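/- Let $n,m\ge 1$ be integers and $\alpha>0$. Let $\mu_k$ be Lebesgue measure on $\mathbb{R}^k$ (with $\mathbb{C}^n\cong\mathbb{R}^{2n}$), and put $\widetilde\mu_k=(2\pi)^{-k/2}\mu_k$. A smooth function $f\colon\mathbb{C}^n\to\mathbb{C}$ is called $m$-analytic if $\overline{D}^k f=0$ for every $k\in\mathbb{N}_0^n$ with $|k|=m$, where $\overline{D}^k=\prod_r(\partial/\partial\overline{z}_r)^{k_r}$. Let $\mathcal{F}_{\alpha,m}$ be the space of $m$-analytic functions on $\mathbb{C}^n$ with $$\|f\|^2_{\mathcal{F}_{\alpha,m}}=\frac{\alpha^n}{\pi^n}\int_{\mathbb{C}^n}|f(z)|^2e^{-\alpha|z|^2}\,d\mu_{2n}(z)<\infty .$$ For $f\in\mathcal{F}_{\alpha,m}$ put $$(Uf)(x,y)=2^{n/2}e^{-\frac12|x|^2-\frac12|y|^2-i\langle x,y\rangle}f\Bigl(\frac{x+iy}{\sqrt\alpha}\Bigr)\qquad(x,y\in\mathbb{R}^n),$$ and let $\mathcal{H}_m=\{Uf: f\in\mathcal{F}_{\alpha,m}\}$, with the inner product and norm of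 $L^2(\mathbb{R}^{2n},\widetilde\mu_{2n})$. Let $F$ be the Fourier--Plancherel transform of $L^2(\mathbb{R}^n,\widetilde\mu_n)$, $(Fg)(\xi)=(2\pi)^{-n/2}\int g(u)e^{-i\langle u,\xi\rangle}\,d\mu_n(u)$ for $g\in L^1\cap L^2$, and let $F\otimes I$ be the corresponding transform of $L^2(\mathbb{R}^{2n},\widetilde\mu_{2n})$ in the first variable $u\in\mathbb{R}^n$ of $(u,v)\in\mathbb{R}^n\times\mathbb{R}^n$. Let $\psi_k(t)=(2^kk!\sqrt\pi)^{-1/2}e^{-t^2/2}H_k(t)$ be the Hermite functions ($H_k$ the physicists' Hermite polynomials), let $J=\{k\in\mathbb{N}_0^n:|k|\le m-1\}$, $d=\#J$, let $\phi\colon\{1,\dots,d\}\to J$ be the enumeration of $J$ in the lexicographic order, and $$q_{k,\xi}(v)=2^{n/2}\pi^{n/4}\prod_{r=1}^n\psi_{k_r}\Bigl(\frac{\xi_r+2v_r}{\sqrt2}\Bigr),\qquad (NG)(\xi)_j=\int_{\mathbb{R}^n}G(\xi,v)\,q_{\phi(j),\xi}(v)\,d\widetilde\mu_n(v)\quad(1\le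 j\le d).$$ Then the following holds. 1. $R_{\mathcal{H}_m}:=N(F\otimes I)$ is a well-defined isometric isomorphism from $\mathcal{H}_m$ onto $L^2(\mathbb{R}^n,\widetilde\mu_n)^d$. If $g\in\mathcal{H}_m$ and $g\in L^1(\mathbb{R}^{2n})$, then for every $j$ and almost every $\xi\in\mathbb{R}^n$ $$(R_{\mathcal{H}_m}g)(\xi)_j=\frac{1}{2^{n/2}\pi^{3n/4}}\int_{\mathbb{R}^{2n}}g(u,v)\,e^{-i\langle u,\xi\rangle}\prod_{r=1}^n\psi_{\phi(j)_r}\Bigl(\frac{\xi_r+2v_r}{\sqrt2}\Bigr)\,d\mu_{2n}(u,v).$$ 2. $R_{\mathcal{F}_{\alpha,m}}:=R_{\mathcal{H}_m}U$ is a well-defined isometric isomorphism from $\mathcal{F}_{\alpha,m}$ onto $L^2(\mathbb{R}^n,\widetilde\mu_n)^d$. If $f\in\mathcal{F}_{\alpha,m}$ and $\int_{\mathbb{C}^n}|f(z)|e^{-\frac{\alpha}{2}|z|^2}\,d\mu_{2n}(z)<\infty$, then for every $j$ and almost every $\xi\in\mathbb{R}^n$ $$(R_{\mathcal{F}_{\alpha,m}}f)(\xi)_j=\frac{1}{\pi^{3n/4}}\int_{\mathbb{R}^{2n}}f\Bigl(\frac{u+iv}{\sqrt\alpha}\Bigr)e^{-\frac12|u|^2-\frac12|v|^2-i\langle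 u,v+\xi\rangle}\prod_{r=1}^n\psi_{\phi(j)_r}\Bigl(\frac{\xi_r+2v_r}{\sqrt2}\Bigr)\,d\mu_{2n}(u,v).$$ -/

import Mathlib

open MeasureTheory Complex
open scoped ContDiff TensorProduct

noncomputable section

namespace PolyFock

/-! ### Polyanalytic functions and the Bargmann–Segal–Fock space -/

/-- The Wirtinger operator `∂/∂z̄_r = (∂/∂x_r + i ∂/∂y_r) / 2` on functions `ℂⁿ → ℂ`. -/
def dbar {n : ℕ} (r : Fin n) (f : (Fin n → ℂ) → ℂ) : (Fin n → ℂ) → ℂ := fun z =>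
  (1 / 2) * (fderiv ℝ f z (Pi.single r 1) + I * fderiv ℝ f z (Pi.single r I))

/-- The Wirtinger operator of multi-index `k`: `∂/∂z̄_r` is applied `k r` times for every `r`. -/
def dbarPow {n : ℕ} (k : Fin n → ℕ) (f : (Fin n → ℂ) → ℂ) : (Fin n → ℂ) → ℂ :=
  (List.finRange n).foldr (fun r g => (dbar r)^[k r] g) f

/-- Homogeneously `m`-analytic functions on `ℂⁿ`. -/
def IsPolyanalytic {n : ℕ} (m : ℕ) (f : (Fin n → ℂ) → ℂ) : Prop :=
  ContDiff ℝ ∞ f ∧ ∀ k : Fin n → ℕ, ∑ r, k r = m → dbarPow k f = 0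

section Linearity

variable {n : ℕ} {f g : (Fin n → ℂ) → ℂ}

lemma contDiff_dbar (r : Fin n) (hf : ContDiff ℝ ∞ f) : ContDiff ℝ ∞ (dbar r f) := by
  have h : ContDiff ℝ ∞ (fderiv ℝ f) := hf.fderiv_right (by simp)
  unfold dbar
  fun_prop

lemma dbar_add (r : Fin n) (hf : ContDiff ℝ ∞ f) (hg : ContDiff ℝ ∞ g) :
    dbar r (f + g) = dbar r f + dbar r g := by
  funext z
  have hf' := (hf.differentiable (by simp)) z
  have hg' := (hg.differentiable (by simp)) z
  simp only [dbar, fderiv_add hf' hg', Pi.add_apply, add_apply]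
  ring

lemma dbar_smul (r : Fin n) (c : ℂ) (hf : ContDiff ℝ ∞ f) :
    dbar r (c • f) = c • dbar r f := by
  funext z
  have hf' := (hf.differentiable (by simp)) z
  simp only [dbar, fderiv_const_smul hf', Pi.smul_apply, smul_apply,
    smul_eq_mul]
  ring

lemma dbar_iterate (r : Fin n) (p : ℕ) (c : ℂ) (hf : ContDiff ℝ ∞ f) (hg : ContDiff ℝ ∞ g) :
    ContDiff ℝ ∞ ((dbar r)^[p] f) ∧
    (dbar r)^[p] (f + g) = (dbar r)^[p] f + (dbar r)^[p] g ∧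
    (dbar r)^[p] (c • f) = c • (dbar r)^[p] f := by
  induction p generalizing f g with
  | zero => exact ⟨hf, rfl, rfl⟩
  | succ p ih =>
    simp only [Function.iterate_succ, Function.comp_apply, dbar_add r hf hg, dbar_smul r c hf]
    exact ih (contDiff_dbar r hf) (contDiff_dbar r hg)

lemma dbarPow_linear (k : Fin n → ℕ) (c : ℂ) (hf : ContDiff ℝ ∞ f) (hg : ContDiff ℝ ∞ g) :
    dbarPow k (f + g) = dbarPow k f + dbarPow k g ∧ dbarPow k (c • f) = c • dbarPow k f := by
  unfold dbarPow
  have key : ∀ l : List (Fin n), ∀ f : (Fin n → ℂ) → ℂ, ContDiff ℝ ∞ f →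
      ContDiff ℝ ∞ (l.foldr (fun r g => (dbar r)^[k r] g) f) := by
    intro l f hf
    induction l with
    | nil => exact hf
    | cons r l ih => exact (dbar_iterate r (k r) c ih ih).1
  induction List.finRange n with
  | nil => exact ⟨rfl, rfl⟩
  | cons r l ih =>
    simp only [List.foldr_cons, ih.1, ih.2]
    exact (dbar_iterate r (k r) c (key l f hf) (key l g hg)).2

end Linearity

/-- The Gaussian measure `(α/π)ⁿ exp(-α |z|²) dμ_{2n}(z)` on `ℂⁿ`. -/
def gaussian (α : ℝ) (n : ℕ) : Measure (Fin n → ℂ) :=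
  volume.withDensity fun z =>
    ENNReal.ofReal ((α ^ n / Real.pi ^ n) * Real.exp (-α * ∑ r, ‖z r‖ ^ 2))

/-- The `m`-analytic Bargmann–Segal–Fock space `F_{α,m}(ℂⁿ)`. -/
def Fock (α : ℝ) (n m : ℕ) : Submodule ℂ ((Fin n → ℂ) → ℂ) where
  carrier := {f | IsPolyanalytic m f ∧ MemLp f 2 (gaussian α n)}
  zero_mem' := by
    have h0 : ContDiff ℝ ∞ (0 : (Fin n → ℂ) → ℂ) := contDiff_const
    refine ⟨⟨h0, fun k _ => ?_⟩, MemLp.zero⟩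
    simpa using (dbarPow_linear k 0 h0 h0).2
  add_mem' := by
    rintro f g ⟨⟨hf, hf'⟩, hf2⟩ ⟨⟨hg, hg'⟩, hg2⟩
    refine ⟨⟨hf.add hg, fun k hk => ?_⟩, hf2.add hg2⟩
    rw [(dbarPow_linear k 0 hf hg).1, hf' k hk, hg' k hk, add_zero]
  smul_mem' := by
    rintro c f ⟨⟨hf, hf'⟩, hf2⟩
    refine ⟨⟨contDiff_const.smul hf, fun k hk => ?_⟩, hf2.const_smul c⟩
    rw [(dbarPow_linear k c hf hf).2, hf' k hk, smul_zero]

/-- The class in `L²` of an element of the Fock space. -/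
def Fock.toLp (α : ℝ) (n m : ℕ) : Fock α n m →ₗ[ℂ] Lp ℂ 2 (gaussian α n) where
  toFun f := MemLp.toLp f.1 f.2.2
  map_add' _ _ := rfl
  map_smul' _ _ := rfl

lemma Fock.toLp_injective (α : ℝ) [hα : Fact (0 < α)] (n m : ℕ) :
    Function.Injective (Fock.toLp α n m) := by
  intro f g h
  have hα' := hα.out
  have h1 : f.1 =ᵐ[gaussian α n] g.1 := (MemLp.toLp_eq_toLp_iff f.2.2 g.2.2).1 h
  have h2 : (volume : Measure (Fin n → ℂ)) ≪ gaussian α n := by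
    apply withDensity_absolutelyContinuous'
    · apply Measurable.aemeasurable
      fun_prop
    · refine Filter.Eventually.of_forall fun z => ?_
      have : 0 < (α ^ n / Real.pi ^ n) * Real.exp (-α * ∑ r, ‖z r‖ ^ 2) := by positivity
      simpa using this
  exact Subtype.ext
    ((Continuous.ae_eq_iff_eq volume f.2.1.1.continuous g.2.1.1.continuous).1 (h2.ae_eq h1))

/-- The norm of `F_{α,m}` is the norm of `L²(ℂⁿ, (α/π)ⁿ exp(-α |z|²) dμ_{2n}(z))`. -/
instance (α : ℝ) [Fact (0 < α)] (n m : ℕ) : NormedAddCommGroup (Fock α n m) :=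
  NormedAddCommGroup.induced _ _ (Fock.toLp α n m) (Fock.toLp_injective α n m)

instance (α : ℝ) [Fact (0 < α)] (n m : ℕ) : InnerProductSpace ℂ (Fock α n m) :=
  InnerProductSpace.induced (Fock.toLp α n m)

/-! ### The flattened space -/

/-- The Euclidean space `ℝⁿ`. -/
abbrev E (n : ℕ) : Type := EuclideanSpace ℝ (Fin n)

/-- The Lebesgue measure of `ℝⁿ` multiplied by `(2π)^{-n/2}`. -/
def muTilde (n : ℕ) : Measure (E n) :=
  ENNReal.ofReal ((2 * Real.pi) ^ (-(n : ℝ) / 2)) • volume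

instance (n : ℕ) : (muTilde n).IsAddHaarMeasure :=
  Measure.IsAddHaarMeasure.smul _ (by simp; positivity) ENNReal.ofReal_ne_top

/-- The measure `(2π)^{-n} μ_{2n}` on `ℝ²ⁿ = ℝⁿ × ℝⁿ`. -/
abbrev muTilde2 (n : ℕ) : Measure (E n × E n) := (muTilde n).prod (muTilde n)

/-- The point `(x + i y) / √α` of `ℂⁿ`. -/
def cpoint (α : ℝ) {n : ℕ} (p : E n × E n) : Fin n → ℂ := fun r =>
  ((p.1 r : ℂ) + I * (p.2 r : ℂ)) / (Real.sqrt α : ℂ)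

/-- The flattening operator
`(U f)(x, y) = 2^{n/2} exp(-|x|²/2 - |y|²/2 - i⟨x,y⟩) f((x + i y)/√α)`. -/
def flatten (α : ℝ) (n : ℕ) : ((Fin n → ℂ) → ℂ) →ₗ[ℂ] (E n × E n → ℂ) where
  toFun f p := (((2 : ℝ) ^ ((n : ℝ) / 2) : ℝ) : ℂ) *
    cexp (-(‖p.1‖ ^ 2 : ℝ) / 2 - (‖p.2‖ ^ 2 : ℝ) / 2 - I * (inner ℝ p.1 p.2 : ℝ)) *
      f (cpoint α p)
  map_add' f g := by
    funext p
    simp only [Pi.add_apply]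
    ring
  map_smul' c f := by
    funext p
    simp only [Pi.smul_apply, smul_eq_mul, RingHom.id_apply]
    ring

/-- The flattened space `H_m`, the image of `F_{α,m}` under the flattening operator. -/
def FlatFock (α : ℝ) (n m : ℕ) : Submodule ℂ (E n × E n → ℂ) :=
  (Fock α n m).map (flatten α n)

/-- The flattening operator as a map `F_{α,m} → H_m`. -/
def U (α : ℝ) (n m : ℕ) : Fock α n m →ₗ[ℂ] FlatFock α n m :=
  (flatten α n).submoduleMap (Fock α n m)

section Change

/-- `(x, y) ↦ (x + i y) / √α` as a linear isomorphism. -/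
def cpointEquiv (α : ℝ) [hα : Fact (0 < α)] (n : ℕ) : (E n × E n) ≃L[ℝ] (Fin n → ℂ) :=
  LinearEquiv.toContinuousLinearEquiv
    { toFun := cpoint α
      invFun := fun z => (WithLp.toLp 2 fun r => Real.sqrt α * (z r).re,
        WithLp.toLp 2 fun r => Real.sqrt α * (z r).im)
      map_add' := fun p q => by
        funext r
        simp only [cpoint, Prod.fst_add, Prod.snd_add, PiLp.add_apply, Pi.add_apply]
        push_cast
        ring
      map_smul' := fun c p => by
        funext r
        simp only [cpoint, Prod.smul_fst, Prod.smul_snd, PiLp.smul_apply, Pi.smul_apply,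
          RingHom.id_apply, smul_eq_mul, real_smul]
        push_cast
        ring
      left_inv := fun p => by
        have h : Real.sqrt α ≠ 0 := (Real.sqrt_pos.2 hα.out).ne'
        ext r <;> simp [cpoint, div_ofReal_re, div_ofReal_im] <;> field_simp
      right_inv := fun z => by
        have h : (Real.sqrt α : ℂ) ≠ 0 := by
          exact_mod_cast (Real.sqrt_pos.2 hα.out).ne'
        funext r
        simp only [cpoint, ofReal_mul]
        rw [div_eq_iff h]
        conv_rhs => rw [← re_add_im (z r)]
        ring }

lemma continuous_cpoint (α : ℝ) [Fact (0 < α)] (n : ℕ) :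
    Continuous (cpoint α : E n × E n → Fin n → ℂ) := (cpointEquiv α n).continuous

lemma continuous_flatten (α : ℝ) [Fact (0 < α)] {n : ℕ} {f : (Fin n → ℂ) → ℂ}
    (hf : Continuous f) : Continuous (flatten α n f) := by
  have h := hf.comp (continuous_cpoint α n)
  simp only [flatten, LinearMap.coe_mk, AddHom.coe_mk]
  exact Continuous.mul (by fun_prop) h

lemma norm_cpoint (α : ℝ) [hα : Fact (0 < α)] {n : ℕ} (p : E n × E n) :
    α * ∑ r, ‖cpoint α p r‖ ^ 2 = ‖p.1‖ ^ 2 + ‖p.2‖ ^ 2 := by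
  have h := hα.out
  rw [EuclideanSpace.norm_sq_eq, EuclideanSpace.norm_sq_eq, Finset.mul_sum,
    ← Finset.sum_add_distrib]
  refine Finset.sum_congr rfl fun r _ => ?_
  have h2 : ‖(Real.sqrt α : ℂ)‖ ^ 2 = α := by
    rw [norm_real, Real.norm_eq_abs, sq_abs, Real.sq_sqrt h.le]
  rw [cpoint, norm_div, div_pow, h2, mul_div_cancel₀ _ h.ne', ← normSq_eq_norm_sq, normSq_apply]
  simp
  ring

lemma memLp_flatten (α : ℝ) [hα : Fact (0 < α)] {n m : ℕ} {f : (Fin n → ℂ) → ℂ}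
    (hf : f ∈ Fock α n m) : MemLp (flatten α n f) 2 (muTilde2 n) := by
  have hα' := hα.out
  have hc : Continuous f := hf.1.1.continuous
  rw [memLp_two_iff_integrable_sq_norm (continuous_flatten α hc).aestronglyMeasurable]
  have h1 := (memLp_two_iff_integrable_sq_norm hf.2.1).1 hf.2
  rw [gaussian, integrable_withDensity_iff_integrable_smul' (by fun_prop) (by simp)] at h1
  have h2 : Integrable (fun z => (ENNReal.ofReal
      ((α ^ n / Real.pi ^ n) * Real.exp (-α * ∑ r, ‖z r‖ ^ 2))).toReal • ‖f z‖ ^ 2)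
      ((muTilde2 n).map (cpointEquiv α n)) := by
    have : ((muTilde2 n).map (cpointEquiv α n)).IsAddHaarMeasure :=
      (cpointEquiv α n).isAddHaarMeasure_map _
    rw [Measure.isAddLeftInvariant_eq_smul ((muTilde2 n).map (cpointEquiv α n)) volume]
    exact h1.smul_measure_nnreal
  have h3 := (integrable_map_measure h2.aestronglyMeasurable
    (cpointEquiv α n).continuous.aemeasurable).1 h2
  refine (h3.const_mul (2 ^ n / (α ^ n / Real.pi ^ n))).congr
    (Filter.Eventually.of_forall fun p => ?_)
  have e1 : (cpointEquiv α n) p = cpoint α p := rfl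
  have e2 : (0 : ℝ) ≤ (α ^ n / Real.pi ^ n) * Real.exp (-(‖p.1‖ ^ 2 + ‖p.2‖ ^ 2)) := by positivity
  have e3 : ((2 : ℝ) ^ ((n : ℝ) / 2)) ^ 2 = 2 ^ n := by
    rw [← Real.rpow_natCast, ← Real.rpow_mul (by norm_num), ← Real.rpow_natCast]
    congr 1
    push_cast
    ring
  have e4 : ‖cexp (-(‖p.1‖ ^ 2 : ℝ) / 2 - (‖p.2‖ ^ 2 : ℝ) / 2 - I * (inner ℝ p.1 p.2 : ℝ))‖ ^ 2
      = Real.exp (-(‖p.1‖ ^ 2 + ‖p.2‖ ^ 2)) := by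
    rw [norm_exp, ← Real.exp_nat_mul]
    congr 1
    have : (-(‖p.1‖ ^ 2 : ℝ) / 2 - (‖p.2‖ ^ 2 : ℝ) / 2 - I * (inner ℝ p.1 p.2 : ℝ) : ℂ).re
        = -‖p.1‖ ^ 2 / 2 - ‖p.2‖ ^ 2 / 2 := by
      simp only [sub_re, mul_re, I_re, I_im, ofReal_re, ofReal_im, neg_re, div_ofNat_re]
      ring
    rw [this]
    push_cast
    ring
  have e5 : (0 : ℝ) ≤ (2 : ℝ) ^ ((n : ℝ) / 2) := by positivity
  simp only [Function.comp_apply, e1, neg_mul, norm_cpoint, ENNReal.toReal_ofReal e2, flatten,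
    LinearMap.coe_mk, AddHom.coe_mk, norm_mul, mul_pow, smul_eq_mul, norm_real,
    Real.norm_of_nonneg e5, e3]
  rw [e4]
  have : α ^ n / Real.pi ^ n ≠ 0 := by positivity
  field_simp

lemma FlatFock.continuous (α : ℝ) [Fact (0 < α)] {n m : ℕ} (g : FlatFock α n m) :
    Continuous g.1 := by
  obtain ⟨f, hf, h⟩ := g.2
  exact h ▸ continuous_flatten α hf.1.1.continuous

lemma FlatFock.memLp (α : ℝ) [Fact (0 < α)] {n m : ℕ} (g : FlatFock α n m) :
    MemLp g.1 2 (muTilde2 n) := by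
  obtain ⟨f, hf, h⟩ := g.2
  exact h ▸ memLp_flatten α hf

end Change

/-- The class in `L²(ℝ²ⁿ, (2π)^{-n} μ_{2n})` of an element of `H_m`. -/
def FlatFock.toLp (α : ℝ) [Fact (0 < α)] (n m : ℕ) :
    FlatFock α n m →ₗ[ℂ] Lp ℂ 2 (muTilde2 n) where
  toFun g := MemLp.toLp g.1 (FlatFock.memLp α g)
  map_add' _ _ := rfl
  map_smul' _ _ := rfl

lemma FlatFock.toLp_injective (α : ℝ) [Fact (0 < α)] (n m : ℕ) :
    Function.Injective (FlatFock.toLp α n m) := fun f g h =>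
  Subtype.ext ((Continuous.ae_eq_iff_eq (muTilde2 n) (FlatFock.continuous α f)
    (FlatFock.continuous α g)).1 
    ((MemLp.toLp_eq_toLp_iff (FlatFock.memLp α f) (FlatFock.memLp α g)).1 h))

/-- The norm of `H_m` is the norm of `L²(ℝ²ⁿ, (2π)^{-n} μ_{2n})`. -/
instance (α : ℝ) [Fact (0 < α)] (n m : ℕ) : NormedAddCommGroup (FlatFock α n m) :=
  NormedAddCommGroup.induced _ _ (FlatFock.toLp α n m) (FlatFock.toLp_injective α n m)

instance (α : ℝ) [Fact (0 < α)] (n m : ℕ) : InnerProductSpace ℂ (FlatFock α n m) :=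
  InnerProductSpace.induced (FlatFock.toLp α n m)

/-! ### The Fourier–Plancherel transform and its action in the first variable -/

/-- The dilation by `√(2π)` carries `μ_n` to `(2π)^{-n/2} μ_n`. -/
lemma measurePreserving_dilation (n : ℕ) :
    MeasurePreserving (fun x : E n => Real.sqrt (2 * Real.pi) • x) volume (muTilde n) := by
  have h : (0 : ℝ) < Real.sqrt (2 * Real.pi) := Real.sqrt_pos.2 (by positivity)
  refine ⟨by fun_prop, ?_⟩
  rw [Measure.map_addHaar_smul volume h.ne', muTilde]
  congr 2
  rw [finrank_euclideanSpace, Fintype.card_fin, abs_of_pos (by positivity), Real.sqrt_eq_rpow,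
    ← Real.rpow_natCast, ← Real.rpow_mul (by positivity), ← Real.rpow_neg (by positivity)]
  congr 1
  ring

lemma measurePreserving_dilation_symm (n : ℕ) :
    MeasurePreserving (fun x : E n => (Real.sqrt (2 * Real.pi))⁻¹ • x) (muTilde n) volume := by
  have h : (0 : ℝ) < Real.sqrt (2 * Real.pi) := Real.sqrt_pos.2 (by positivity)
  refine ⟨by fun_prop, ?_⟩
  rw [← (measurePreserving_dilation n).map_eq, Measure.map_map (by fun_prop) (by fun_prop)]
  convert Measure.map_id
  funext x
  simp only [Function.comp_apply, smul_smul, inv_mul_cancel₀ h.ne', one_smul, id]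

/-- The Fourier–Plancherel transform `F` on `L²(ℝⁿ, (2π)^{-n/2} μ_n)`, which on integrable
functions is `(F g)(ξ) = (2π)^{-n/2} ∫ g(u) exp(-i⟨u,ξ⟩) du`. Substituting `u = √(2π) s` and
`ξ = √(2π) w` gives `(F g)(√(2π) w) = ∫ g(√(2π) s) exp(-2πi⟨s,w⟩) ds`, so that `F` is Mathlib's
transform on `L²(ℝⁿ, μ_n)` conjugated by the dilation by `√(2π)`. -/
def fourierF (n : ℕ) : Lp ℂ 2 (muTilde n) →ₗ[ℂ] Lp ℂ 2 (muTilde n) :=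
  (Lp.compMeasurePreservingₗᵢ ℂ _ (measurePreserving_dilation_symm n)).toLinearMap ∘ₗ
    (Lp.fourierTransformₗᵢ (E n) ℂ).toLinearIsometry.toLinearMap ∘ₗ
      (Lp.compMeasurePreservingₗᵢ ℂ _ (measurePreserving_dilation n)).toLinearMap

lemma memLp_tensor {n : ℕ} {f h : E n → ℂ} (hf : MemLp f 2 (muTilde n))
    (hh : MemLp h 2 (muTilde n)) :
    MemLp (fun p : E n × E n => f p.1 * h p.2) 2 (muTilde2 n) := by
  have h1 := (memLp_two_iff_integrable_sq_norm hf.1).1 hf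
  have h2 := (memLp_two_iff_integrable_sq_norm hh.1).1 hh
  refine (memLp_two_iff_integrable_sq_norm (hf.1.comp_fst.mul hh.1.comp_snd)).2 ?_
  simpa only [Pi.mul_apply, norm_mul, mul_pow] using h1.mul_prod h2

/-- The inclusion of the algebraic tensor product `L²(ℝⁿ) ⊗ L²(ℝⁿ)` in `L²(ℝⁿ × ℝⁿ)`, which sends
`f ⊗ h` to the class of `(x, y) ↦ f(x) h(y)`. Its range is dense. -/
def tensorIncl (n : ℕ) :
    Lp ℂ 2 (muTilde n) ⊗[ℂ] Lp ℂ 2 (muTilde n) →ₗ[ℂ] Lp ℂ 2 (muTilde2 n) :=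
  TensorProduct.lift <| LinearMap.mk₂ ℂ
    (fun f h => MemLp.toLp _ (memLp_tensor (Lp.memLp f) (Lp.memLp h)))
    (fun f g h => by
      rw [← MemLp.toLp_add, MemLp.toLp_eq_toLp_iff]
      filter_upwards [Measure.quasiMeasurePreserving_fst.ae (Lp.coeFn_add f g)] with p hp
      simp only [hp, Pi.add_apply, add_mul])
    (fun c f h => by
      rw [← MemLp.toLp_const_smul, MemLp.toLp_eq_toLp_iff]
      filter_upwards [Measure.quasiMeasurePreserving_fst.ae (Lp.coeFn_smul c f)] with p hp
      simp [hp, mul_assoc])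
    (fun f g h => by
      rw [← MemLp.toLp_add, MemLp.toLp_eq_toLp_iff]
      filter_upwards [Measure.quasiMeasurePreserving_snd.ae (Lp.coeFn_add g h)] with p hp
      simp only [hp, Pi.add_apply, mul_add])
    (fun c f h => by
      rw [← MemLp.toLp_const_smul, MemLp.toLp_eq_toLp_iff]
      filter_upwards [Measure.quasiMeasurePreserving_snd.ae (Lp.coeFn_smul c h)] with p hp
      simp [hp, mul_left_comm])

/-- The horizontal Fourier transform `F ⊗ I` on `L²(ℝ²ⁿ, (2π)^{-n} μ_{2n})`: the continuous
extension of `f ⊗ h ↦ (F f) ⊗ h` from the algebraic tensor product. -/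
def fourierTensorId (n : ℕ) : Lp ℂ 2 (muTilde2 n) →L[ℂ] Lp ℂ 2 (muTilde2 n) :=
  (tensorIncl n ∘ₗ TensorProduct.map (fourierF n) LinearMap.id).extendOfNorm (tensorIncl n)

/-! ### Hermite functions and the operators `N`, `R` -/

/-- The physicists' Hermite polynomials: `H_0 = 1`, `H_{k+1} = 2 X H_k - H_k'`. -/
def hermitePoly : ℕ → Polynomial ℝ
  | 0 => 1
  | k + 1 => 2 * Polynomial.X * hermitePoly k - Polynomial.derivative (hermitePoly k)

/-- The Hermite functions `ψ_k(t) = (2^k k! √π)^{-1/2} exp(-t²/2) H_k(t)`. -/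
def hermiteFun (k : ℕ) (t : ℝ) : ℝ :=
  ((2 : ℝ) ^ k * (k.factorial : ℝ) * Real.sqrt Real.pi) ^ (-(1 / 2) : ℝ) *
    Real.exp (-(1 / 2) * t ^ 2) * (hermitePoly k).eval t

/-- The set `J_{n,m}` of multi-indices `k ∈ ℕ₀ⁿ` with `|k| ≤ m - 1`, as a set in the
lexicographically ordered type of multi-indices. -/
def J (n m : ℕ) : Finset (Lex (Fin n → ℕ)) :=
  ((Fintype.piFinset fun _ : Fin n => Finset.range m).filter fun k => ∑ r, k r < m).map
    (toLex : (Fin n → ℕ) ≃ Lex (Fin n → ℕ)).toEmbedding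

/-- The number `d` of elements of `J_{n,m}`. -/
def dim (n m : ℕ) : ℕ := (J n m).card

/-- The enumeration `φ` of `J_{n,m}` in the lexicographic order. -/
def phi (n m : ℕ) (j : Fin (dim n m)) : Fin n → ℕ := ofLex ((J n m).orderEmbOfFin rfl j)

/-- The product `∏_r ψ_{φ(j)_r}((ξ_r + 2 v_r)/√2)`. -/
def hermiteProd {n m : ℕ} (j : Fin (dim n m)) (ξ v : E n) : ℝ :=
  ∏ r, hermiteFun (phi n m j r) ((ξ r + 2 * v r) / Real.sqrt 2)

/-- The functions `q_{φ(j),ξ}(v) = 2^{n/2} π^{n/4} ∏_r ψ_{φ(j)_r}((ξ_r + 2 v_r)/√2)`. -/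
def q {n m : ℕ} (j : Fin (dim n m)) (ξ v : E n) : ℝ :=
  (2 : ℝ) ^ ((n : ℝ) / 2) * Real.pi ^ ((n : ℝ) / 4) * hermiteProd j ξ v

/-- `(N G)(ξ)_j = ⟨G(ξ,·), q_{φ(j),ξ}⟩` in `L²(ℝⁿ, (2π)^{-n/2} μ_n)`. -/
def N {n m : ℕ} (G : Lp ℂ 2 (muTilde2 n)) (ξ : E n) (j : Fin (dim n m)) : ℂ :=
  ∫ v, G (ξ, v) * (q j ξ v : ℂ) ∂(muTilde n)

/-- `R_{H_m} = N (F ⊗ I)`. -/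
def RFlat (α : ℝ) [Fact (0 < α)] {n m : ℕ} (g : FlatFock α n m) (ξ : E n)
    (j : Fin (dim n m)) : ℂ :=
  N (fourierTensorId n (FlatFock.toLp α n m g)) ξ j

/-- `R_{F_{α,m}} = R_{H_m} U`. -/
def RFock (α : ℝ) [Fact (0 < α)] {n m : ℕ} (f : Fock α n m) (ξ : E n)
    (j : Fin (dim n m)) : ℂ :=
  RFlat α (U α n m f) ξ j

/-- The Hilbert space `L²(ℝⁿ, (2π)^{-n/2} μ_n)^d`. -/
abbrev Target (n m : ℕ) : Type := PiLp 2 fun _ : Fin (dim n m) => Lp ℂ 2 (muTilde n)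

end PolyFock

end

open MeasureTheory Complex
open scoped ContDiff TensorProduct

noncomputable section

namespace PolyFock

section

/-! ### The Fourier transform on `L¹ ∩ L²` -/

section Fourier

open FourierTransform SchwartzMap

variable {V : Type*} [NormedAddCommGroup V] [InnerProductSpace ℝ V] [FiniteDimensional ℝ V]
  [MeasurableSpace V] [BorelSpace V]

/-! For each fixed `ξ` the functions `q_{k,ξ}`, with `k` over all multi-indices, form an orthonormal
basis of `L²` in the variable `v` (`integral_qk_mul_qk`, `ae_eq_zero_of_integral_qk_eq_zero`). Hence
the maps `c ↦ c(ξ) q_{k,ξ}(v)`, called `hermiteLift k`, are isometries of `L²(ℝⁿ)` into `L²(ℝ²ⁿ)`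
with mutually orthogonal ranges, and these ranges together span a dense subspace. The components of
`N` are their adjoints `hermiteCoeff`. Since `U` and `F ⊗ I` preserve norms, the theorem reduces to
one claim: `F ⊗ I` carries `H_m` exactly onto the sum of the ranges with `|k| < m`.

Coefficients of degree at least `m` vanish (`hermiteCoeff_fourierTensorId_eq_zero`). The coefficient
is tested against the total family `gaussWave s`. The inverse partial transform of `gaussWave s ξ *
q_{k,ξ}(v)` is an explicit function, `waveKernel`. After conjugation and multiplication by a
flattened `f` it becomes a constant times `f` times `fockKernel`, that is `(az+s)^k exp(-(az+s)·a
z̄)` with `a = √α`. On this kernel `∂/∂z̄_r` acts as multiplication by `-a` together with `k ↦ k +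
e_r`. A kernel of degree at least `m` is therefore a multiple of an `m`-th order `∂̄`-derivative of
another one, and integration by parts with a cutoff moves these derivatives onto `f`, where they
give zero (`integral_mul_fockKernel_eq_zero`).

Conversely, every lift with `|k| < m` is attained (`exists_fourierTensorId_eq_hermiteLift`).
Expanding the Hermite polynomials of `(ξ+2y)/√2` in powers of `y`, the inverse partial transform of
`c(ξ) q_{k,ξ}` is the flattening of a sum of terms `(Im z)^b` times an entire function, with `|b| ≤
|k|`. Each factor `Im z_j` raises the order of polyanalyticity by one, so the order is at most `m`
(`flatten_fockLift`, `isPolyanalytic_fockLift`).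

The integral formulas follow because the Plancherel transform is the Fourier integral on `L¹ ∩ L²`,
slice by slice, and Fubini merges it with the integral in `N`. -/

lemma integral_schwartz_mul_fourier {f : V → ℂ} (hf : Integrable f) (φ : 𝓢(V, ℂ)) :
    ∫ x, 𝓕 φ x • f x = ∫ x, φ x • 𝓕 f x := by
  simpa using! VectorFourier.integral_fourierIntegral_smul_eq_flip (L := innerₗ V)
    Real.continuous_fourierChar continuous_inner φ.integrable hf

lemma integral_schwartz_mul_fourierInv {f : V → ℂ} (hf : Integrable f) (φ : 𝓢(V, ℂ)) :
    ∫ x, 𝓕⁻ φ x • f x = ∫ x, φ x • 𝓕⁻ f x := by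
  -- The inverse transform is the transform attached to the pairing `-⟨x, y⟩`, which is its own
  -- flip.
  have h := VectorFourier.integral_fourierIntegral_smul_eq_flip (L := -innerₗ V)
    (μ := volume) (ν := volume)
    Real.continuous_fourierChar continuous_inner.neg φ.integrable hf
  have h2 : (-innerₗ V).flip = -innerₗ V := by
    ext x y
    simp [real_inner_comm]
  rw [h2] at h
  rw [SchwartzMap.fourierInv_coe]
  exact h

/-- Smooth functions of compact support are Schwartz functions and already separate locally
integrable functions. This converts equalities of tempered distributions into equalities almost
everywhere. -/
lemma ae_eq_of_integral_schwartz_eq {f g : V → ℂ} (hf : LocallyIntegrable f)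
    (hg : LocallyIntegrable g)
    (h : ∀ φ : 𝓢(V, ℂ), ∫ x, φ x • f x = ∫ x, φ x • g x) : f =ᵐ[volume] g := by
  refine ae_eq_of_integral_contDiff_smul_eq hf hg fun φ hφ hφc => ?_
  have hc : HasCompactSupport (fun x => (φ x : ℂ)) := hφc.comp_left (g := ((↑) : ℝ → ℂ)) (by simp)
  exact h (hc.toSchwartzMap (Complex.ofRealCLM.contDiff.comp hφ))

/-- An integrable function whose Fourier transform vanishes is zero almost everywhere. -/
lemma ae_eq_zero_of_fourier_eq_zero {f : V → ℂ} (hf : Integrable f) (h : ∀ w, 𝓕 f w = 0) :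
    f =ᵐ[volume] 0 := by
  refine ae_eq_of_integral_schwartz_eq hf.locallyIntegrable
    (integrable_zero _ _ _).locallyIntegrable fun φ => ?_
  -- Every test function is itself a Fourier transform, so its pairing with `f` moves onto `𝓕 f`.
  have h1 := integral_schwartz_mul_fourier hf (𝓕⁻ φ)
  rw [FourierTransform.fourier_fourierInv_eq] at h1
  rw [h1]
  simp [h]

/-- The Fourier transform of `L²` is given by the Fourier integral on `L¹ ∩ L²`. -/
lemma fourier_toLp_ae_eq {f : V → ℂ} (hf : Integrable f) (hf2 : MemLp f 2) :
    (𝓕 (hf2.toLp f) : Lp ℂ 2 (volume : Measure V)) =ᵐ[volume] 𝓕 f := by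
  refine ae_eq_of_integral_schwartz_eq ((Lp.memLp _).locallyIntegrable (by norm_num))
    (Continuous.locallyIntegrable ?_) fun φ => ?_
  · exact VectorFourier.fourierIntegral_continuous Real.continuous_fourierChar
      continuous_inner hf
  -- Both sides equal the pairing of `f` with `𝓕 φ`: one by the flip formula, the other because the
  -- `L²` transform agrees with the distributional one.
  · rw [← integral_schwartz_mul_fourier hf, ← Lp.toTemperedDistribution_apply,
      ← Lp.fourier_toTemperedDistribution_eq, TemperedDistribution.fourier_apply,
      Lp.toTemperedDistribution_apply]
    refine integral_congr_ae ?_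
    filter_upwards [hf2.coeFn_toLp] with x hx
    rw [hx]

/-- The inverse Fourier transform of `L²` is given by the Fourier integral on `L¹ ∩ L²`. -/
lemma fourierInv_toLp_ae_eq {f : V → ℂ} (hf : Integrable f) (hf2 : MemLp f 2) :
    (𝓕⁻ (hf2.toLp f) : Lp ℂ 2 (volume : Measure V)) =ᵐ[volume] 𝓕⁻ f := by
  refine ae_eq_of_integral_schwartz_eq ((Lp.memLp _).locallyIntegrable (by norm_num))
    (Continuous.locallyIntegrable ?_) fun φ => ?_
  · exact VectorFourier.fourierIntegral_continuous Real.continuous_fourierChar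
      continuous_inner.neg hf
  · rw [← integral_schwartz_mul_fourierInv hf, ← Lp.toTemperedDistribution_apply,
      ← Lp.fourierInv_toTemperedDistribution_eq, TemperedDistribution.fourierInv_apply,
      Lp.toTemperedDistribution_apply]
    refine integral_congr_ae ?_
    filter_upwards [hf2.coeFn_toLp] with x hx
    rw [hx]

end Fourier

/-! ### The normalized Lebesgue measure and the transform `F` as an isometric automorphism -/

lemma sqrt_two_pi_pos : 0 < Real.sqrt (2 * Real.pi) := Real.sqrt_pos.2 (by positivity)

lemma muTilde_absolutelyContinuous (n : ℕ) : muTilde n ≪ volume :=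
  Measure.smul_absolutelyContinuous

lemma volume_absolutelyContinuous_muTilde (n : ℕ) : (volume : Measure (E n)) ≪ muTilde n :=
  Measure.absolutelyContinuous_smul (by simp; positivity)

lemma ae_muTilde_iff {n : ℕ} {p : E n → Prop} :
    (∀ᵐ x ∂(muTilde n), p x) ↔ ∀ᵐ x, p x :=
  ⟨fun h => (volume_absolutelyContinuous_muTilde n).ae_le h,
    fun h => (muTilde_absolutelyContinuous n).ae_le h⟩

lemma integral_muTilde {n : ℕ} (f : E n → ℂ) :
    ∫ x, f x ∂(muTilde n) = (((2 * Real.pi) ^ (-(n : ℝ) / 2) : ℝ) : ℂ) * ∫ x, f x := by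
  rw [muTilde, integral_smul_measure, ENNReal.toReal_ofReal (by positivity)]
  simp

lemma integrable_muTilde_iff {n : ℕ} {f : E n → ℂ} :
    Integrable f (muTilde n) ↔ Integrable f := by
  rw [muTilde, integrable_smul_measure (by simp; positivity) ENNReal.ofReal_ne_top]

/-- Composition with the dilation by `√(2π)` as an isometric isomorphism. -/
def dilationEquiv (n : ℕ) : Lp ℂ 2 (muTilde n) ≃ₗᵢ[ℂ] Lp ℂ 2 (volume : Measure (E n)) where
  toLinearEquiv := LinearEquiv.ofLinearMap
    (Lp.compMeasurePreservingₗᵢ ℂ _ (measurePreserving_dilation n)).toLinearMap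
    (Lp.compMeasurePreservingₗᵢ ℂ _ (measurePreserving_dilation_symm n)).toLinearMap
    (by
      refine LinearMap.ext fun f => ?_
      have h : (fun x : E n => (Real.sqrt (2 * Real.pi))⁻¹ • x) ∘
          (fun x : E n => Real.sqrt (2 * Real.pi) • x) = id := by
        funext x
        simp only [Function.comp_apply, smul_smul, inv_mul_cancel₀ sqrt_two_pi_pos.ne', one_smul, id]
      refine (Lp.compMeasurePreserving_comp_apply f (measurePreserving_dilation_symm n)
        (measurePreserving_dilation n)).symm.trans ?_
      simp only [h]
      simp)
    (by
      refine LinearMap.ext fun f => ?_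
      have h : (fun x : E n => Real.sqrt (2 * Real.pi) • x) ∘
          (fun x : E n => (Real.sqrt (2 * Real.pi))⁻¹ • x) = id := by
        funext x
        simp only [Function.comp_apply, smul_smul, mul_inv_cancel₀ sqrt_two_pi_pos.ne', one_smul, id]
      refine (Lp.compMeasurePreserving_comp_apply f (measurePreserving_dilation n)
        (measurePreserving_dilation_symm n)).symm.trans ?_
      simp only [h]
      simp)
  norm_map' f := (Lp.compMeasurePreservingₗᵢ ℂ _ (measurePreserving_dilation n)).norm_map f

/-- The transform `F` as an isometric automorphism of `L²(ℝⁿ, (2π)^{-n/2} μ_n)`. -/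
def fourierFEquiv (n : ℕ) : Lp ℂ 2 (muTilde n) ≃ₗᵢ[ℂ] Lp ℂ 2 (muTilde n) :=
  (dilationEquiv n).trans ((Lp.fourierTransformₗᵢ (E n) ℂ).trans (dilationEquiv n).symm)

lemma fourierFEquiv_apply {n : ℕ} (f : Lp ℂ 2 (muTilde n)) : fourierFEquiv n f = fourierF n f :=
  rfl

lemma dilationEquiv_symm_ae_eq {n : ℕ} {f : Lp ℂ 2 (volume : Measure (E n))} {g : E n → ℂ}
    (h : f =ᵐ[volume] g) :
    (dilationEquiv n).symm f =ᵐ[muTilde n] fun ξ => g ((Real.sqrt (2 * Real.pi))⁻¹ • ξ) :=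
  (Lp.coeFn_compMeasurePreserving f (measurePreserving_dilation_symm n)).trans
    ((measurePreserving_dilation_symm n).quasiMeasurePreserving.ae_eq_comp h)

lemma integral_dilation {n : ℕ} (f : E n → ℂ) :
    ∫ s : E n, f (Real.sqrt (2 * Real.pi) • s) = ∫ u, f u ∂(muTilde n) :=
  (measurePreserving_dilation n).integral_comp
    (Homeomorph.smulOfNeZero _ sqrt_two_pi_pos.ne').measurableEmbedding f

lemma integrable_dilation {n : ℕ} {f : E n → ℂ} (hf : Integrable f (muTilde n)) :
    Integrable (fun s : E n => f (Real.sqrt (2 * Real.pi) • s)) :=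
  (measurePreserving_dilation n).integrable_comp_of_integrable hf

lemma two_pi_mul_inner_dilation {n : ℕ} (s ξ : E n) :
    2 * Real.pi * inner ℝ s ((Real.sqrt (2 * Real.pi))⁻¹ • ξ) =
      inner ℝ (Real.sqrt (2 * Real.pi) • s) ξ := by
  rw [inner_smul_left, inner_smul_right, ← mul_assoc]
  congr 1
  rw [conj_trivial, ← div_eq_mul_inv, Real.div_sqrt]

/-- With `u = √(2π) s` and frequency `ξ/√(2π)` the phase `2π⟨s, ·⟩` becomes `⟨u, ξ⟩`, while the
dilation carries Lebesgue measure to the normalized one. Thus the conjugation by dilations accounts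
for every factor of `2π`. -/
lemma fourierF_toLp_ae_eq {n : ℕ} {f : E n → ℂ} (hf : Integrable f (muTilde n))
    (hf2 : MemLp f 2 (muTilde n)) :
    fourierF n (hf2.toLp f) =ᵐ[muTilde n]
      fun ξ => ∫ u, f u * cexp (-I * (inner ℝ u ξ : ℝ)) ∂(muTilde n) := by
  have h := fourier_toLp_ae_eq (integrable_dilation hf)
    (hf2.comp_measurePreserving (measurePreserving_dilation n))
  refine (dilationEquiv_symm_ae_eq h).trans (Filter.Eventually.of_forall fun ξ => ?_)
  simp only [Real.fourier_eq', ← integral_dilation]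
  refine integral_congr_ae (Filter.Eventually.of_forall fun s => ?_)
  simp only [smul_eq_mul]
  rw [mul_comm, neg_mul, neg_mul, two_pi_mul_inner_dilation]
  push_cast
  ring_nf

lemma fourierFEquiv_symm_toLp_ae_eq {n : ℕ} {f : E n → ℂ} (hf : Integrable f (muTilde n))
    (hf2 : MemLp f 2 (muTilde n)) :
    (fourierFEquiv n).symm (hf2.toLp f) =ᵐ[muTilde n]
      fun ξ => ∫ u, f u * cexp (I * (inner ℝ u ξ : ℝ)) ∂(muTilde n) := by
  have h := fourierInv_toLp_ae_eq (integrable_dilation hf)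
    (hf2.comp_measurePreserving (measurePreserving_dilation n))
  refine (dilationEquiv_symm_ae_eq h).trans (Filter.Eventually.of_forall fun ξ => ?_)
  simp only [Real.fourierInv_eq', ← integral_dilation]
  refine integral_congr_ae (Filter.Eventually.of_forall fun s => ?_)
  simp only [smul_eq_mul]
  rw [mul_comm, two_pi_mul_inner_dilation]
  ring_nf

lemma ae_eq_zero_of_integral_exp_eq_zero {n : ℕ} {f : E n → ℂ} (hf : Integrable f (muTilde n))
    (h : ∀ s : E n, ∫ u, f u * cexp (-I * (inner ℝ u s : ℝ)) ∂(muTilde n) = 0) :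
    f =ᵐ[muTilde n] 0 := by
  refine ae_muTilde_iff.2 (ae_eq_zero_of_fourier_eq_zero (integrable_muTilde_iff.1 hf) fun w => ?_)
  -- At the frequency `2πw` the kernel is that of `𝓕`.
  have h1 := h ((2 * Real.pi) • w)
  rw [integral_muTilde, mul_eq_zero] at h1
  have h2 : (((2 * Real.pi) ^ (-(n : ℝ) / 2) : ℝ) : ℂ) ≠ 0 := by
    rw [Ne, ofReal_eq_zero]
    positivity
  rw [Real.fourier_eq', ← h1.resolve_left h2]
  refine integral_congr_ae (Filter.Eventually.of_forall fun s => ?_)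
  simp only [smul_eq_mul, inner_smul_right]
  rw [mul_comm]
  congr 2
  push_cast
  ring

end

section

/-! ### Continuous functions of exponential growth -/

/-- Continuous functions bounded by `C exp(a ‖v‖)`. -/
def ExpBdd {V : Type*} [NormedAddCommGroup V] (f : V → ℂ) : Prop :=
  Continuous f ∧ ∃ C a : ℝ, 0 ≤ C ∧ 0 ≤ a ∧ ∀ v, ‖f v‖ ≤ C * Real.exp (a * ‖v‖)

namespace ExpBdd

section Basic

variable {V : Type*} [NormedAddCommGroup V] {f g : V → ℂ}

lemma const (c : ℂ) : ExpBdd fun _ : V => c :=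
  ⟨continuous_const, ‖c‖, 0, norm_nonneg c, le_rfl, fun v => by simp⟩

lemma mul (hf : ExpBdd f) (hg : ExpBdd g) : ExpBdd fun v => f v * g v := by
  obtain ⟨hf, C, a, hC, ha, h⟩ := hf
  obtain ⟨hg, D, b, hD, hb, h'⟩ := hg
  refine ⟨hf.mul hg, C * D, a + b, by positivity, by positivity, fun v => ?_⟩
  rw [norm_mul, add_mul, Real.exp_add, mul_mul_mul_comm]
  exact mul_le_mul (h v) (h' v) (norm_nonneg _) (by positivity)

lemma add (hf : ExpBdd f) (hg : ExpBdd g) : ExpBdd fun v => f v + g v := by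
  obtain ⟨hf, C, a, hC, ha, h⟩ := hf
  obtain ⟨hg, D, b, hD, hb, h'⟩ := hg
  refine ⟨hf.add hg, C + D, a + b, by positivity, by positivity, fun v => ?_⟩
  have h1 : Real.exp (a * ‖v‖) ≤ Real.exp ((a + b) * ‖v‖) :=
    Real.exp_le_exp.2 (mul_le_mul_of_nonneg_right (by linarith) (norm_nonneg v))
  have h2 : Real.exp (b * ‖v‖) ≤ Real.exp ((a + b) * ‖v‖) :=
    Real.exp_le_exp.2 (mul_le_mul_of_nonneg_right (by linarith) (norm_nonneg v))
  calc ‖f v + g v‖ ≤ ‖f v‖ + ‖g v‖ := norm_add_le _ _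
    _ ≤ C * Real.exp (a * ‖v‖) + D * Real.exp (b * ‖v‖) := add_le_add (h v) (h' v)
    _ ≤ (C + D) * Real.exp ((a + b) * ‖v‖) := by
      rw [add_mul]
      exact add_le_add (mul_le_mul_of_nonneg_left h1 hC) (mul_le_mul_of_nonneg_left h2 hD)

lemma prod {ι : Type*} (s : Finset ι) {f : ι → V → ℂ} (h : ∀ i, ExpBdd (f i)) :
    ExpBdd fun v => ∏ i ∈ s, f i v := by
  classical
  induction s using Finset.induction_on with
  | empty => simpa using const 1
  | insert i s hi ih => simpa only [Finset.prod_insert hi] using (h i).mul ih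

lemma sum {ι : Type*} (s : Finset ι) {f : ι → V → ℂ} (h : ∀ i, ExpBdd (f i)) :
    ExpBdd fun v => ∑ i ∈ s, f i v := by
  classical
  induction s using Finset.induction_on with
  | empty => simpa using const 0
  | insert i s hi ih => simpa only [Finset.sum_insert hi] using (h i).add ih

lemma pow (hf : ExpBdd f) (k : ℕ) : ExpBdd fun v => f v ^ k := by
  simpa using prod (Finset.range k) fun _ => hf

lemma eval {t : V → ℝ} (ht : ExpBdd fun v => (t v : ℂ)) (p : Polynomial ℝ) :
    ExpBdd fun v => ((p.eval (t v) : ℝ) : ℂ) := by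
  simp only [Polynomial.eval_eq_sum_range, ofReal_sum, ofReal_mul, ofReal_pow]
  exact sum _ fun i => (const _).mul (ht.pow i)

variable [NormedSpace ℝ V]

lemma of_clm (L : V →L[ℝ] ℂ) : ExpBdd fun v => L v := by
  refine ⟨L.continuous, ‖L‖, 1, norm_nonneg _, zero_le_one, fun v => (L.le_opNorm v).trans ?_⟩
  refine mul_le_mul_of_nonneg_left ?_ (norm_nonneg _)
  linarith [Real.add_one_le_exp (1 * ‖v‖)]

lemma of_clm_real (L : V →L[ℝ] ℝ) : ExpBdd fun v => (L v : ℂ) := of_clm (ofRealCLM.comp L)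

lemma cexp_clm (L : V →L[ℝ] ℂ) : ExpBdd fun v => cexp (L v) := by
  refine ⟨continuous_exp.comp L.continuous, 1, ‖L‖, zero_le_one, norm_nonneg _, fun v => ?_⟩
  rw [norm_exp, one_mul, Real.exp_le_exp]
  exact (re_le_norm _).trans (L.le_opNorm v)

end Basic

variable {V : Type*} [NormedAddCommGroup V] [InnerProductSpace ℝ V] [FiniteDimensional ℝ V]
  [MeasurableSpace V] [BorelSpace V] {f : V → ℂ}

/-- Half of the Gaussian absorbs the exponential growth: completing the square gives `a t - b t² ≤
a²/(2b) - (b/2) t²`. -/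
lemma integrable_gaussian (hf : ExpBdd f) {b : ℝ} (hb : 0 < b) :
    Integrable fun v => f v * (Real.exp (-b * ‖v‖ ^ 2) : ℂ) := by
  obtain ⟨hc, C, a, hC, ha, h⟩ := hf
  have h1 := (GaussianFourier.integrable_cexp_neg_mul_sq_norm_add (b := (b / 2 : ℝ))
    (by simpa using hb) 0 (0 : V)).norm.const_mul (C * Real.exp (a ^ 2 / (2 * b)))
  refine h1.mono' (by fun_prop) (Filter.Eventually.of_forall fun v => ?_)
  simp only [norm_exp, norm_mul, norm_real, Real.norm_of_nonneg (Real.exp_pos _).le]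
  have e : (-((b / 2 : ℝ) : ℂ) * (‖v‖ : ℂ) ^ 2 + 0 * ((inner ℝ (0 : V) v : ℝ) : ℂ)).re
      = -(b / 2) * ‖v‖ ^ 2 := by
    rw [zero_mul, add_zero, ← ofReal_pow, ← ofReal_neg, ← ofReal_mul, ofReal_re]
  rw [e, mul_assoc, ← Real.exp_add]
  refine (mul_le_mul_of_nonneg_right (h v) (Real.exp_pos _).le).trans ?_
  rw [mul_assoc, ← Real.exp_add]
  refine mul_le_mul_of_nonneg_left (Real.exp_le_exp.2 ?_) hC
  have : a ^ 2 / (2 * b) + -(b / 2) * ‖v‖ ^ 2 - (a * ‖v‖ + -b * ‖v‖ ^ 2)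
      = (a - b * ‖v‖) ^ 2 / (2 * b) := by
    field_simp
    ring
  have h2 : 0 ≤ (a - b * ‖v‖) ^ 2 / (2 * b) := by positivity
  linarith

lemma memLp_gaussian (hf : ExpBdd f) {b : ℝ} (hb : 0 < b) :
    MemLp (fun v => f v * (Real.exp (-b * ‖v‖ ^ 2) : ℂ)) 2 := by
  have hc := hf.1
  rw [memLp_two_iff_integrable_sq_norm (by fun_prop)]
  refine ((hf.mul hf).integrable_gaussian (b := 2 * b) (by positivity)).norm.congr
    (Filter.Eventually.of_forall fun v => ?_)
  simp only [norm_mul, norm_real, Real.norm_of_nonneg (Real.exp_pos _).le]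
  have e : Real.exp (-(2 * b) * ‖v‖ ^ 2) = Real.exp (-b * ‖v‖ ^ 2) ^ 2 := by
    rw [← Real.exp_nat_mul]
    congr 1
    push_cast
    ring
  rw [e]
  ring

end ExpBdd

/-! ### Hermite polynomials and Hermite functions -/

lemma hermitePoly_succ (k : ℕ) : hermitePoly (k + 1) =
    2 * Polynomial.X * hermitePoly k - Polynomial.derivative (hermitePoly k) := rfl

lemma derivative_hermitePoly_succ (k : ℕ) : Polynomial.derivative (hermitePoly (k + 1)) =
    2 * ((k : Polynomial ℝ) + 1) * hermitePoly k := by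
  induction k with
  | zero => simp [hermitePoly]
  | succ k ih =>
    rw [hermitePoly_succ (k + 1), Polynomial.derivative_sub, Polynomial.derivative_mul,
      Polynomial.derivative_mul, ih, Polynomial.derivative_mul, Polynomial.derivative_mul]
    have h2 : Polynomial.derivative (2 : Polynomial ℝ) = 0 := Polynomial.derivative_ofNat 2
    have hk : Polynomial.derivative ((k : Polynomial ℝ) + 1) = 0 := by simp
    simp only [h2, hk, Polynomial.derivative_X, hermitePoly_succ k]
    push_cast
    ring

/-- The recursion reads `X H_k = (H_{k+1} + H_k')/2`, and `H_k'` is zero or a multiple of `H_{k-1}`.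
The span of the Hermite polynomials is therefore stable under multiplication by `X`, and it contains
`1`. -/
lemma X_pow_mem_span_hermitePoly (a : ℕ) :
    (Polynomial.X : Polynomial ℝ) ^ a ∈ Submodule.span ℝ (Set.range hermitePoly) := by
  have hX : ∀ k, Polynomial.X * hermitePoly k ∈ Submodule.span ℝ (Set.range hermitePoly) := by
    intro k
    have h0 : ∀ k, hermitePoly k ∈ Submodule.span ℝ (Set.range hermitePoly) :=
      fun k => Submodule.subset_span ⟨k, rfl⟩
    have h1 : Polynomial.X * hermitePoly k =
        (1 / 2 : ℝ) • (hermitePoly (k + 1) + Polynomial.derivative (hermitePoly k)) := by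
      rw [hermitePoly_succ, sub_add_cancel, Polynomial.smul_eq_C_mul, ← mul_assoc, ← mul_assoc]
      congr 1
      rw [show (2 : Polynomial ℝ) = Polynomial.C 2 from rfl, ← Polynomial.C_mul]
      norm_num
    rw [h1]
    refine Submodule.smul_mem _ _ (Submodule.add_mem _ (h0 _) ?_)
    cases k with
    | zero => simp [hermitePoly]
    | succ k =>
      have : Polynomial.derivative (hermitePoly (k + 1)) =
          (2 * ((k : ℝ) + 1)) • hermitePoly k := by
        rw [derivative_hermitePoly_succ, Polynomial.smul_eq_C_mul, Polynomial.C_mul,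
          Polynomial.C_add, Polynomial.C_1, Polynomial.C_eq_natCast]
        rfl
      rw [this]
      exact Submodule.smul_mem _ _ (h0 _)
  induction a with
  | zero => exact Submodule.subset_span ⟨0, by simp [hermitePoly]⟩
  | succ a ih =>
    rw [pow_succ']
    generalize (Polynomial.X : Polynomial ℝ) ^ a = p at ih
    induction ih using Submodule.span_induction with
    | mem p hp =>
      obtain ⟨k, rfl⟩ := hp
      exact hX k
    | zero => simp
    | add p q _ _ hp hq => simpa [mul_add] using Submodule.add_mem _ hp hq
    | smul c p _ hp => simpa using Submodule.smul_mem _ c hp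

lemma integrable_eval_mul_gaussian (p : Polynomial ℝ) :
    Integrable fun t : ℝ => p.eval t * Real.exp (-t ^ 2) := by
  have h := (ExpBdd.eval (ExpBdd.of_clm_real (ContinuousLinearMap.id ℝ ℝ)) p).integrable_gaussian
    (b := 1) one_pos
  refine h.re.congr (Filter.Eventually.of_forall fun t => ?_)
  simp only [ContinuousLinearMap.id_apply, ← ofReal_mul, Real.norm_eq_abs, sq_abs, neg_mul, one_mul]
  exact ofReal_re _

/-- The recursion says that `H_{k+1} exp(-t²)` is minus the derivative of `H_k exp(-t²)`, so this is
one integration by parts. -/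
lemma integral_hermitePoly_succ_mul (k : ℕ) (p : Polynomial ℝ) :
    ∫ t, (hermitePoly (k + 1) * p).eval t * Real.exp (-t ^ 2) =
      ∫ t, (hermitePoly k * Polynomial.derivative p).eval t * Real.exp (-t ^ 2) := by
  have hd : ∀ t : ℝ, HasDerivAt (fun t => (hermitePoly k * p).eval t * Real.exp (-t ^ 2))
      ((hermitePoly k * Polynomial.derivative p).eval t * Real.exp (-t ^ 2) -
        (hermitePoly (k + 1) * p).eval t * Real.exp (-t ^ 2)) t := by
    intro t
    have h1 := (hermitePoly k * p).hasDerivAt t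
    have h2 : HasDerivAt (fun t : ℝ => Real.exp (-t ^ 2)) (Real.exp (-t ^ 2) * (-(2 * t))) t := by
      simpa using ((hasDerivAt_pow 2 t).neg).exp
    refine (h1.mul h2).congr_deriv ?_
    simp only [hermitePoly_succ, Polynomial.derivative_mul, Polynomial.eval_add,
      Polynomial.eval_mul, Polynomial.eval_sub, Polynomial.eval_X, Polynomial.eval_ofNat]
    ring
  have h := integral_eq_zero_of_hasDerivAt_of_integrable hd
    ((integrable_eval_mul_gaussian _).sub (integrable_eval_mul_gaussian _))
    (integrable_eval_mul_gaussian _)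
  rw [integral_sub (integrable_eval_mul_gaussian _) (integrable_eval_mul_gaussian _)] at h
  linarith

/-- Integration by parts and `H_{l+1}' = 2(l+1) H_l` lower both indices by one at the cost of the
factor `2(l+1)`. The descent ends at the Gaussian integral if the indices agree, and at the
derivative of the constant `H_0` otherwise. -/
lemma integral_hermitePoly_mul (k l : ℕ) :
    ∫ t, (hermitePoly k * hermitePoly l).eval t * Real.exp (-t ^ 2) =
      if k = l then 2 ^ k * (k.factorial : ℝ) * Real.sqrt Real.pi else 0 := by
  induction k generalizing l with
  | zero =>
    cases l with
    | zero => simpa [hermitePoly] using integral_gaussian 1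
    | succ l =>
      rw [mul_comm, integral_hermitePoly_succ_mul]
      simp [hermitePoly]
  | succ k ih =>
    rw [integral_hermitePoly_succ_mul]
    cases l with
    | zero => simp [hermitePoly]
    | succ l =>
      have h : ∀ t : ℝ, (hermitePoly k * Polynomial.derivative (hermitePoly (l + 1))).eval t *
          Real.exp (-t ^ 2) =
          (2 * ((l : ℝ) + 1)) * ((hermitePoly k * hermitePoly l).eval t * Real.exp (-t ^ 2)) := by
        intro t
        rw [derivative_hermitePoly_succ]
        simp
        ring
      simp only [h, integral_const_mul, ih, add_left_inj]
      split_ifs with hkl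
      · subst hkl
        rw [Nat.factorial_succ]
        push_cast
        ring
      · simp

lemma hermiteFun_mul (k l : ℕ) (t : ℝ) : hermiteFun k t * hermiteFun l t =
    ((2 : ℝ) ^ k * (k.factorial : ℝ) * Real.sqrt Real.pi) ^ (-(1 / 2) : ℝ) *
      ((2 : ℝ) ^ l * (l.factorial : ℝ) * Real.sqrt Real.pi) ^ (-(1 / 2) : ℝ) *
      ((hermitePoly k * hermitePoly l).eval t * Real.exp (-t ^ 2)) := by
  have : Real.exp (-t ^ 2) = Real.exp (-(1 / 2) * t ^ 2) * Real.exp (-(1 / 2) * t ^ 2) := by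
    rw [← Real.exp_add]
    ring_nf
  rw [hermiteFun, hermiteFun, this, Polynomial.eval_mul]
  ring

/-- The Hermite functions are orthonormal. -/
lemma integral_hermiteFun_mul (k l : ℕ) :
    ∫ t, hermiteFun k t * hermiteFun l t = if k = l then 1 else 0 := by
  simp only [hermiteFun_mul, integral_const_mul, integral_hermitePoly_mul]
  split_ifs with h
  · subst h
    have hp : 0 < (2 : ℝ) ^ k * (k.factorial : ℝ) * Real.sqrt Real.pi := by
      have := Real.sqrt_pos.2 Real.pi_pos
      positivity
    rw [← Real.rpow_add hp]
    norm_num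
    rw [Real.rpow_neg_one, inv_mul_cancel₀ hp.ne']
  · simp

end

/-! ### The kernels `q_{k,ξ}`: Gaussian form, orthonormality and completeness -/

section

variable {n : ℕ}

lemma integral_prod_coord {𝕜 : Type*} [RCLike 𝕜] (f : Fin n → ℝ → 𝕜) :
    ∫ x : E n, ∏ r, f r (x r) = ∏ r, ∫ t, f r t := by
  rw [← integral_fintype_prod_volume_eq_prod]
  exact (EuclideanSpace.volume_preserving_symm_measurableEquiv_toLp (Fin n)).integral_comp
    (MeasurableEquiv.measurableEmbedding _) (fun x : Fin n → ℝ => ∏ r, f r (x r))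

lemma memLp_muTilde {f : E n → ℂ} (hf : MemLp f 2) : MemLp f 2 (muTilde n) :=
  hf.smul_measure ENNReal.ofReal_ne_top

/-- The variable `(ξ_r + 2 v_r)/√2` of the Hermite functions. -/
def hvar (ξ v : E n) (r : Fin n) : ℝ := (ξ r + 2 * v r) / Real.sqrt 2

/-- The Gaussian factor of the products of Hermite functions. -/
def hgauss (ξ v : E n) : ℝ := Real.exp (-(1 / 2) * ∑ r, hvar ξ v r ^ 2)

lemma hgauss_pos (ξ v : E n) : 0 < hgauss ξ v := Real.exp_pos _

/-- The quadratic form splits into one square in `v`, one in `ξ`, and a cross term that is linear in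
each variable. With either variable fixed, `hgauss` is therefore a Gaussian in the other times a
function of exponential growth, which puts `q_{k,ξ}(v)` in `L²` of each variable separately. -/
lemma sum_hvar_sq (ξ v : E n) :
    (1 / 2) * ∑ r, hvar ξ v r ^ 2 = ‖v‖ ^ 2 + inner ℝ ξ v + ‖ξ‖ ^ 2 / 4 := by
  have h1 : ∀ r, hvar ξ v r ^ 2 = ξ r ^ 2 / 2 + 2 * (v r * ξ r) + 2 * v r ^ 2 := by
    intro r
    rw [hvar, div_pow, Real.sq_sqrt (by norm_num)]
    ring
  rw [EuclideanSpace.real_norm_sq_eq, EuclideanSpace.real_norm_sq_eq, PiLp.inner_apply]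
  simp only [h1, Finset.sum_add_distrib, ← Finset.mul_sum, ← Finset.sum_div, RCLike.inner_apply,
    conj_trivial]
  ring

lemma hgauss_eq (ξ v : E n) :
    hgauss ξ v = Real.exp (-(‖v‖ ^ 2 + inner ℝ ξ v + ‖ξ‖ ^ 2 / 4)) := by
  rw [hgauss, neg_mul, sum_hvar_sq]

@[fun_prop]
lemma continuous_hvar (r : Fin n) : Continuous fun p : E n × E n => hvar p.1 p.2 r := by
  unfold hvar
  fun_prop

@[fun_prop]
lemma continuous_hgauss : Continuous fun p : E n × E n => hgauss p.1 p.2 := by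
  unfold hgauss
  fun_prop

lemma expBdd_hvar_right (ξ : E n) (r : Fin n) : ExpBdd fun v => (hvar ξ v r : ℂ) := by
  have h := ((ExpBdd.const ((ξ r : ℂ) / (Real.sqrt 2 : ℂ))).add
    ((ExpBdd.const (2 / (Real.sqrt 2 : ℂ))).mul
      (ExpBdd.of_clm_real (EuclideanSpace.proj r : E n →L[ℝ] ℝ))))
  convert h using 2
  simp [hvar]
  ring

lemma expBdd_hvar_left (v : E n) (r : Fin n) : ExpBdd fun ξ => (hvar ξ v r : ℂ) := by
  have h := ((ExpBdd.const (2 * (v r : ℂ) / (Real.sqrt 2 : ℂ))).add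
    ((ExpBdd.const (1 / (Real.sqrt 2 : ℂ))).mul
      (ExpBdd.of_clm_real (EuclideanSpace.proj r : E n →L[ℝ] ℝ))))
  convert h using 2
  simp [hvar]
  ring

lemma exists_expBdd_hgauss_right (ξ : E n) {f : E n → ℂ} (hf : ExpBdd f) :
    ∃ g : E n → ℂ, ExpBdd g ∧
      (fun v => f v * (hgauss ξ v : ℂ)) = fun v => g v * (Real.exp (-1 * ‖v‖ ^ 2) : ℂ) := by
  refine ⟨fun v => f v * ((Real.exp (-‖ξ‖ ^ 2 / 4) : ℂ) *
      cexp ((-ofRealCLM.comp (innerSL ℝ ξ) : E n →L[ℝ] ℂ) v)),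
    hf.mul ((ExpBdd.const _).mul (ExpBdd.cexp_clm _)), funext fun v => ?_⟩
  have : (hgauss ξ v : ℂ) = (Real.exp (-‖ξ‖ ^ 2 / 4) : ℂ) *
      cexp ((-ofRealCLM.comp (innerSL ℝ ξ) : E n →L[ℝ] ℂ) v) *
      (Real.exp (-1 * ‖v‖ ^ 2) : ℂ) := by
    rw [hgauss_eq]
    push_cast
    rw [← Complex.exp_add, ← Complex.exp_add]
    congr 1
    simp
    ring
  rw [this]
  ring

lemma exists_expBdd_hgauss_left (v : E n) {f : E n → ℂ} (hf : ExpBdd f) :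
    ∃ g : E n → ℂ, ExpBdd g ∧
      (fun ξ => f ξ * (hgauss ξ v : ℂ)) = fun ξ => g ξ * (Real.exp (-(1 / 4) * ‖ξ‖ ^ 2) : ℂ) := by
  refine ⟨fun ξ => f ξ * ((Real.exp (-‖v‖ ^ 2) : ℂ) *
      cexp ((-ofRealCLM.comp (innerSL ℝ v) : E n →L[ℝ] ℂ) ξ)),
    hf.mul ((ExpBdd.const _).mul (ExpBdd.cexp_clm _)), funext fun ξ => ?_⟩
  have : (hgauss ξ v : ℂ) = (Real.exp (-‖v‖ ^ 2) : ℂ) *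
      cexp ((-ofRealCLM.comp (innerSL ℝ v) : E n →L[ℝ] ℂ) ξ) *
      (Real.exp (-(1 / 4) * ‖ξ‖ ^ 2) : ℂ) := by
    rw [hgauss_eq]
    push_cast
    rw [← Complex.exp_add, ← Complex.exp_add]
    congr 1
    simp [real_inner_comm]
    ring
  rw [this]
  ring

lemma memLp_mul_hgauss_right (ξ : E n) {f : E n → ℂ} (hf : ExpBdd f) :
    MemLp (fun v => f v * (hgauss ξ v : ℂ)) 2 (muTilde n) := by
  obtain ⟨g, hg, h⟩ := exists_expBdd_hgauss_right ξ hf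
  rw [h]
  exact memLp_muTilde (hg.memLp_gaussian one_pos)

lemma memLp_mul_hgauss_left (v : E n) {f : E n → ℂ} (hf : ExpBdd f) :
    MemLp (fun ξ => f ξ * (hgauss ξ v : ℂ)) 2 (muTilde n) := by
  obtain ⟨g, hg, h⟩ := exists_expBdd_hgauss_left v hf
  rw [h]
  exact memLp_muTilde (hg.memLp_gaussian (by norm_num))

/-- The functions `q_{k,ξ}(v) = 2^{n/2} π^{n/4} ∏_r ψ_{k_r}((ξ_r + 2 v_r)/√2)` for an arbitrary
multi-index `k`. -/
def qk (k : Fin n → ℕ) (ξ v : E n) : ℝ :=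
  (2 : ℝ) ^ ((n : ℝ) / 2) * Real.pi ^ ((n : ℝ) / 4) * ∏ r, hermiteFun (k r) (hvar ξ v r)

lemma q_eq_qk {m : ℕ} (j : Fin (dim n m)) (ξ v : E n) : q j ξ v = qk (phi n m j) ξ v := rfl

/-- The normalizing constant of `q_{k,ξ}`. -/
def qconst (k : Fin n → ℕ) : ℝ :=
  (2 : ℝ) ^ ((n : ℝ) / 2) * Real.pi ^ ((n : ℝ) / 4) *
    ∏ r, ((2 : ℝ) ^ k r * ((k r).factorial : ℝ) * Real.sqrt Real.pi) ^ (-(1 / 2) : ℝ)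

lemma qconst_ne_zero (k : Fin n → ℕ) : qconst k ≠ 0 := by
  have := Real.sqrt_pos.2 Real.pi_pos
  have : 0 < qconst k := by
    unfold qconst
    refine mul_pos (by positivity) (Finset.prod_pos fun r _ => by positivity)
  exact this.ne'

lemma qk_eq (k : Fin n → ℕ) (ξ v : E n) :
    qk k ξ v = qconst k * (∏ r, (hermitePoly (k r)).eval (hvar ξ v r)) * hgauss ξ v := by
  simp only [qk, hermiteFun, qconst, hgauss, Finset.prod_mul_distrib, Finset.mul_sum,
    Real.exp_sum]
  ring

@[fun_prop]
lemma continuous_qk (k : Fin n → ℕ) : Continuous fun p : E n × E n => qk k p.1 p.2 := by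
  simp only [qk_eq]
  fun_prop

lemma memLp_qk_right (k : Fin n → ℕ) (ξ : E n) :
    MemLp (fun v => (qk k ξ v : ℂ)) 2 (muTilde n) := by
  simp only [qk_eq, ofReal_mul, ofReal_prod]
  exact memLp_mul_hgauss_right ξ
    ((ExpBdd.const _).mul (ExpBdd.prod _ fun r => (expBdd_hvar_right ξ r).eval _))

lemma memLp_qk_left (k : Fin n → ℕ) (v : E n) :
    MemLp (fun ξ => (qk k ξ v : ℂ)) 2 (muTilde n) := by
  simp only [qk_eq, ofReal_mul, ofReal_prod]
  exact memLp_mul_hgauss_left v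
    ((ExpBdd.const _).mul (ExpBdd.prod _ fun r => (expBdd_hvar_left v r).eval _))

lemma integral_comp_hvar (g : ℝ → ℝ) (a : ℝ) :
    ∫ t, g ((a + 2 * t) / Real.sqrt 2) = (Real.sqrt 2)⁻¹ * ∫ t, g t := by
  have h2 : (0 : ℝ) < Real.sqrt 2 := Real.sqrt_pos.2 (by norm_num)
  have hs : Real.sqrt 2 * Real.sqrt 2 = 2 := Real.mul_self_sqrt (by norm_num)
  have h : ∀ t : ℝ, (a + 2 * t) / Real.sqrt 2 = a / Real.sqrt 2 + Real.sqrt 2 * t := by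
    intro t
    field_simp
    rw [sq, hs, mul_comm t]
  simp only [h]
  rw [Measure.integral_comp_mul_left (fun t => g (a / Real.sqrt 2 + t)),
    integral_add_left_eq_self, abs_of_pos (by positivity), smul_eq_mul]

/-- For every `ξ` the functions `q_{k,ξ}` are orthonormal. -/
lemma integral_qk_mul_qk (k l : Fin n → ℕ) (ξ : E n) :
    ∫ v, (qk k ξ v : ℂ) * (qk l ξ v : ℂ) ∂(muTilde n) = if k = l then 1 else 0 := by
  have h1 : ∀ v, (qk k ξ v : ℂ) * (qk l ξ v : ℂ) =
      (((2 : ℝ) ^ ((n : ℝ) / 2) * Real.pi ^ ((n : ℝ) / 4)) ^ 2 *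
        ∏ r, (hermiteFun (k r) ((ξ r + 2 * v r) / Real.sqrt 2) *
          hermiteFun (l r) ((ξ r + 2 * v r) / Real.sqrt 2)) : ℝ) := by
    intro v
    rw [← ofReal_mul, Finset.prod_mul_distrib]
    simp only [qk, hvar]
    congr 1
    ring
  have h2 : ∀ r, ∫ t, hermiteFun (k r) ((ξ r + 2 * t) / Real.sqrt 2) *
      hermiteFun (l r) ((ξ r + 2 * t) / Real.sqrt 2) =
      (Real.sqrt 2)⁻¹ * if k r = l r then 1 else 0 := fun r => by
    rw [integral_comp_hvar (fun t => hermiteFun (k r) t * hermiteFun (l r) t),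
      integral_hermiteFun_mul]
  simp only [h1]
  rw [integral_muTilde, integral_complex_ofReal, integral_const_mul, integral_prod_coord
    (fun r t => hermiteFun (k r) ((ξ r + 2 * t) / Real.sqrt 2) *
      hermiteFun (l r) ((ξ r + 2 * t) / Real.sqrt 2))]
  simp only [h2, Finset.prod_mul_distrib, Finset.prod_const, Finset.card_univ, Fintype.card_fin]
  by_cases hkl : k = l
  · subst hkl
    simp only [if_true, Finset.prod_const_one, mul_one]
    rw [← ofReal_mul, ← ofReal_one]
    congr 1
    -- The measure contributes `(2π)^{-n/2}`, the squared constant of `q` contributes `2^n π^{n/2}`,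
    -- and the substitution in the `n` coordinates contributes `2^{-n/2}`. Their product is `1`.
    rw [Real.sqrt_eq_rpow, ← Real.rpow_neg (by norm_num), ← Real.rpow_natCast,
      ← Real.rpow_natCast, Real.mul_rpow (by positivity) (by positivity),
      Real.mul_rpow (by positivity) (by positivity), ← Real.rpow_mul (by positivity),
      ← Real.rpow_mul (by positivity), ← Real.rpow_mul (by positivity)]
    rw [show (2 : ℝ) ^ (-(n : ℝ) / 2) * Real.pi ^ (-(n : ℝ) / 2) *
      (2 ^ ((n : ℝ) / 2 * ((2 : ℕ) : ℝ)) * Real.pi ^ ((n : ℝ) / 4 * ((2 : ℕ) : ℝ)) *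
        2 ^ (-(1 / 2) * (n : ℝ))) =
      (2 ^ (-(n : ℝ) / 2) * 2 ^ ((n : ℝ) / 2 * ((2 : ℕ) : ℝ)) * 2 ^ (-(1 / 2) * (n : ℝ))) *
      (Real.pi ^ (-(n : ℝ) / 2) * Real.pi ^ ((n : ℝ) / 4 * ((2 : ℕ) : ℝ))) by ring]
    rw [← Real.rpow_add (by norm_num), ← Real.rpow_add (by norm_num),
      ← Real.rpow_add Real.pi_pos]
    have e1 : -(n : ℝ) / 2 + (n : ℝ) / 2 * ((2 : ℕ) : ℝ) + -(1 / 2) * (n : ℝ) = 0 := by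
      push_cast
      ring
    have e2 : -(n : ℝ) / 2 + (n : ℝ) / 4 * ((2 : ℕ) : ℝ) = 0 := by
      push_cast
      ring
    rw [e1, e2]
    simp
  · obtain ⟨r, hr⟩ := Function.ne_iff.1 hkl
    have : ∏ r, (if k r = l r then (1 : ℝ) else 0) = 0 :=
      Finset.prod_eq_zero (Finset.mem_univ r) (by simp [hr])
    simp [this, hkl]

lemma integrable_mul_expBdd_mul_hgauss {φ : E n → ℂ} (hφ : MemLp φ 2 (muTilde n)) (ξ : E n)
    {f : E n → ℂ} (hf : ExpBdd f) :
    Integrable (fun v => φ v * (f v * (hgauss ξ v : ℂ))) (muTilde n) :=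
  hφ.integrable_mul (memLp_mul_hgauss_right ξ hf)

/-- Each power of a coordinate is a finite combination of Hermite polynomials. Multiplying these
out, a monomial times the Gaussian is a finite combination of the functions `q_{k,ξ}`. -/
lemma integral_monomial_mul_hgauss_eq_zero {φ : E n → ℂ} (hφ : MemLp φ 2 (muTilde n)) (ξ : E n)
    (h : ∀ k : Fin n → ℕ, ∫ v, φ v * (qk k ξ v : ℂ) ∂(muTilde n) = 0) (a : Fin n → ℕ) :
    ∫ v, φ v * ((∏ r, (hvar ξ v r : ℂ) ^ a r) * (hgauss ξ v : ℂ)) ∂(muTilde n) = 0 := by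
  have hc : ∀ r, ∃ c : ℕ →₀ ℝ, (c.sum fun i b => b • hermitePoly i) = Polynomial.X ^ a r :=
    fun r => Finsupp.mem_span_range_iff_exists_finsupp.1 (X_pow_mem_span_hermitePoly (a r))
  choose c hc using hc
  have h1 : ∀ v, φ v * ((∏ r, (hvar ξ v r : ℂ) ^ a r) * (hgauss ξ v : ℂ)) =
      ∑ k ∈ Fintype.piFinset fun r => (c r).support,
        (∏ r, (c r (k r) : ℂ)) * ((qconst k : ℂ)⁻¹ * (φ v * (qk k ξ v : ℂ))) := by
    intro v
    have h2 : ∀ r, (hvar ξ v r : ℂ) ^ a r =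
        ∑ i ∈ (c r).support, (c r i : ℂ) * (((hermitePoly i).eval (hvar ξ v r) : ℝ) : ℂ) := by
      intro r
      have := congrArg (Polynomial.eval (hvar ξ v r)) (hc r)
      rw [Polynomial.eval_pow, Polynomial.eval_X, Finsupp.sum, Polynomial.eval_finsetSum] at this
      rw [← ofReal_pow, ← this]
      simp
    simp only [h2]
    rw [Finset.prod_univ_sum, Finset.sum_mul, Finset.mul_sum]
    refine Finset.sum_congr rfl fun k _ => ?_
    have hq : (qconst k : ℂ) ≠ 0 := ofReal_ne_zero.2 (qconst_ne_zero k)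
    rw [qk_eq, Finset.prod_mul_distrib]
    push_cast
    field_simp
  simp only [h1]
  rw [integral_finsetSum]
  · simp [integral_const_mul, h]
  · intro k _
    exact ((hφ.integrable_mul (memLp_qk_right k ξ)).const_mul _).const_mul _

/-- For every `ξ` the functions `q_{k,ξ}` are complete. -/
lemma ae_eq_zero_of_integral_qk_eq_zero {φ : E n → ℂ} (ξ : E n)
    (hφ : MemLp φ 2 (muTilde n))
    (h : ∀ k : Fin n → ℕ, ∫ v, φ v * (qk k ξ v : ℂ) ∂(muTilde n) = 0) :
    φ =ᵐ[muTilde n] 0 := by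
  have hint := integrable_mul_expBdd_mul_hgauss hφ ξ (ExpBdd.const 1)
  simp only [one_mul] at hint
  -- From moments to the Fourier transform: the exponential series is truncated in each coordinate
  -- separately, which leaves finitely many moments. The product of the truncations is dominated by
  -- `∏ exp |s_r hvar_r|`, which the Gaussian makes integrable against `φ`.
  have key : ∀ s : E n,
      ∫ v, φ v * ((∏ r, cexp (-I * (s r * hvar ξ v r : ℝ))) * (hgauss ξ v : ℂ)) ∂(muTilde n) = 0 := by
    intro s
    set T : ℕ → E n → ℂ := fun N v =>
      ∏ r, ∑ a ∈ Finset.range N, (-I * (s r * hvar ξ v r : ℝ)) ^ a / (a.factorial : ℂ) with hT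
    have hbdd : ExpBdd fun v => ∏ r, (Real.exp |s r * hvar ξ v r| : ℂ) := by
      refine ExpBdd.prod _ fun r => ?_
      have h1 : ExpBdd fun v => (((s r * hvar ξ v r : ℝ)) : ℂ) := by
        simpa using (ExpBdd.const (s r : ℂ)).mul (expBdd_hvar_right ξ r)
      have hcont : Continuous fun v : E n => hvar ξ v r := by unfold hvar; fun_prop
      refine ⟨by fun_prop, Real.exp (|s r| * |ξ r / Real.sqrt 2|),
        |s r| * (2 / Real.sqrt 2), by positivity, by positivity, fun v => ?_⟩
      rw [norm_real, Real.norm_of_nonneg (Real.exp_pos _).le, ← Real.exp_add, Real.exp_le_exp,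
        abs_mul, mul_assoc, ← mul_add]
      refine mul_le_mul_of_nonneg_left ?_ (abs_nonneg _)
      have : hvar ξ v r = ξ r / Real.sqrt 2 + 2 / Real.sqrt 2 * v r := by
        rw [hvar]
        ring
      rw [this]
      refine (abs_add_le _ _).trans (add_le_add le_rfl ?_)
      rw [abs_mul, abs_of_nonneg (by positivity : 0 ≤ 2 / Real.sqrt 2)]
      exact mul_le_mul_of_nonneg_left (PiLp.norm_apply_le v r) (by positivity)
    have hlim : Filter.Tendsto (fun N => ∫ v, φ v * (T N v * (hgauss ξ v : ℂ)) ∂(muTilde n))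
        Filter.atTop (nhds (∫ v, φ v * ((∏ r, cexp (-I * (s r * hvar ξ v r : ℝ))) *
          (hgauss ξ v : ℂ)) ∂(muTilde n))) := by
      refine tendsto_integral_of_dominated_convergence
        (fun v => ‖φ v * ((∏ r, (Real.exp |s r * hvar ξ v r| : ℂ)) * (hgauss ξ v : ℂ))‖)
        (fun N => ?_) (integrable_mul_expBdd_mul_hgauss hφ ξ hbdd).norm (fun N => ?_) ?_
      · refine hφ.1.mul (Continuous.aestronglyMeasurable ?_)
        simp only [hT, hgauss, hvar]
        fun_prop
      · refine Filter.Eventually.of_forall fun v => ?_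
        simp only [norm_mul, hT, norm_prod]
        refine mul_le_mul_of_nonneg_left (mul_le_mul_of_nonneg_right
          (Finset.prod_le_prod (fun r _ => norm_nonneg _) fun r _ => ?_) (norm_nonneg _))
          (norm_nonneg _)
        rw [norm_real, Real.norm_of_nonneg (Real.exp_pos _).le]
        refine (norm_sum_le _ _).trans ((Finset.sum_le_sum fun a _ => ?_).trans
          (Real.sum_le_exp_of_nonneg (abs_nonneg (s r * hvar ξ v r)) N))
        simp only [norm_div, norm_pow, norm_mul, norm_neg, norm_I, one_mul, norm_real,
          Real.norm_eq_abs, norm_natCast, abs_mul, le_refl]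
      · refine Filter.Eventually.of_forall fun v => ?_
        refine Filter.Tendsto.const_mul _ (Filter.Tendsto.mul_const _ ?_)
        refine tendsto_finsetProd _ fun r _ => ?_
        rw [Complex.exp_eq_exp_ℂ]
        have := (NormedSpace.exp_series_hasSum_exp' (𝕂 := ℂ)
          (-I * (s r * hvar ξ v r : ℝ) : ℂ)).tendsto_sum_nat
        simpa [div_eq_inv_mul] using this
    have hzero : ∀ N, ∫ v, φ v * (T N v * (hgauss ξ v : ℂ)) ∂(muTilde n) = 0 := by
      intro N
      have h1 : ∀ v, φ v * (T N v * (hgauss ξ v : ℂ)) =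
          ∑ a ∈ Fintype.piFinset fun _ : Fin n => Finset.range N,
            (∏ r, (-I * s r) ^ a r / ((a r).factorial : ℂ)) *
              (φ v * ((∏ r, (hvar ξ v r : ℂ) ^ a r) * (hgauss ξ v : ℂ))) := by
        intro v
        simp only [hT]
        rw [Finset.prod_univ_sum, Finset.sum_mul, Finset.mul_sum]
        refine Finset.sum_congr rfl fun a _ => ?_
        have h2 : ∏ r, (-I * (s r * hvar ξ v r : ℝ)) ^ a r / ((a r).factorial : ℂ) =
            (∏ r, (-I * s r) ^ a r / ((a r).factorial : ℂ)) * ∏ r, (hvar ξ v r : ℂ) ^ a r := by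
          rw [← Finset.prod_mul_distrib]
          refine Finset.prod_congr rfl fun r _ => ?_
          push_cast
          ring
        rw [h2]
        ring
      simp only [h1]
      rw [integral_finsetSum]
      · simp [integral_const_mul, integral_monomial_mul_hgauss_eq_zero hφ ξ h]
      · intro a _
        exact (integrable_mul_expBdd_mul_hgauss hφ ξ
          (ExpBdd.prod _ fun r => (expBdd_hvar_right ξ r).pow _)).const_mul _
    simp only [hzero] at hlim
    exact tendsto_nhds_unique hlim tendsto_const_nhds
  have hs2 : (0 : ℝ) < Real.sqrt 2 := Real.sqrt_pos.2 (by norm_num)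
  have hz := ae_eq_zero_of_integral_exp_eq_zero hint fun s => by
    -- As `hvar` is `(ξ + 2v)/√2`, the frequency `s/√2` yields the phase `⟨v, s⟩` plus `⟨ξ, s⟩/2`,
    -- and the latter does not depend on `v`.
    have h1 := key ((Real.sqrt 2)⁻¹ • s)
    have h2 : ∀ v, φ v * ((∏ r, cexp (-I * (((Real.sqrt 2)⁻¹ • s) r * hvar ξ v r : ℝ))) *
        (hgauss ξ v : ℂ)) = cexp (-I * (inner ℝ ξ s / 2 : ℝ)) *
          (φ v * (hgauss ξ v : ℂ) * cexp (-I * (inner ℝ v s : ℝ))) := by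
      intro v
      have h3 : ∏ r, cexp (-I * (((Real.sqrt 2)⁻¹ • s) r * hvar ξ v r : ℝ)) =
          cexp (-I * (inner ℝ ξ s / 2 : ℝ)) * cexp (-I * (inner ℝ v s : ℝ)) := by
        rw [← Complex.exp_sum, ← Complex.exp_add, ← Finset.mul_sum, ← mul_add, ← ofReal_sum,
          ← ofReal_add]
        congr 3
        rw [PiLp.inner_apply, PiLp.inner_apply, Finset.sum_div, ← Finset.sum_add_distrib]
        refine Finset.sum_congr rfl fun r _ => ?_
        have hss : Real.sqrt 2 * Real.sqrt 2 = 2 := Real.mul_self_sqrt (by norm_num)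
        simp only [PiLp.smul_apply, smul_eq_mul, hvar, RCLike.inner_apply, conj_trivial]
        rw [show (Real.sqrt 2)⁻¹ * s r * ((ξ r + 2 * v r) / Real.sqrt 2) =
          s r * (ξ r + 2 * v r) / (Real.sqrt 2 * Real.sqrt 2) by field_simp, hss]
        ring
      rw [h3]
      ring
    simp only [h2] at h1
    rw [integral_const_mul, mul_eq_zero] at h1
    exact h1.resolve_left (Complex.exp_ne_zero _)
  filter_upwards [hz] with v hv
  exact (mul_eq_zero.1 hv).resolve_right (ofReal_ne_zero.2 (hgauss_pos ξ v).ne')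

end

section

variable {n : ℕ}

/-! ### Fibres of square-integrable functions of two variables -/

lemma memLp_fiber_left {Φ : E n × E n → ℂ} (hΦ : MemLp Φ 2 (muTilde2 n)) :
    ∀ᵐ ξ ∂(muTilde n), MemLp (fun v => Φ (ξ, v)) 2 (muTilde n) := by
  have h1 := ((memLp_two_iff_integrable_sq_norm hΦ.1).1 hΦ).prod_right_ae
  filter_upwards [h1, hΦ.1.prodMk_left] with ξ h2 h3
  exact (memLp_two_iff_integrable_sq_norm h3).2 h2

lemma memLp_fiber_right {Φ : E n × E n → ℂ} (hΦ : MemLp Φ 2 (muTilde2 n)) :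
    ∀ᵐ v ∂(muTilde n), MemLp (fun ξ => Φ (ξ, v)) 2 (muTilde n) :=
  memLp_fiber_left (hΦ.comp_measurePreserving Measure.measurePreserving_swap)

lemma eq_zero_of_fiber_eq_zero {Φ : Lp ℂ 2 (muTilde2 n)}
    (h : ∀ᵐ ξ ∂(muTilde n), (fun v => Φ (ξ, v)) =ᵐ[muTilde n] 0) : Φ = 0 := by
  have h1 := (memLp_two_iff_integrable_sq_norm (Lp.aestronglyMeasurable Φ)).1 (Lp.memLp Φ)
  have h2 : ∫ p, ‖Φ p‖ ^ 2 ∂(muTilde2 n) = 0 := by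
    rw [integral_prod _ h1]
    refine integral_eq_zero_of_ae ?_
    filter_upwards [h] with ξ hξ
    refine integral_eq_zero_of_ae ?_
    filter_upwards [hξ] with v hv
    simp [hv]
  rw [integral_eq_zero_iff_of_nonneg (fun p => by positivity) h1] at h2
  refine (Lp.eq_zero_iff_ae_eq_zero).2 ?_
  filter_upwards [h2] with p hp
  simpa using hp

/-! ### Fibre integrals against kernels with unit fibres -/

/-- A real kernel on `ℝⁿ × ℝⁿ` whose fibres are unit vectors of `L²`. -/
structure UnitKernel (b : E n → E n → ℝ) : Prop where
  cont : Continuous fun p : E n × E n => b p.1 p.2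
  memLp : ∀ ξ, MemLp (fun v => (b ξ v : ℂ)) 2 (muTilde n)
  unit : ∀ ξ, ∫ v, (b ξ v : ℂ) * (b ξ v : ℂ) ∂(muTilde n) = 1

lemma unitKernel_qk (k : Fin n → ℕ) : UnitKernel (qk k) :=
  ⟨continuous_qk k, memLp_qk_right k, fun ξ => by simp [integral_qk_mul_qk]⟩

/-- Freezing the parameter makes `c(ξ) b(ξ,v)` an elementary tensor. In this form the kernels serve
to prove the density of the algebraic tensor product. -/
lemma unitKernel_qk_const (k : Fin n → ℕ) (ξ₀ : E n) :
    UnitKernel fun (_ : E n) v => qk k ξ₀ v := by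
  have h1 : Continuous fun v : E n => qk k ξ₀ v := by
    unfold qk hvar hermiteFun
    fun_prop
  have h2 := integral_qk_mul_qk k k ξ₀
  rw [if_pos rfl] at h2
  exact ⟨h1.comp continuous_snd, fun _ => memLp_qk_right k ξ₀, fun _ => h2⟩

namespace UnitKernel

variable {b : E n → E n → ℝ}

lemma memLp_mul (hb : UnitKernel b) {c : E n → ℂ} (hc : MemLp c 2 (muTilde n)) :
    MemLp (fun p : E n × E n => c p.1 * (b p.1 p.2 : ℂ)) 2 (muTilde2 n) := by
  have hm : AEStronglyMeasurable (fun p : E n × E n => c p.1 * (b p.1 p.2 : ℂ)) (muTilde2 n) :=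
    hc.1.comp_fst.mul (continuous_ofReal.comp hb.cont).aestronglyMeasurable
  refine (memLp_two_iff_integrable_sq_norm hm).2 ?_
  have hm2 : AEStronglyMeasurable (fun p : E n × E n => ‖c p.1 * (b p.1 p.2 : ℂ)‖ ^ 2)
      (muTilde2 n) := hm.norm.pow 2
  rw [integrable_prod_iff hm2]
  have h1 : ∀ ξ, Integrable (fun v => ‖(b ξ v : ℂ)‖ ^ 2) (muTilde n) := fun ξ =>
    (memLp_two_iff_integrable_sq_norm (hb.memLp ξ).1).1 (hb.memLp ξ)
  have h2 : ∀ ξ, ∫ v, ‖(b ξ v : ℂ)‖ ^ 2 ∂(muTilde n) = 1 := by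
    intro ξ
    have := hb.unit ξ
    rw [← ofReal_inj, ← integral_complex_ofReal, ofReal_one, ← this]
    refine integral_congr_ae (Filter.Eventually.of_forall fun v => ?_)
    simp only [norm_real, Real.norm_eq_abs, sq_abs]
    push_cast
    ring
  constructor
  · refine Filter.Eventually.of_forall fun ξ => ?_
    simp only [norm_mul, mul_pow]
    exact (h1 ξ).const_mul _
  · simp only [norm_mul, mul_pow, norm_pow, norm_norm, integral_const_mul, h2, mul_one]
    exact (memLp_two_iff_integrable_sq_norm hc.1).1 hc

lemma integrable_conj_mul (hb : UnitKernel b) (c : Lp ℂ 2 (muTilde n))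
    (Φ : Lp ℂ 2 (muTilde2 n)) :
    Integrable (fun p : E n × E n => star (c p.1) * (Φ p * (b p.1 p.2 : ℂ))) (muTilde2 n) := by
  refine ((Lp.memLp Φ).integrable_mul (hb.memLp_mul (Lp.memLp c)).star).congr
    (Filter.Eventually.of_forall fun p => ?_)
  simp only [Pi.mul_apply, Pi.star_apply, star_mul', RCLike.star_def, conj_ofReal]
  ring

lemma inner_toLp_mul (hb : UnitKernel b) (c : Lp ℂ 2 (muTilde n)) (Φ : Lp ℂ 2 (muTilde2 n)) :
    inner ℂ ((hb.memLp_mul (Lp.memLp c)).toLp _) Φ =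
      ∫ ξ, star (c ξ) * ∫ v, Φ (ξ, v) * (b ξ v : ℂ) ∂(muTilde n) ∂(muTilde n) := by
  rw [L2.inner_def]
  have h1 : ∀ᵐ p ∂(muTilde2 n), inner ℂ ((hb.memLp_mul (Lp.memLp c)).toLp _ p) (Φ p) =
      star (c p.1) * (Φ p * (b p.1 p.2 : ℂ)) := by
    filter_upwards [(hb.memLp_mul (Lp.memLp c)).coeFn_toLp] with p hp
    rw [hp, RCLike.inner_apply]
    simp only [map_mul, conj_ofReal, RCLike.star_def]
    ring
  rw [integral_congr_ae h1, integral_prod _ (hb.integrable_conj_mul c Φ)]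
  simp only [integral_const_mul]

/-- If the function `ξ ↦ ∫ Φ(ξ,v) b(ξ,v)` has the same pairings with `L²` as `u ∈ L²`, then it
coincides with `u`. -/
lemma fiber_integral_ae_eq (hb : UnitKernel b) (Φ : Lp ℂ 2 (muTilde2 n))
    (u : Lp ℂ 2 (muTilde n))
    (h : ∀ c : Lp ℂ 2 (muTilde n),
      inner ℂ ((hb.memLp_mul (Lp.memLp c)).toLp _) Φ = inner ℂ c u) :
    (fun ξ => ∫ v, Φ (ξ, v) * (b ξ v : ℂ) ∂(muTilde n)) =ᵐ[muTilde n] u := by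
  have hind : ∀ (s : Set (E n)) (hs : MeasurableSet s) (hμs : muTilde n s < ⊤),
      (fun ξ => star (indicatorConstLp 2 hs hμs.ne (1 : ℂ) ξ) *
        ∫ v, Φ (ξ, v) * (b ξ v : ℂ) ∂(muTilde n)) =ᵐ[muTilde n]
      s.indicator fun ξ => ∫ v, Φ (ξ, v) * (b ξ v : ℂ) ∂(muTilde n) := by
    intro s hs hμs
    filter_upwards [indicatorConstLp_coeFn (p := 2) (hs := hs) (hμs := hμs.ne) (c := (1 : ℂ))]
      with ξ hξ
    rw [hξ]
    by_cases hm : ξ ∈ s <;> simp [hm]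
  -- Indicators of sets of finite measure are admissible choices of `c`. Comparing set integrals
  -- avoids having to know beforehand that the fibre integral is square-integrable.
  refine ae_eq_of_forall_setIntegral_eq_of_sigmaFinite (fun s hs hμs => ?_) (fun s hs hμs => ?_)
    (fun s hs hμs => ?_)
  · have h1 := (hb.integrable_conj_mul (indicatorConstLp 2 hs hμs.ne (1 : ℂ)) Φ).integral_prod_left
    simp only [integral_const_mul] at h1
    exact (integrable_indicator_iff hs).1 (h1.congr (hind s hs hμs))
  · exact integrableOn_Lp_of_measure_ne_top u (by norm_num) hμs.ne
  · have h1 := h (indicatorConstLp 2 hs hμs.ne (1 : ℂ))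
    rw [hb.inner_toLp_mul, L2.inner_indicatorConstLp_one, integral_congr_ae (hind s hs hμs),
      integral_indicator hs] at h1
    exact h1

end UnitKernel

/-- Multi-indices are countable, so one null set of `ξ` serves for all `k`, and completeness applies
on the remaining fibres. The parameter `η` covers two uses: the constant `0` for elementary tensors
and the identity for Hermite coefficients. -/
lemma eq_zero_of_fiber_integral_qk_eq_zero {Φ : Lp ℂ 2 (muTilde2 n)} (η : E n → E n)
    (h : ∀ k : Fin n → ℕ, ∀ᵐ ξ ∂(muTilde n),
      ∫ v, Φ (ξ, v) * (qk k (η ξ) v : ℂ) ∂(muTilde n) = 0) : Φ = 0 := by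
  refine eq_zero_of_fiber_eq_zero ?_
  filter_upwards [ae_all_iff.2 h, memLp_fiber_left (Lp.memLp Φ)] with ξ h1 h2
  exact ae_eq_zero_of_integral_qk_eq_zero (η ξ) h2 h1

/-! ### The operator `F ⊗ I` -/

lemma tensorIncl_tmul (f h : Lp ℂ 2 (muTilde n)) : tensorIncl n (f ⊗ₜ h) =
    MemLp.toLp _ (memLp_tensor (Lp.memLp f) (Lp.memLp h)) := rfl

lemma inner_toLp_tensor (f h : Lp ℂ 2 (muTilde n)) {Φ : E n × E n → ℂ}
    (hΦ : MemLp Φ 2 (muTilde2 n)) :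
    inner ℂ (tensorIncl n (f ⊗ₜ h)) (hΦ.toLp Φ) =
      ∫ v, star (h v) * ∫ u, star (f u) * Φ (u, v) ∂(muTilde n) ∂(muTilde n) := by
  rw [tensorIncl_tmul, L2.inner_def]
  have hm := memLp_tensor (Lp.memLp f) (Lp.memLp h)
  have h1 : ∀ᵐ p ∂(muTilde2 n), inner ℂ (hm.toLp _ p) (hΦ.toLp Φ p) =
      star (h p.2) * (star (f p.1) * Φ p) := by
    filter_upwards [hm.coeFn_toLp, hΦ.coeFn_toLp] with p hp hp'
    rw [hp, hp', RCLike.inner_apply]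
    simp only [map_mul, RCLike.star_def]
    ring
  have h2 : Integrable (fun p : E n × E n => star (h p.2) * (star (f p.1) * Φ p))
      (muTilde2 n) := by
    refine (hΦ.integrable_mul hm.star).congr (Filter.Eventually.of_forall fun p => ?_)
    simp only [Pi.mul_apply, Pi.star_apply, star_mul']
    ring
  rw [integral_congr_ae h1, integral_prod_symm _ h2]
  simp only [integral_const_mul]

/-- By Fubini the `L²` pairing of two elementary tensors factorizes, and the product of inner
products defines the inner product of the algebraic tensor product. -/
lemma inner_tensorIncl (x y : Lp ℂ 2 (muTilde n) ⊗[ℂ] Lp ℂ 2 (muTilde n)) :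
    inner ℂ (tensorIncl n x) (tensorIncl n y) = inner ℂ x y := by
  induction x using TensorProduct.induction_on with
  | zero => simp
  | add x x' hx hx' => simp only [map_add, inner_add_left, hx, hx']
  | tmul f h =>
    induction y using TensorProduct.induction_on with
    | zero => simp
    | add y y' hy hy' => simp only [map_add, inner_add_right, hy, hy']
    | tmul f' h' =>
      rw [tensorIncl_tmul f' h', inner_toLp_tensor, TensorProduct.inner_tmul, L2.inner_def,
        L2.inner_def, mul_comm, ← integral_mul_const]
      refine integral_congr_ae (Filter.Eventually.of_forall fun v => ?_)
      simp only [← mul_assoc, integral_mul_const, RCLike.inner_apply, RCLike.star_def]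
      simp only [mul_comm (f' _)]
      ring

lemma norm_tensorIncl (x : Lp ℂ 2 (muTilde n) ⊗[ℂ] Lp ℂ 2 (muTilde n)) :
    ‖tensorIncl n x‖ = ‖x‖ := by
  rw [@norm_eq_sqrt_re_inner ℂ, @norm_eq_sqrt_re_inner ℂ, inner_tensorIncl]

/-- Tensors whose second factor is some `q_{k,0}` suffice: orthogonality to them makes the fibre
integrals of `Φ` against a complete system vanish. -/
lemma eq_zero_of_inner_tensor_eq_zero {Φ : Lp ℂ 2 (muTilde2 n)}
    (h : ∀ f h : Lp ℂ 2 (muTilde n), inner ℂ (tensorIncl n (f ⊗ₜ h)) Φ = 0) : Φ = 0 := by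
  refine eq_zero_of_fiber_integral_qk_eq_zero (fun _ => 0) fun k => ?_
  have h1 := (unitKernel_qk_const k (0 : E n)).fiber_integral_ae_eq Φ 0 fun c => by
    rw [inner_zero_right, ← h c ((memLp_qk_right k 0).toLp _), tensorIncl_tmul]
    congr 1
    rw [MemLp.toLp_eq_toLp_iff]
    filter_upwards [Measure.quasiMeasurePreserving_snd.ae (memLp_qk_right k (0 : E n)).coeFn_toLp]
      with p hp
    rw [hp]
  filter_upwards [h1, Lp.coeFn_zero ℂ 2 (muTilde n)] with ξ h2 h3
  rw [h2, h3]
  rfl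

lemma denseRange_tensorIncl (n : ℕ) : DenseRange (tensorIncl n) := by
  have h : (LinearMap.range (tensorIncl n)).topologicalClosure = ⊤ := by
    rw [Submodule.topologicalClosure_eq_top_iff, Submodule.eq_bot_iff]
    intro Φ hΦ
    refine eq_zero_of_inner_tensor_eq_zero fun f h => ?_
    exact (Submodule.mem_orthogonal _ _).1 hΦ _ ⟨_, rfl⟩
  exact (Submodule.dense_iff_topologicalClosure_eq_top.2 h)

/-- A tensor product of isometries is an isometry. This equality provides the bound under which the
continuous extension agrees with the algebraic map on its dense domain. -/
lemma norm_tensorIncl_map_fourierF (x : Lp ℂ 2 (muTilde n) ⊗[ℂ] Lp ℂ 2 (muTilde n)) :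
    ‖(tensorIncl n ∘ₗ TensorProduct.map (fourierF n) LinearMap.id) x‖ = ‖tensorIncl n x‖ := by
  rw [LinearMap.comp_apply, norm_tensorIncl, norm_tensorIncl]
  exact TensorProduct.norm_map (fourierFEquiv n).toLinearIsometry LinearIsometry.id x

lemma fourierTensorId_tensorIncl (x : Lp ℂ 2 (muTilde n) ⊗[ℂ] Lp ℂ 2 (muTilde n)) :
    fourierTensorId n (tensorIncl n x) =
      tensorIncl n (TensorProduct.map (fourierF n) LinearMap.id x) :=
  LinearMap.extendOfNorm_eq (denseRange_tensorIncl n)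
    ⟨1, fun x => by rw [norm_tensorIncl_map_fourierF, one_mul]⟩ x

lemma norm_fourierTensorId (Φ : Lp ℂ 2 (muTilde2 n)) : ‖fourierTensorId n Φ‖ = ‖Φ‖ := by
  refine (denseRange_tensorIncl n).induction_on Φ
    (isClosed_eq (fourierTensorId n).continuous.norm continuous_norm) fun x => ?_
  rw [fourierTensorId_tensorIncl]
  exact norm_tensorIncl_map_fourierF x

/-- `F ⊗ I` as a linear isometry. -/
def fourierTensorIdₗᵢ (n : ℕ) : Lp ℂ 2 (muTilde2 n) →ₗᵢ[ℂ] Lp ℂ 2 (muTilde2 n) where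
  toLinearMap := (fourierTensorId n).toLinearMap
  norm_map' := norm_fourierTensorId

lemma inner_fourierTensorId (Φ Ψ : Lp ℂ 2 (muTilde2 n)) :
    inner ℂ (fourierTensorId n Φ) (fourierTensorId n Ψ) = inner ℂ Φ Ψ :=
  (fourierTensorIdₗᵢ n).inner_map_map Φ Ψ

/-- `F ⊗ I` acts on almost every horizontal slice as `F`. -/
lemma fourierTensorId_toLp_eq {g G : E n × E n → ℂ} (hg : MemLp g 2 (muTilde2 n))
    (hG : MemLp G 2 (muTilde2 n))
    (h : ∀ᵐ v ∂(muTilde n), ∀ (h1 : MemLp (fun u => g (u, v)) 2 (muTilde n))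
      (h2 : MemLp (fun u => G (u, v)) 2 (muTilde n)), fourierF n (h1.toLp _) = h2.toLp _) :
    fourierTensorId n (hg.toLp g) = hG.toLp G := by
  rw [← sub_eq_zero]
  refine eq_zero_of_inner_tensor_eq_zero fun f' w => ?_
  -- Since `F` is onto, it is enough to test against `(F f) ⊗ w`, the image of `f ⊗ w`. Both
  -- pairings then reduce to pairings on slices: the first because `F ⊗ I` preserves inner products,
  -- the second because `F` does.
  obtain ⟨f, rfl⟩ := (fourierFEquiv n).surjective f'
  have h1 : tensorIncl n (fourierFEquiv n f ⊗ₜ w) = fourierTensorId n (tensorIncl n (f ⊗ₜ w)) := by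
    rw [fourierTensorId_tensorIncl]
    rfl
  rw [inner_sub_right, inner_toLp_tensor, h1, inner_fourierTensorId, inner_toLp_tensor, sub_eq_zero]
  refine integral_congr_ae ?_
  filter_upwards [h, memLp_fiber_right hg, memLp_fiber_right hG] with v hv hv1 hv2
  have h2 : ∀ (φ : Lp ℂ 2 (muTilde n)) (ψ : E n → ℂ) (hψ : MemLp ψ 2 (muTilde n)),
      ∫ u, star (φ u) * ψ u ∂(muTilde n) = inner ℂ φ (hψ.toLp ψ) := by
    intro φ ψ hψ
    rw [L2.inner_def]
    refine integral_congr_ae ?_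
    filter_upwards [hψ.coeFn_toLp] with u hu
    rw [hu, RCLike.inner_apply, RCLike.star_def, mul_comm]
  simp only [h2 _ _ hv1, h2 _ _ hv2]
  rw [← hv hv1 hv2, ← fourierFEquiv_apply, LinearIsometryEquiv.inner_map_map]

end

section

variable {n : ℕ}

/-! ### Partial Fourier integrals -/

lemma integral_norm_sq_eq {X : Type*} [MeasurableSpace X] {ν : Measure X} (f : Lp ℂ 2 ν) :
    ∫ x, ‖f x‖ ^ 2 ∂ν = ‖f‖ ^ 2 := by
  rw [← ofReal_inj, ← integral_complex_ofReal]
  push_cast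
  have h := @inner_self_eq_norm_sq_to_K ℂ _ _ _ _ f
  rw [L2.inner_def] at h
  refine Eq.trans ?_ h
  refine integral_congr_ae (Filter.Eventually.of_forall fun x => ?_)
  exact (@inner_self_eq_norm_sq_to_K ℂ _ _ _ _ (f x)).symm

lemma integral_norm_sq_toLp {X : Type*} [MeasurableSpace X] {ν : Measure X} {f : X → ℂ}
    (hf : MemLp f 2 ν) : ∫ x, ‖f x‖ ^ 2 ∂ν = ‖hf.toLp f‖ ^ 2 := by
  rw [← integral_norm_sq_eq]
  refine integral_congr_ae ?_
  filter_upwards [hf.coeFn_toLp] with x hx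
  rw [hx]

/-- An isometry of `L²` that is an integral operator on `L¹ ∩ L²` acts on the horizontal slices of
a square-integrable function of two variables. -/
lemma partial_transform {T : Lp ℂ 2 (muTilde n) → Lp ℂ 2 (muTilde n)} (hT : ∀ f, ‖T f‖ = ‖f‖)
    {κ : E n → E n → ℂ} (hκ : Continuous fun p : E n × E n => κ p.1 p.2)
    (hTκ : ∀ (f : E n → ℂ), Integrable f (muTilde n) → ∀ hf2 : MemLp f 2 (muTilde n),
      T (hf2.toLp f) =ᵐ[muTilde n] fun ξ => ∫ u, f u * κ u ξ ∂(muTilde n))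
    {g : E n × E n → ℂ} (hg : MemLp g 2 (muTilde2 n)) (hgm : StronglyMeasurable g)
    (hs : ∀ᵐ v ∂(muTilde n), Integrable (fun u => g (u, v)) (muTilde n)) :
    MemLp (fun p : E n × E n => ∫ u, g (u, p.2) * κ u p.1 ∂(muTilde n)) 2 (muTilde2 n) ∧
    ∀ᵐ v ∂(muTilde n), ∀ (h1 : MemLp (fun u => g (u, v)) 2 (muTilde n))
      (h2 : MemLp (fun ξ => ∫ u, g (u, v) * κ u ξ ∂(muTilde n)) 2 (muTilde n)),
      T (h1.toLp _) = h2.toLp _ := by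
  have key : ∀ᵐ v ∂(muTilde n), ∃ h1 : MemLp (fun u => g (u, v)) 2 (muTilde n),
      T (h1.toLp _) =ᵐ[muTilde n] fun ξ => ∫ u, g (u, v) * κ u ξ ∂(muTilde n) := by
    filter_upwards [hs, memLp_fiber_right hg] with v hv1 hv2
    exact ⟨hv2, hTκ _ hv1 hv2⟩
  -- Joint measurability of the partial integral is where strong measurability of `g` itself, and
  -- not only of its class, is used.
  have hm : StronglyMeasurable
      (fun p : E n × E n => ∫ u, g (u, p.2) * κ u p.1 ∂(muTilde n)) := by
    refine StronglyMeasurable.integral_prod_right'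
      (f := fun q : (E n × E n) × E n => g (q.2, q.1.2) * κ q.2 q.1.1) ?_
    refine StronglyMeasurable.mul (hgm.comp_measurable (by fun_prop)) ?_
    exact (hκ.comp (by fun_prop : Continuous fun q : (E n × E n) × E n => (q.2, q.1.1))
      ).stronglyMeasurable
  refine ⟨(memLp_two_iff_integrable_sq_norm hm.aestronglyMeasurable).2 ?_, ?_⟩
  · have hm2 : AEStronglyMeasurable (fun p : E n × E n =>
        ‖∫ u, g (u, p.2) * κ u p.1 ∂(muTilde n)‖ ^ 2) (muTilde2 n) :=
      (hm.norm.pow 2).aestronglyMeasurable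
    rw [integrable_prod_iff' hm2]
    constructor
    · filter_upwards [key] with v ⟨h1, h2⟩
      have h3 := (memLp_congr_ae h2).1 (Lp.memLp _)
      exact (memLp_two_iff_integrable_sq_norm h3.1).1 h3
    -- By isometry on slices, the squared norm of the transformed slice equals that of the slice of
    -- `g`, whose integral over `v` is finite.
    · have h4 := ((memLp_two_iff_integrable_sq_norm hg.1).1 hg).integral_prod_right
      refine h4.congr ?_
      filter_upwards [key] with v ⟨h1, h2⟩
      simp only [norm_pow, norm_norm]
      rw [integral_norm_sq_toLp h1, ← hT, ← integral_norm_sq_eq]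
      refine integral_congr_ae ?_
      filter_upwards [h2] with ξ hξ
      rw [hξ]
  · filter_upwards [key] with v ⟨h1, h2⟩ _ h3
    refine Lp.ext (h2.trans h3.coeFn_toLp.symm)

/-- On functions with integrable slices `F ⊗ I` is the Fourier integral in the first variable. -/
lemma fourierTensorId_integral {g : E n × E n → ℂ} (hg : MemLp g 2 (muTilde2 n))
    (hgm : StronglyMeasurable g)
    (hs : ∀ᵐ v ∂(muTilde n), Integrable (fun u => g (u, v)) (muTilde n)) :
    ∃ hG : MemLp (fun p : E n × E n =>
        ∫ u, g (u, p.2) * cexp (-I * (inner ℝ u p.1 : ℝ)) ∂(muTilde n)) 2 (muTilde2 n),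
      fourierTensorId n (hg.toLp g) = hG.toLp _ := by
  obtain ⟨h1, h2⟩ := partial_transform (T := fourierF n) (fourierFEquiv n).norm_map
    (κ := fun u ξ => cexp (-I * (inner ℝ u ξ : ℝ))) (by fun_prop)
    (fun f hf hf2 => fourierF_toLp_ae_eq hf hf2) hg hgm hs
  exact ⟨h1, fourierTensorId_toLp_eq hg h1 h2⟩

/-- The inverse of `F ⊗ I` on functions with integrable slices. -/
lemma fourierTensorId_integral_inv {G : E n × E n → ℂ} (hG : MemLp G 2 (muTilde2 n))
    (hGm : StronglyMeasurable G)
    (hs : ∀ᵐ v ∂(muTilde n), Integrable (fun u => G (u, v)) (muTilde n)) :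
    ∃ hg : MemLp (fun p : E n × E n =>
        ∫ u, G (u, p.2) * cexp (I * (inner ℝ u p.1 : ℝ)) ∂(muTilde n)) 2 (muTilde2 n),
      fourierTensorId n (hg.toLp _) = hG.toLp G := by
  obtain ⟨h1, h2⟩ := partial_transform (T := (fourierFEquiv n).symm)
    (fourierFEquiv n).symm.norm_map
    (κ := fun u ξ => cexp (I * (inner ℝ u ξ : ℝ))) (by fun_prop)
    (fun f hf hf2 => fourierFEquiv_symm_toLp_ae_eq hf hf2) hG hGm hs
  refine ⟨h1, fourierTensorId_toLp_eq h1 hG ?_⟩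
  filter_upwards [h2] with v hv hv1 hv2
  rw [← hv hv2 hv1, ← fourierFEquiv_apply, LinearIsometryEquiv.apply_symm_apply]

/-! ### The isometries `c ↦ c(ξ) q_{k,ξ}(v)` -/

lemma memLp_mul_qk (k : Fin n → ℕ) {c : E n → ℂ} (hc : MemLp c 2 (muTilde n)) :
    MemLp (fun p : E n × E n => c p.1 * (qk k p.1 p.2 : ℂ)) 2 (muTilde2 n) :=
  (unitKernel_qk k).memLp_mul hc

/-- The linear map `c ↦ c(ξ) q_{k,ξ}(v)` from `L²(ℝⁿ)` to `L²(ℝ²ⁿ)`. -/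
def hermiteLift (k : Fin n → ℕ) : Lp ℂ 2 (muTilde n) →ₗ[ℂ] Lp ℂ 2 (muTilde2 n) where
  toFun c := (memLp_mul_qk k (Lp.memLp c)).toLp _
  map_add' c d := by
    rw [← MemLp.toLp_add, MemLp.toLp_eq_toLp_iff]
    filter_upwards [Measure.quasiMeasurePreserving_fst.ae (Lp.coeFn_add c d)] with p hp
    simp only [hp, Pi.add_apply, add_mul]
  map_smul' a c := by
    rw [RingHom.id_apply, ← MemLp.toLp_const_smul, MemLp.toLp_eq_toLp_iff]
    filter_upwards [Measure.quasiMeasurePreserving_fst.ae (Lp.coeFn_smul a c)] with p hp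
    simp [hp, mul_assoc]

lemma hermiteLift_apply (k : Fin n → ℕ) (c : Lp ℂ 2 (muTilde n)) :
    hermiteLift k c = (memLp_mul_qk k (Lp.memLp c)).toLp _ := rfl

lemma hermiteLift_toLp (k : Fin n → ℕ) {c : E n → ℂ} (hc : MemLp c 2 (muTilde n)) :
    hermiteLift k (hc.toLp c) = (memLp_mul_qk k hc).toLp _ := by
  rw [hermiteLift_apply, MemLp.toLp_eq_toLp_iff]
  filter_upwards [Measure.quasiMeasurePreserving_fst.ae hc.coeFn_toLp] with p hp
  rw [hp]

/-- Integrating over `v` first leaves `d(ξ)` times a Kronecker delta, by orthonormality on each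
fibre. -/
lemma inner_hermiteLift (k l : Fin n → ℕ) (c d : Lp ℂ 2 (muTilde n)) :
    inner ℂ (hermiteLift k c) (hermiteLift l d) = if k = l then inner ℂ c d else 0 := by
  rw [hermiteLift_apply, (unitKernel_qk k).inner_toLp_mul]
  have h : ∀ᵐ ξ ∂(muTilde n), ∫ v, hermiteLift l d (ξ, v) * (qk k ξ v : ℂ) ∂(muTilde n) =
      d ξ * if k = l then 1 else 0 := by
    filter_upwards [Measure.ae_ae_of_ae_prod (memLp_mul_qk l (Lp.memLp d)).coeFn_toLp] with ξ hξ
    rw [← integral_qk_mul_qk k l ξ, ← integral_const_mul]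
    refine integral_congr_ae ?_
    filter_upwards [hξ] with v hv
    rw [hermiteLift_apply, hv]
    ring
  have h2 : ∀ᵐ ξ ∂(muTilde n),
      star (c ξ) * ∫ v, hermiteLift l d (ξ, v) * (qk k ξ v : ℂ) ∂(muTilde n) =
      (inner ℂ (c ξ) (d ξ)) * if k = l then 1 else 0 := by
    filter_upwards [h] with ξ hξ
    rw [hξ, RCLike.inner_apply, RCLike.star_def]
    ring
  rw [integral_congr_ae h2, integral_mul_const, L2.inner_def]
  split_ifs <;> simp

/-- The map `c ↦ c(ξ) q_{k,ξ}(v)` as a linear isometry. -/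
def hermiteLiftₗᵢ (k : Fin n → ℕ) : Lp ℂ 2 (muTilde n) →ₗᵢ[ℂ] Lp ℂ 2 (muTilde2 n) :=
  (hermiteLift k).isometryOfInner fun c d => by rw [inner_hermiteLift, if_pos rfl]

/-- The adjoint of `c ↦ c(ξ) q_{k,ξ}(v)`. -/
def hermiteCoeff (k : Fin n → ℕ) : Lp ℂ 2 (muTilde2 n) →L[ℂ] Lp ℂ 2 (muTilde n) :=
  ContinuousLinearMap.adjoint (hermiteLiftₗᵢ k).toContinuousLinearMap

lemma inner_hermiteLift_left (k : Fin n → ℕ) (c : Lp ℂ 2 (muTilde n))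
    (Φ : Lp ℂ 2 (muTilde2 n)) :
    inner ℂ (hermiteLift k c) Φ = inner ℂ c (hermiteCoeff k Φ) :=
  (ContinuousLinearMap.adjoint_inner_right (hermiteLiftₗᵢ k).toContinuousLinearMap c Φ).symm

lemma hermiteCoeff_hermiteLift (k l : Fin n → ℕ) (c : Lp ℂ 2 (muTilde n)) :
    hermiteCoeff k (hermiteLift l c) = if k = l then c else 0 := by
  refine ext_inner_left ℂ fun d => ?_
  rw [← inner_hermiteLift_left, inner_hermiteLift]
  split_ifs <;> simp

/-- The adjoint takes values in `L²(ℝⁿ)` by construction. Identifying it with the fibre integral is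
what makes the components of `N` well defined as elements of that space. -/
lemma hermiteCoeff_ae_eq (k : Fin n → ℕ) (Φ : Lp ℂ 2 (muTilde2 n)) :
    (fun ξ => ∫ v, Φ (ξ, v) * (qk k ξ v : ℂ) ∂(muTilde n)) =ᵐ[muTilde n] hermiteCoeff k Φ :=
  (unitKernel_qk k).fiber_integral_ae_eq Φ _ fun c => inner_hermiteLift_left k c Φ

lemma eq_zero_of_hermiteCoeff_eq_zero {Φ : Lp ℂ 2 (muTilde2 n)}
    (h : ∀ k, hermiteCoeff k Φ = 0) : Φ = 0 := by
  refine eq_zero_of_fiber_integral_qk_eq_zero id fun k => ?_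
  filter_upwards [hermiteCoeff_ae_eq k Φ, Lp.coeFn_zero ℂ 2 (muTilde n)] with ξ h1 h2
  rw [id, h1, h, h2]
  rfl

/-- An element of `L²(ℝ²ⁿ)` is determined by its Hermite coefficients. -/
lemma sum_hermiteLift_hermiteCoeff {Φ : Lp ℂ 2 (muTilde2 n)} (s : Finset (Fin n → ℕ))
    (h : ∀ k ∉ s, hermiteCoeff k Φ = 0) : Φ = ∑ k ∈ s, hermiteLift k (hermiteCoeff k Φ) := by
  rw [← sub_eq_zero]
  refine eq_zero_of_hermiteCoeff_eq_zero fun k => ?_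
  simp only [map_sub, map_sum, hermiteCoeff_hermiteLift, Finset.sum_ite_eq]
  split_ifs with hk
  · simp
  · simp [h k hk]

lemma norm_sq_eq_sum_hermiteCoeff {Φ : Lp ℂ 2 (muTilde2 n)} (s : Finset (Fin n → ℕ))
    (h : ∀ k ∉ s, hermiteCoeff k Φ = 0) : ‖Φ‖ ^ 2 = ∑ k ∈ s, ‖hermiteCoeff k Φ‖ ^ 2 := by
  have h1 : (inner ℂ Φ Φ : ℂ) = ∑ k ∈ s, inner ℂ (hermiteCoeff k Φ) (hermiteCoeff k Φ) := by
    conv_lhs => enter [2]; rw [sum_hermiteLift_hermiteCoeff s h]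
    rw [sum_inner]
    exact Finset.sum_congr rfl fun k _ => inner_hermiteLift_left k _ Φ
  simp only [inner_self_eq_norm_sq_to_K] at h1
  exact_mod_cast h1

end

section

variable {n : ℕ}

/-! ### Calculus of the Wirtinger operators -/

lemma dbar_mul (r : Fin n) {f g : (Fin n → ℂ) → ℂ} {z : Fin n → ℂ}
    (hf : DifferentiableAt ℝ f z) (hg : DifferentiableAt ℝ g z) :
    dbar r (fun z => f z * g z) z = dbar r f z * g z + f z * dbar r g z := by
  simp only [dbar, fderiv_fun_mul hf hg, add_apply, smul_apply,
    smul_eq_mul]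
  ring

lemma dbar_sum (r : Fin n) {ι : Type*} (s : Finset ι) {f : ι → (Fin n → ℂ) → ℂ} {z : Fin n → ℂ}
    (hf : ∀ i, DifferentiableAt ℝ (f i) z) :
    dbar r (fun z => ∑ i ∈ s, f i z) z = ∑ i ∈ s, dbar r (f i) z := by
  simp only [dbar, fderiv_fun_sum fun i _ => hf i, sum_apply, Finset.mul_sum,
    ← Finset.sum_add_distrib]

lemma dbar_cexp (r : Fin n) {f : (Fin n → ℂ) → ℂ} {z : Fin n → ℂ}
    (hf : DifferentiableAt ℝ f z) :
    dbar r (fun z => cexp (f z)) z = cexp (f z) * dbar r f z := by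
  have h : fderiv ℝ (fun z => cexp (f z)) z = cexp (f z) • fderiv ℝ f z := hf.hasFDerivAt.cexp.fderiv
  simp only [dbar, h, smul_apply, smul_eq_mul]
  ring

/-- The Wirtinger operators annihilate holomorphic functions. -/
lemma dbar_eq_zero (r : Fin n) {f : (Fin n → ℂ) → ℂ} {z : Fin n → ℂ}
    (hf : DifferentiableAt ℂ f z) : dbar r f z = 0 := by
  have h : (Pi.single r I : Fin n → ℂ) = I • Pi.single r 1 := by
    rw [← Pi.single_smul]
    simp
  rw [dbar, hf.fderiv_restrictScalars ℝ, ContinuousLinearMap.coe_restrictScalars', h, map_smul,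
    smul_eq_mul, ← mul_assoc, I_mul_I]
  ring

lemma dbar_conj_coord (r j : Fin n) (z : Fin n → ℂ) :
    dbar r (fun z => star (z j)) z = if j = r then 1 else 0 := by
  have h : fderiv ℝ (fun z : Fin n → ℂ => star (z j)) z =
      (conjCLE : ℂ →L[ℝ] ℂ).comp (ContinuousLinearMap.proj (φ := fun _ : Fin n => ℂ) j) :=
    ((conjCLE : ℂ →L[ℝ] ℂ).comp
      (ContinuousLinearMap.proj (φ := fun _ : Fin n => ℂ) j)).hasFDerivAt.fderiv
  rw [dbar, h]
  by_cases hj : j = r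
  · subst hj
    simp
    norm_num
  · simp [hj]

lemma dbar_comp_smul (r : Fin n) (t : ℝ) {χ : (Fin n → ℂ) → ℂ} (hχ : Differentiable ℝ χ)
    (z : Fin n → ℂ) : dbar r (fun z => χ (t • z)) z = t * dbar r χ (t • z) := by
  have h : HasFDerivAt (fun z => χ (t • z))
      ((fderiv ℝ χ (t • z)).comp (t • ContinuousLinearMap.id ℝ (Fin n → ℂ))) z :=
    (hχ (t • z)).hasFDerivAt.comp z ((ContinuousLinearMap.id ℝ (Fin n → ℂ)).hasFDerivAt.const_smul t)
  simp only [dbar, h.fderiv, ContinuousLinearMap.comp_apply, smul_apply,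
    ContinuousLinearMap.id_apply, map_smul, real_smul]
  ring

lemma hasCompactSupport_dbar (r : Fin n) {χ : (Fin n → ℂ) → ℂ} (hχ : HasCompactSupport χ) :
    HasCompactSupport (dbar r χ) :=
  ((hχ.fderiv_apply ℝ _).add ((hχ.fderiv_apply ℝ _).mul_left)).mul_left

/-- Integration by parts for the Wirtinger operators. -/
lemma integral_dbar_mul (r : Fin n) {u v : (Fin n → ℂ) → ℂ} (hu : ContDiff ℝ ∞ u)
    (hv : ContDiff ℝ ∞ v) (hvc : HasCompactSupport v) :
    ∫ z, dbar r u z * v z = -∫ z, u z * dbar r v z := by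
  have hu1 : Continuous (fderiv ℝ u) := hu.continuous_fderiv (by simp)
  have hv1 : Continuous (fderiv ℝ v) := hv.continuous_fderiv (by simp)
  have hu0 := hu.continuous
  have hv0 := hv.continuous
  have i1 : ∀ e, Integrable (fun z => fderiv ℝ u z e * v z) := fun e =>
    Continuous.integrable_of_hasCompactSupport (by fun_prop) hvc.mul_left
  have i2 : ∀ e, Integrable (fun z => u z * fderiv ℝ v z e) := fun e =>
    Continuous.integrable_of_hasCompactSupport (by fun_prop) (hvc.fderiv_apply ℝ e).mul_left
  have i3 : Integrable (fun z => u z * v z) :=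
    Continuous.integrable_of_hasCompactSupport (by fun_prop) hvc.mul_left
  have h : ∀ e, ∫ z, fderiv ℝ u z e * v z = -∫ z, u z * fderiv ℝ v z e := fun e => by
    rw [integral_mul_fderiv_eq_neg_fderiv_mul_of_integrable (i1 e) (i2 e) i3
      (fun z _ => hu.differentiable (by simp) z) (fun z _ => hv.differentiable (by simp) z), neg_neg]
  have e1 : ∀ z, dbar r u z * v z = (1 / 2) * (fderiv ℝ u z (Pi.single r 1) * v z) +
      (I / 2) * (fderiv ℝ u z (Pi.single r I) * v z) := fun z => by
    rw [dbar]
    ring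
  have e2 : ∀ z, u z * dbar r v z = (1 / 2) * (u z * fderiv ℝ v z (Pi.single r 1)) +
      (I / 2) * (u z * fderiv ℝ v z (Pi.single r I)) := fun z => by
    rw [dbar]
    ring
  simp only [e1, e2]
  rw [integral_add ((i1 _).const_mul _) ((i1 _).const_mul _),
    integral_add ((i2 _).const_mul _) ((i2 _).const_mul _)]
  simp only [integral_const_mul, h]
  ring

/-- Successive application of the Wirtinger operators of a list of indices, from the head. -/
def dbarList (L : List (Fin n)) (v : (Fin n → ℂ) → ℂ) : (Fin n → ℂ) → ℂ :=
  L.foldl (fun v r => dbar r v) v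

lemma dbarList_cons (r : Fin n) (L : List (Fin n)) (v : (Fin n → ℂ) → ℂ) :
    dbarList (r :: L) v = dbarList L (dbar r v) := rfl

lemma dbarList_linear (L : List (Fin n)) {u v : (Fin n → ℂ) → ℂ} (c : ℂ) (hu : ContDiff ℝ ∞ u)
    (hv : ContDiff ℝ ∞ v) :
    dbarList L (u + v) = dbarList L u + dbarList L v ∧ dbarList L (c • u) = c • dbarList L u := by
  induction L generalizing u v with
  | nil => exact ⟨rfl, rfl⟩
  | cons r L ih =>
    simp only [dbarList_cons, dbar_add r hu hv, dbar_smul r c hu]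
    exact ih (contDiff_dbar r hu) (contDiff_dbar r hv)

lemma dbarList_smul_add_smul (L : List (Fin n)) {u v : (Fin n → ℂ) → ℂ} (c d : ℂ)
    (hu : ContDiff ℝ ∞ u) (hv : ContDiff ℝ ∞ v) :
    dbarList L (c • u + d • v) = c • dbarList L u + d • dbarList L v := by
  have h1 : ContDiff ℝ ∞ (c • u) := contDiff_const.smul hu
  have h2 : ContDiff ℝ ∞ (d • v) := contDiff_const.smul hv
  rw [(dbarList_linear L 0 h1 h2).1, (dbarList_linear L c hu hu).2, (dbarList_linear L d hv hv).2]

lemma contDiff_dbarList (L : List (Fin n)) {v : (Fin n → ℂ) → ℂ} (hv : ContDiff ℝ ∞ v) :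
    ContDiff ℝ ∞ (dbarList L v) := by
  induction L generalizing v with
  | nil => exact hv
  | cons r L ih => exact ih (contDiff_dbar r hv)

lemma hasCompactSupport_dbarList (L : List (Fin n)) {v : (Fin n → ℂ) → ℂ}
    (hv : HasCompactSupport v) : HasCompactSupport (dbarList L v) := by
  induction L generalizing v with
  | nil => exact hv
  | cons r L ih => exact ih (hasCompactSupport_dbar r hv)

lemma contDiff_foldr_dbar (L : List (Fin n)) {f : (Fin n → ℂ) → ℂ} (hf : ContDiff ℝ ∞ f) :
    ContDiff ℝ ∞ (L.foldr dbar f) := by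
  induction L with
  | nil => exact hf
  | cons r L ih => exact contDiff_dbar r ih

/-- The operator at the head is applied last to `f`, so it is the first to move onto `v`, in
agreement with `dbarList`. No commutation of Wirtinger operators is needed. -/
lemma integral_foldr_dbar_mul (L : List (Fin n)) {f v : (Fin n → ℂ) → ℂ} (hf : ContDiff ℝ ∞ f)
    (hv : ContDiff ℝ ∞ v) (hvc : HasCompactSupport v) :
    ∫ z, L.foldr dbar f z * v z = (-1) ^ L.length * ∫ z, f z * dbarList L v z := by
  induction L generalizing v with
  | nil => simp [dbarList]
  | cons r L ih =>
    rw [List.foldr_cons, integral_dbar_mul r (contDiff_foldr_dbar L hf) hv hvc,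
      ih (contDiff_dbar r hv) (hasCompactSupport_dbar r hvc), dbarList_cons, List.length_cons]
    ring

/-- The list in which every index `r` occurs `k r` times. -/
def indexList (k : Fin n → ℕ) : List (Fin n) :=
  (List.finRange n).flatMap fun r => List.replicate (k r) r

lemma foldr_indexList (k : Fin n → ℕ) (f : (Fin n → ℂ) → ℂ) :
    (indexList k).foldr dbar f = dbarPow k f := by
  rw [indexList, List.foldr_flatMap, dbarPow]
  congr 1
  funext r g
  induction k r with
  | zero => rfl
  | succ p ih => rw [List.replicate_succ, List.foldr_cons, ih, Function.iterate_succ_apply']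

lemma sum_map_indexList (k : Fin n → ℕ) :
    ((indexList k).map fun r => (Pi.single r 1 : Fin n → ℕ)).sum = k := by
  have h : ∀ l : List (Fin n), ((l.flatMap fun r => List.replicate (k r) r).map
      fun r => (Pi.single r 1 : Fin n → ℕ)).sum = (l.map fun r => Pi.single r (k r)).sum := by
    intro l
    induction l with
    | nil => rfl
    | cons r l ih =>
      rw [List.flatMap_cons, List.map_append, List.sum_append, ih, List.map_cons, List.sum_cons,
        List.map_replicate, List.sum_replicate]
      congr 1
      rw [← Pi.single_smul]
      simp
  rw [indexList, h, ← Fin.sum_univ_def, Finset.univ_sum_single]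

/-! ### Orthogonality of polyanalytic functions to the higher kernels -/

/-- The functions `(a z + s)^k exp(-a² |z|² - a s·z̄)`. -/
def fockKernel (a : ℝ) (s : E n) (k : Fin n → ℕ) (z : Fin n → ℂ) : ℂ :=
  (∏ j, ((a : ℂ) * z j + s j) ^ k j) *
    cexp (∑ j, -(a * ((a : ℂ) * z j + s j)) * star (z j))

lemma contDiff_fockKernel (a : ℝ) (s : E n) (k : Fin n → ℕ) :
    ContDiff ℝ ∞ (fockKernel a s k) := by
  have h : ∀ j, ContDiff ℝ ∞ fun z : Fin n → ℂ => star (z j) := fun j =>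
    (conjCLE : ℂ →L[ℝ] ℂ).contDiff.comp (contDiff_apply ℝ ℂ j)
  have h1 : ∀ j, ContDiff ℝ ∞ fun z : Fin n → ℂ => z j := contDiff_apply ℝ ℂ
  unfold fockKernel
  refine ContDiff.mul (contDiff_prod fun j _ => ?_) (ContDiff.cexp (ContDiff.sum fun j _ => ?_))
  · exact ((contDiff_const.mul (h1 j)).add contDiff_const).pow _
  · exact (contDiff_const.mul ((contDiff_const.mul (h1 j)).add contDiff_const)).neg.mul (h j)

/-- Everything in the kernel except the factors `z̄_j` of the exponent is holomorphic.
Differentiating the exponential thus brings down `-a (a z_r + s_r)`, which raises the `r`-th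
exponent by one. -/
lemma dbar_fockKernel (a : ℝ) (s : E n) (k : Fin n → ℕ) (r : Fin n) :
    dbar r (fockKernel a s k) = (-a : ℂ) • fockKernel a s (k + Pi.single r 1) := by
  funext z
  have hs : ∀ j, DifferentiableAt ℝ (fun z : Fin n → ℂ => star (z j)) z := fun j =>
    ((conjCLE : ℂ →L[ℝ] ℂ).comp
      (ContinuousLinearMap.proj (φ := fun _ : Fin n => ℂ) j)).differentiableAt
  have h0 : ∀ j, DifferentiableAt ℂ (fun z : Fin n → ℂ => -(a * ((a : ℂ) * z j + s j))) z :=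
    fun j => by fun_prop
  have h1 : DifferentiableAt ℂ (fun z : Fin n → ℂ => ∏ j, ((a : ℂ) * z j + s j) ^ k j) z := by
    fun_prop
  have h2 : ∀ j, DifferentiableAt ℝ
      (fun z : Fin n → ℂ => -(a * ((a : ℂ) * z j + s j)) * star (z j)) z := fun j =>
    ((h0 j).restrictScalars ℝ).mul (hs j)
  have h3 : DifferentiableAt ℝ
      (fun z : Fin n → ℂ => ∑ j, -(a * ((a : ℂ) * z j + s j)) * star (z j)) z :=
    DifferentiableAt.fun_sum fun j _ => h2 j
  have h4 : dbar r (fun z : Fin n → ℂ => ∑ j, -(a * ((a : ℂ) * z j + s j)) * star (z j)) z =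
      -(a * ((a : ℂ) * z r + s r)) := by
    rw [dbar_sum r _ h2]
    have : ∀ j, dbar r (fun z : Fin n → ℂ => -(a * ((a : ℂ) * z j + s j)) * star (z j)) z =
        if j = r then -(a * ((a : ℂ) * z j + s j)) else 0 := fun j => by
      rw [dbar_mul r ((h0 j).restrictScalars ℝ) (hs j), dbar_eq_zero r (h0 j), dbar_conj_coord]
      simp
    simp only [this, Finset.sum_ite_eq', Finset.mem_univ, if_true]
  have h5 : ∏ j, ((a : ℂ) * z j + s j) ^ (k + Pi.single r 1 : Fin n → ℕ) j =
      (∏ j, ((a : ℂ) * z j + s j) ^ k j) * ((a : ℂ) * z r + s r) := by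
    simp only [Pi.add_apply, pow_add, Finset.prod_mul_distrib]
    congr 1
    rw [Finset.prod_eq_single r (fun j _ hj => by simp [hj]) (by simp)]
    simp
  unfold fockKernel
  rw [dbar_mul r (h1.restrictScalars ℝ) h3.cexp, dbar_eq_zero r h1, dbar_cexp r h3, h4,
    Pi.smul_apply, h5, smul_eq_mul]
  ring

lemma dbarList_fockKernel (a : ℝ) (s : E n) (k : Fin n → ℕ) (L : List (Fin n)) :
    dbarList L (fockKernel a s k) = (-a : ℂ) ^ L.length •
      fockKernel a s (k + (L.map fun r => (Pi.single r 1 : Fin n → ℕ)).sum) := by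
  induction L generalizing k with
  | nil => simp [dbarList]
  | cons r L ih =>
    rw [dbarList_cons, dbar_fockKernel,
      (dbarList_linear L _ (contDiff_fockKernel a s _) (contDiff_fockKernel a s k)).2, ih,
      List.map_cons, List.sum_cons, List.length_cons, smul_smul, pow_succ', add_assoc]

section Cutoff

variable {a : ℝ} {s : E n} {f : (Fin n → ℂ) → ℂ}

lemma integrable_mul_dbarList {v : (Fin n → ℂ) → ℂ} (hf : Continuous f) (hv : ContDiff ℝ ∞ v)
    (hvc : HasCompactSupport v) (L : List (Fin n)) :
    Integrable fun z => f z * dbarList L v z :=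
  Continuous.integrable_of_hasCompactSupport (hf.mul (contDiff_dbarList L hv).continuous)
    (hasCompactSupport_dbarList L hvc).mul_left

lemma hasCompactSupport_cutoff_mul {χ : (Fin n → ℂ) → ℂ} (hχ : HasCompactSupport χ) (N : ℕ)
    (g : (Fin n → ℂ) → ℂ) :
    HasCompactSupport fun z => χ (((N : ℝ) + 1)⁻¹ • z) * g z :=
  (hχ.comp_smul (by positivity : ((N : ℝ) + 1)⁻¹ ≠ 0)).mul_right

/-- In the Leibniz rule a derivative falling on the cutoff produces a factor `1/(N+1)` and the new
cutoff `dbar r χ`. The induction ranges over all cutoffs and all `k`: the error integral then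
converges by the same statement for `dbar r χ`, and the factor sends it to zero. -/
lemma tendsto_integral_cutoff (hf : Continuous f)
    (hint : ∀ k, Integrable fun z => f z * fockKernel a s k z) (L : List (Fin n))
    {χ : (Fin n → ℂ) → ℂ} (hχ : ContDiff ℝ ∞ χ) (hχc : HasCompactSupport χ) (k : Fin n → ℕ) :
    Filter.Tendsto (fun N : ℕ => ∫ z, f z *
        dbarList L (fun z => χ (((N : ℝ) + 1)⁻¹ • z) * fockKernel a s k z) z) Filter.atTop
      (nhds (χ 0 * ∫ z, f z * dbarList L (fockKernel a s k) z)) := by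
  have htend : Filter.Tendsto (fun N : ℕ => ((N : ℝ) + 1)⁻¹) Filter.atTop (nhds 0) := by
    simpa [one_div] using tendsto_one_div_add_atTop_nhds_zero_nat (𝕜 := ℝ)
  induction L generalizing χ k with
  | nil =>
    simp only [dbarList, List.foldl_nil]
    rw [← integral_const_mul]
    obtain ⟨C, hC⟩ := hχc.exists_bound_of_continuous hχ.continuous
    have hS := (contDiff_fockKernel a s k).continuous
    have hχ0 := hχ.continuous
    refine tendsto_integral_of_dominated_convergence
      (fun z => C * ‖f z * fockKernel a s k z‖) (fun N => ?_) ((hint k).norm.const_mul C)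
      (fun N => Filter.Eventually.of_forall fun z => ?_) (Filter.Eventually.of_forall fun z => ?_)
    · exact Continuous.aestronglyMeasurable (by fun_prop)
    · rw [mul_left_comm, norm_mul]
      exact mul_le_mul_of_nonneg_right (hC _) (norm_nonneg _)
    · have h1 : Filter.Tendsto (fun N : ℕ => χ (((N : ℝ) + 1)⁻¹ • z)) Filter.atTop
          (nhds (χ ((0 : ℝ) • z))) := (hχ0.tendsto _).comp (htend.smul_const z)
      rw [zero_smul] at h1
      simpa [mul_left_comm] using h1.mul_const (f z * fockKernel a s k z)
  | cons r L ih =>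
    have hsm : ∀ (χ : (Fin n → ℂ) → ℂ), ContDiff ℝ ∞ χ → ∀ (N : ℕ) (k : Fin n → ℕ),
        ContDiff ℝ ∞ fun z => χ (((N : ℝ) + 1)⁻¹ • z) * fockKernel a s k z := fun χ hχ N k =>
      (hχ.comp (contDiff_const_smul _)).mul (contDiff_fockKernel a s k)
    have hstep : ∀ N : ℕ, dbar r (fun z => χ (((N : ℝ) + 1)⁻¹ • z) * fockKernel a s k z) =
        (-a : ℂ) • (fun z => χ (((N : ℝ) + 1)⁻¹ • z) * fockKernel a s (k + Pi.single r 1) z) +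
        ((((N : ℝ) + 1)⁻¹ : ℝ) : ℂ) •
          (fun z => dbar r χ (((N : ℝ) + 1)⁻¹ • z) * fockKernel a s k z) := by
      intro N
      funext z
      have h1 : DifferentiableAt ℝ (fun z => χ (((N : ℝ) + 1)⁻¹ • z)) z :=
        (hχ.comp (contDiff_const_smul _)).differentiable (by simp) z
      rw [dbar_mul r h1 ((contDiff_fockKernel a s k).differentiable (by simp) z),
        dbar_comp_smul r _ (hχ.differentiable (by simp)), dbar_fockKernel]
      simp only [Pi.add_apply, Pi.smul_apply, smul_eq_mul]
      ring
    have hχ' := contDiff_dbar r hχ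
    have hχc' := hasCompactSupport_dbar r hχc
    have hstep2 : ∀ N : ℕ, ∫ z, f z *
        dbarList (r :: L) (fun z => χ (((N : ℝ) + 1)⁻¹ • z) * fockKernel a s k z) z =
        (-a : ℂ) * (∫ z, f z * dbarList L
          (fun z => χ (((N : ℝ) + 1)⁻¹ • z) * fockKernel a s (k + Pi.single r 1) z) z) +
        ((((N : ℝ) + 1)⁻¹ : ℝ) : ℂ) * ∫ z, f z * dbarList L
          (fun z => dbar r χ (((N : ℝ) + 1)⁻¹ • z) * fockKernel a s k z) z := by
      intro N
      have c1 := hsm χ hχ N (k + Pi.single r 1)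
      have c2 := hsm _ hχ' N k
      rw [dbarList_cons, hstep N, dbarList_smul_add_smul L _ _ c1 c2, ← integral_const_mul,
        ← integral_const_mul, ← integral_add]
      · refine integral_congr_ae (Filter.Eventually.of_forall fun z => ?_)
        simp only [Pi.add_apply, Pi.smul_apply, smul_eq_mul]
        ring
      · exact (integrable_mul_dbarList hf c1 (hasCompactSupport_cutoff_mul hχc N _) L).const_mul _
      · exact (integrable_mul_dbarList hf c2 (hasCompactSupport_cutoff_mul hχc' N _) L).const_mul _
    simp only [hstep2]
    have hc : Filter.Tendsto (fun N : ℕ => ((((N : ℝ) + 1)⁻¹ : ℝ) : ℂ)) Filter.atTop (nhds 0) := by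
      exact ofReal_zero ▸ (continuous_ofReal.tendsto 0).comp htend
    have h1 := ((ih hχ hχc (k + Pi.single r 1)).const_mul (-a : ℂ)).add (hc.mul (ih hχ' hχc' k))
    convert h1 using 2
    rw [zero_mul, add_zero, dbarList_cons, dbar_fockKernel,
      (dbarList_linear L _ (contDiff_fockKernel a s _) (contDiff_fockKernel a s k)).2]
    simp only [Pi.smul_apply, smul_eq_mul, mul_left_comm (f _), integral_const_mul]
    ring

/-- An `m`-analytic function is orthogonal to the kernels of degree at least `m`. -/
lemma integral_mul_fockKernel_eq_zero {m : ℕ} (ha : a ≠ 0) (hf : IsPolyanalytic m f)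
    (hint : ∀ k, Integrable fun z => f z * fockKernel a s k z) {k : Fin n → ℕ}
    (hk : m ≤ ∑ r, k r) : ∫ z, f z * fockKernel a s k z = 0 := by
  -- With `k'` of degree exactly `m`, the kernel of index `k` is, up to the factor `(-a)^m`, the
  -- `k'`-th `∂̄`-derivative of the kernel of index `k - k'`.
  obtain ⟨k', hk', hm⟩ : ∃ k' ≤ k, ∑ r, k' r = m := by
    obtain ⟨g, hg, hd⟩ := Finsupp.exists_le_degree_eq (Finsupp.equivFunOnFinite.symm k) m
      (by simpa [Finsupp.degree_eq_sum] using hk)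
    exact ⟨g, hg, by simpa [Finsupp.degree_eq_sum] using hd⟩
  set L := indexList k'
  obtain ⟨χ, -, hχc, hχ, -, hχ0⟩ := exists_contDiff_tsupport_subset (n := ⊤)
    (Filter.univ_mem : (Set.univ : Set (Fin n → ℂ)) ∈ nhds 0)
  have hχ' : ContDiff ℝ ∞ fun z => (χ z : ℂ) := ofRealCLM.contDiff.comp hχ
  have hχc' : HasCompactSupport fun z => (χ z : ℂ) :=
    hχc.comp_left (g := ((↑) : ℝ → ℂ)) (by simp)
  have h1 := tendsto_integral_cutoff hf.1.continuous hint L hχ' hχc' (k - k')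
  have h2 : ∀ N : ℕ, ∫ z, f z * dbarList L
      (fun z => (χ (((N : ℝ) + 1)⁻¹ • z) : ℂ) * fockKernel a s (k - k') z) z = 0 := by
    intro N
    have h3 := integral_foldr_dbar_mul L hf.1
      ((hχ'.comp (contDiff_const_smul ((N : ℝ) + 1)⁻¹)).mul (contDiff_fockKernel a s (k - k')))
      (hasCompactSupport_cutoff_mul hχc' N _)
    rw [foldr_indexList, hf.2 k' hm] at h3
    simp only [Pi.zero_apply, zero_mul, integral_zero] at h3
    exact (mul_eq_zero.1 h3.symm).resolve_left (pow_ne_zero _ (by norm_num))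
  simp only [h2] at h1
  have h4 := tendsto_nhds_unique h1 tendsto_const_nhds
  rw [hχ0, ofReal_one, one_mul, dbarList_fockKernel, sum_map_indexList, tsub_add_cancel_of_le hk'] at h4
  simp only [Pi.smul_apply, smul_eq_mul, mul_left_comm (f _), integral_const_mul] at h4
  exact (mul_eq_zero.1 h4).resolve_left (pow_ne_zero _ (by simpa using ha))

end Cutoff

end

section

variable {n : ℕ}

/-! ### The change of variables `z = (x + i y)/√α` -/

lemma integral_gaussian_complex {α : ℝ} (hα : 0 < α) :
    ∫ z : Fin n → ℂ, Real.exp (-α * ∑ r, ‖z r‖ ^ 2) = (Real.pi / α) ^ n := by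
  have h1 : ∀ z : Fin n → ℂ, Real.exp (-α * ∑ r, ‖z r‖ ^ 2) =
      ∏ r, Real.exp (-α * ‖z r‖ ^ 2) := fun z => by
    rw [Finset.mul_sum, Real.exp_sum]
  simp only [h1]
  rw [integral_fintype_prod_volume_eq_prod (fun (_ : Fin n) (z : ℂ) => Real.exp (-α * ‖z‖ ^ 2)),
    GaussianFourier.integral_rexp_neg_mul_sq_norm hα]
  simp [div_pow]

lemma integral_gaussian_muTilde2 (n : ℕ) :
    ∫ p : E n × E n, Real.exp (-(‖p.1‖ ^ 2 + ‖p.2‖ ^ 2)) ∂(muTilde2 n) = (1 / 2) ^ n := by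
  have h1 : ∫ x : E n, Real.exp (-‖x‖ ^ 2) ∂(muTilde n) = (1 / 2 : ℝ) ^ ((n : ℝ) / 2) := by
    have h := GaussianFourier.integral_rexp_neg_mul_sq_norm (V := E n) one_pos
    simp only [neg_mul, one_mul, div_one, finrank_euclideanSpace, Fintype.card_fin] at h
    rw [muTilde, integral_smul_measure, ENNReal.toReal_ofReal (by positivity), h, smul_eq_mul,
      neg_div, Real.rpow_neg (by positivity), ← Real.inv_rpow (by positivity),
      ← Real.mul_rpow (by positivity) (by positivity)]
    congr 1
    have := Real.pi_pos
    field_simp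
  have h2 : ∀ p : E n × E n, Real.exp (-(‖p.1‖ ^ 2 + ‖p.2‖ ^ 2)) =
      Real.exp (-‖p.1‖ ^ 2) * Real.exp (-‖p.2‖ ^ 2) := fun p => by
    rw [← Real.exp_add]
    ring_nf
  simp only [h2]
  rw [integral_prod_mul (fun x : E n => Real.exp (-‖x‖ ^ 2)) (fun x : E n => Real.exp (-‖x‖ ^ 2)),
    h1, ← Real.rpow_add (by norm_num), add_halves, Real.rpow_natCast]

/-- The image of `(2π)^{-n} μ_{2n}` under `(x, y) ↦ (x + i y)/√α`. -/
lemma map_cpointEquiv (α : ℝ) [hα : Fact (0 < α)] (n : ℕ) :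
    (muTilde2 n).map (cpointEquiv α n) =
      ENNReal.ofReal ((α / (2 * Real.pi)) ^ n) • (volume : Measure (Fin n → ℂ)) := by
  have hα' := hα.out
  have hπ := Real.pi_pos
  have : ((muTilde2 n).map (cpointEquiv α n)).IsAddHaarMeasure :=
    (cpointEquiv α n).isAddHaarMeasure_map _
  -- The image is a Haar measure, hence a multiple of Lebesgue measure; the integral of one Gaussian
  -- determines the factor.
  have h := Measure.isAddLeftInvariant_eq_smul ((muTilde2 n).map (cpointEquiv α n)) volume
  set κ := Measure.addHaarScalarFactor ((muTilde2 n).map (cpointEquiv α n)) volume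
  have h1 : ∫ z, Real.exp (-α * ∑ r, ‖z r‖ ^ 2) ∂((muTilde2 n).map (cpointEquiv α n)) =
      (1 / 2) ^ n := by
    rw [integral_map (cpointEquiv α n).continuous.aemeasurable
      (Continuous.aestronglyMeasurable (by fun_prop)), ← integral_gaussian_muTilde2]
    refine integral_congr_ae (Filter.Eventually.of_forall fun p => ?_)
    have e1 : (cpointEquiv α n) p = cpoint α p := rfl
    simp only [e1, neg_mul, norm_cpoint]
  rw [h, integral_smul_nnreal_measure, integral_gaussian_complex hα'] at h1
  have h2 : (κ : ℝ) = (α / (2 * Real.pi)) ^ n := by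
    have h3 : (κ : ℝ) * (Real.pi / α) ^ n = (1 / 2) ^ n := h1
    have h4 : (Real.pi / α) ^ n ≠ 0 := by positivity
    rw [← mul_left_inj' h4, h3, ← mul_pow]
    congr 1
    field_simp
  rw [h, ← h2, ENNReal.ofReal_coe_nnreal]
  rfl

lemma measurableEmbedding_cpoint (α : ℝ) [Fact (0 < α)] (n : ℕ) :
    MeasurableEmbedding (cpoint α : E n × E n → Fin n → ℂ) :=
  (cpointEquiv α n).toHomeomorph.measurableEmbedding

lemma integral_comp_cpoint (α : ℝ) [hα : Fact (0 < α)] {F : Type*} [NormedAddCommGroup F]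
    [NormedSpace ℝ F] (g : (Fin n → ℂ) → F) :
    ∫ p, g (cpoint α p) ∂(muTilde2 n) = ((α / (2 * Real.pi)) ^ n) • ∫ z, g z := by
  have hα' := hα.out
  have h2 : (muTilde2 n).map (cpoint α) =
    ENNReal.ofReal ((α / (2 * Real.pi)) ^ n) • (volume : Measure (Fin n → ℂ)) :=
    map_cpointEquiv α n
  rw [← (measurableEmbedding_cpoint α n).integral_map g, h2, integral_smul_measure,
    ENNReal.toReal_ofReal (by positivity)]

lemma integrable_comp_cpoint (α : ℝ) [hα : Fact (0 < α)] {F : Type*} [NormedAddCommGroup F]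
    {g : (Fin n → ℂ) → F} :
    Integrable (fun p => g (cpoint α p)) (muTilde2 n) ↔ Integrable g := by
  have hα' := hα.out
  have hπ := Real.pi_pos
  have h2 : (muTilde2 n).map (cpoint α) =
    ENNReal.ofReal ((α / (2 * Real.pi)) ^ n) • (volume : Measure (Fin n → ℂ)) :=
    map_cpointEquiv α n
  have h3 : ENNReal.ofReal ((α / (2 * Real.pi)) ^ n) ≠ 0 := by
    rw [Ne, ENNReal.ofReal_eq_zero, not_le]
    positivity
  rw [← integrable_smul_measure (f := g) (μ := volume) h3 ENNReal.ofReal_ne_top, ← h2,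
    (measurableEmbedding_cpoint α n).integrable_map_iff]
  rfl

lemma flatten_apply (α : ℝ) (f : (Fin n → ℂ) → ℂ) (p : E n × E n) :
    flatten α n f p = (((2 : ℝ) ^ ((n : ℝ) / 2) : ℝ) : ℂ) *
      cexp (-(‖p.1‖ ^ 2 : ℝ) / 2 - (‖p.2‖ ^ 2 : ℝ) / 2 - I * (inner ℝ p.1 p.2 : ℝ)) *
        f (cpoint α p) := rfl

lemma two_rpow_sq (n : ℕ) : ((2 : ℝ) ^ ((n : ℝ) / 2)) ^ 2 = 2 ^ n := by
  rw [← Real.rpow_natCast, ← Real.rpow_mul (by norm_num), ← Real.rpow_natCast]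
  congr 1
  push_cast
  ring

lemma norm_flatten (α : ℝ) [Fact (0 < α)] (f : (Fin n → ℂ) → ℂ) (p : E n × E n) :
    ‖flatten α n f p‖ = (2 : ℝ) ^ ((n : ℝ) / 2) *
      (‖f (cpoint α p)‖ * Real.exp (-(α / 2) * ∑ r, ‖cpoint α p r‖ ^ 2)) := by
  have e4 : ‖cexp (-(‖p.1‖ ^ 2 : ℝ) / 2 - (‖p.2‖ ^ 2 : ℝ) / 2 - I * (inner ℝ p.1 p.2 : ℝ))‖
      = Real.exp (-(α / 2) * ∑ r, ‖cpoint α p r‖ ^ 2) := by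
    rw [norm_exp]
    congr 1
    have h := norm_cpoint α p
    have : (-(‖p.1‖ ^ 2 : ℝ) / 2 - (‖p.2‖ ^ 2 : ℝ) / 2 - I * (inner ℝ p.1 p.2 : ℝ) : ℂ).re
        = -‖p.1‖ ^ 2 / 2 - ‖p.2‖ ^ 2 / 2 := by
      simp only [sub_re, mul_re, I_re, I_im, ofReal_re, ofReal_im, neg_re, div_ofNat_re]
      ring
    rw [this]
    linear_combination (1 / 2) * h
  rw [flatten_apply, norm_mul, norm_mul, e4, norm_real, Real.norm_of_nonneg (by positivity)]
  ring

lemma norm_sq_flatten (α : ℝ) [Fact (0 < α)] (f : (Fin n → ℂ) → ℂ) (p : E n × E n) :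
    ‖flatten α n f p‖ ^ 2 = 2 ^ n *
      (Real.exp (-α * ∑ r, ‖cpoint α p r‖ ^ 2) * ‖f (cpoint α p)‖ ^ 2) := by
  have h : Real.exp (-(α / 2) * ∑ r, ‖cpoint α p r‖ ^ 2) ^ 2 =
      Real.exp (-α * ∑ r, ‖cpoint α p r‖ ^ 2) := by
    rw [← Real.exp_nat_mul]
    congr 1
    push_cast
    ring
  rw [norm_flatten, mul_pow, mul_pow, h, two_rpow_sq, mul_comm (‖f _‖ ^ 2)]

lemma memLp_gaussian_of_memLp_flatten (α : ℝ) [hα : Fact (0 < α)] {f : (Fin n → ℂ) → ℂ}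
    (hf : Continuous f) (h : MemLp (flatten α n f) 2 (muTilde2 n)) :
    MemLp f 2 (gaussian α n) := by
  have hα' := hα.out
  have hπ := Real.pi_pos
  rw [memLp_two_iff_integrable_sq_norm h.1] at h
  simp only [norm_sq_flatten] at h
  rw [integrable_comp_cpoint α
    (g := fun z => 2 ^ n * (Real.exp (-α * ∑ r, ‖z r‖ ^ 2) * ‖f z‖ ^ 2))] at h
  rw [memLp_two_iff_integrable_sq_norm hf.aestronglyMeasurable, gaussian,
    integrable_withDensity_iff_integrable_smul' (by fun_prop) (by simp)]
  refine (h.const_mul ((α ^ n / Real.pi ^ n) / 2 ^ n)).congr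
    (Filter.Eventually.of_forall fun z => ?_)
  simp only
  rw [ENNReal.toReal_ofReal (by positivity), smul_eq_mul]
  field_simp

lemma integral_norm_sq_flatten (α : ℝ) [hα : Fact (0 < α)] (f : (Fin n → ℂ) → ℂ) :
    ∫ p, ‖flatten α n f p‖ ^ 2 ∂(muTilde2 n) = ∫ z, ‖f z‖ ^ 2 ∂(gaussian α n) := by
  have hα' := hα.out
  have hπ := Real.pi_pos
  simp only [norm_sq_flatten]
  rw [integral_comp_cpoint α
    (fun z => 2 ^ n * (Real.exp (-α * ∑ r, ‖z r‖ ^ 2) * ‖f z‖ ^ 2)), gaussian,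
    integral_withDensity_eq_integral_toReal_smul₀ (Measurable.aemeasurable (by fun_prop))
      (by simp), ← integral_smul]
  refine integral_congr_ae (Filter.Eventually.of_forall fun z => ?_)
  simp only
  rw [ENNReal.toReal_ofReal (by positivity), smul_eq_mul, smul_eq_mul, div_pow, mul_pow]
  field_simp

/-! ### The inverse partial transform of Gaussian multiples of `q_{k,ξ}` -/

section OneDim

variable (x y : ℝ)

/-- The function `p((ξ + 2y)/√2) exp(-ξ²/2 - yξ + ixξ)`. -/
def hermiteWave (p : Polynomial ℝ) (ξ : ℝ) : ℂ :=
  ((p.eval ((ξ + 2 * y) / Real.sqrt 2) : ℝ) : ℂ) * cexp (I * (x + I * y) * ξ) *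
    (Real.exp (-(1 / 2) * ‖ξ‖ ^ 2) : ℂ)

lemma integrable_hermiteWave_mul (p : Polynomial ℝ) {f : ℝ → ℂ} (hf : ExpBdd f) :
    Integrable fun ξ => f ξ * hermiteWave x y p ξ := by
  have h1 : ExpBdd fun ξ : ℝ => (((ξ + 2 * y) / Real.sqrt 2 : ℝ) : ℂ) := by
    have h := (ExpBdd.const (2 * (y : ℂ) / (Real.sqrt 2 : ℂ))).add
      ((ExpBdd.const (1 / (Real.sqrt 2 : ℂ))).mul
        (ExpBdd.of_clm_real (ContinuousLinearMap.id ℝ ℝ)))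
    convert h using 2
    simp
    ring
  have h2 : ExpBdd fun ξ : ℝ => cexp (I * (x + I * y) * ξ) := by
    have h := ExpBdd.cexp_clm ((I * (x + I * y)) • ofRealCLM)
    simpa using h
  refine ((hf.mul ((h1.eval p).mul h2)).integrable_gaussian (b := 1 / 2) (by norm_num)).congr
    (Filter.Eventually.of_forall fun ξ => ?_)
  simp only [hermiteWave]
  ring

lemma integrable_hermiteWave (p : Polynomial ℝ) : Integrable (hermiteWave x y p) := by
  simpa using integrable_hermiteWave_mul x y p (ExpBdd.const 1)

lemma hasDerivAt_hermiteWave (p : Polynomial ℝ) (ξ : ℝ) :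
    HasDerivAt (hermiteWave x y p) ((1 / Real.sqrt 2 : ℝ) * hermiteWave x y (Polynomial.derivative p) ξ
      + (I * (x + I * y) - ξ) * hermiteWave x y p ξ) ξ := by
  have h1 : HasDerivAt (fun ξ : ℝ => ((p.eval ((ξ + 2 * y) / Real.sqrt 2) : ℝ) : ℂ))
      (((Polynomial.derivative p).eval ((ξ + 2 * y) / Real.sqrt 2) * (1 / Real.sqrt 2) : ℝ) : ℂ) ξ :=
    ((p.hasDerivAt _).comp ξ (((hasDerivAt_id ξ).add_const (2 * y)).div_const _)).ofReal_comp
  have h2 : HasDerivAt (fun ξ : ℝ => cexp (I * (x + I * y) * ξ))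
      (cexp (I * (x + I * y) * ξ) * (I * (x + I * y) * 1)) ξ :=
    ((hasDerivAt_id ξ).ofReal_comp.const_mul _).cexp
  have h3 : HasDerivAt (fun ξ : ℝ => (Real.exp (-(1 / 2) * ‖ξ‖ ^ 2) : ℂ))
      ((Real.exp (-(1 / 2) * ‖ξ‖ ^ 2) * (-(1 / 2) * (2 * ξ)) : ℝ) : ℂ) ξ := by
    simp only [Real.norm_eq_abs, sq_abs]
    have := (((hasDerivAt_pow 2 ξ).const_mul (-(1 / 2))).exp).ofReal_comp
    simpa using this
  refine ((h1.mul h2).mul h3).congr_deriv ?_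
  simp only [hermiteWave, Pi.mul_apply]
  push_cast
  ring

/-- The wave of `H_{k+1}` is `√2 i (x - iy)` times the wave of `H_k` minus `√2` times its
derivative, and the derivative integrates to zero. The identity rests on the weight `exp(-ξ²/2)`:
its logarithmic derivative supplies the `ξ` in `√2 (ξ + 2y) H_k`. -/
lemma integral_hermiteWave_succ (k : ℕ) :
    ∫ ξ, hermiteWave x y (hermitePoly (k + 1)) ξ =
      (Real.sqrt 2 * I * (x - I * y)) * ∫ ξ, hermiteWave x y (hermitePoly k) ξ := by
  have hs : (Real.sqrt 2 : ℂ) * Real.sqrt 2 = 2 := by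
    rw [← ofReal_mul, Real.mul_self_sqrt (by norm_num)]
    norm_num
  have hs0 : (Real.sqrt 2 : ℂ) ≠ 0 := by
    intro h
    simp [h] at hs
  have hb : ExpBdd fun ξ : ℝ => I * (x + I * y) - ξ := by
    have h := (ExpBdd.const (I * (x + I * y))).add
      ((ExpBdd.const (-1)).mul (ExpBdd.of_clm_real (ContinuousLinearMap.id ℝ ℝ)))
    convert h using 2
    simp
    ring
  have hi := integrable_hermiteWave x y
  have hi2 : Integrable fun ξ : ℝ => (1 / Real.sqrt 2 : ℝ) *
        hermiteWave x y (Polynomial.derivative (hermitePoly k)) ξ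
      + (I * (x + I * y) - ξ) * hermiteWave x y (hermitePoly k) ξ :=
    ((hi _).const_mul _).add (integrable_hermiteWave_mul x y _ hb)
  have h0 := integral_eq_zero_of_hasDerivAt_of_integrable
    (hasDerivAt_hermiteWave x y (hermitePoly k)) hi2 (hi _)
  have h1 : ∀ ξ, hermiteWave x y (hermitePoly (k + 1)) ξ =
      (Real.sqrt 2 * I * (x - I * y)) * hermiteWave x y (hermitePoly k) ξ -
      Real.sqrt 2 * ((1 / Real.sqrt 2 : ℝ) *
        hermiteWave x y (Polynomial.derivative (hermitePoly k)) ξ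
      + (I * (x + I * y) - ξ) * hermiteWave x y (hermitePoly k) ξ) := by
    intro ξ
    simp only [hermiteWave, hermitePoly_succ, Polynomial.eval_sub, Polynomial.eval_mul,
      Polynomial.eval_X, Polynomial.eval_ofNat]
    push_cast
    rw [show (2 : ℂ) * ((ξ + 2 * y) / (Real.sqrt 2 : ℂ)) = Real.sqrt 2 * (ξ + 2 * y) by
      rw [← hs]; field_simp]
    field_simp
    linear_combination (2 * (Real.sqrt 2 : ℂ) * y *
      ((Polynomial.eval ((ξ + 2 * y) / Real.sqrt 2) (hermitePoly k) : ℝ) : ℂ)) * I_sq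
  simp only [h1]
  rw [integral_sub ((hi _).const_mul _) (hi2.const_mul _), integral_const_mul,
    integral_const_mul, h0]
  ring

lemma integral_hermiteWave (k : ℕ) :
    ∫ ξ, hermiteWave x y (hermitePoly k) ξ = (Real.sqrt (2 * Real.pi) : ℂ) *
      ((Real.sqrt 2 * I * (x - I * y)) ^ k * cexp (-(x + I * y) ^ 2 / 2)) := by
  induction k with
  | zero =>
    have h := fourierIntegral_gaussian (b := 1 / 2) (by norm_num) (x + I * y : ℂ)
    have h2 : (Real.sqrt (2 * Real.pi) : ℂ) = ((Real.pi : ℂ) / (1 / 2)) ^ (1 / 2 : ℂ) := by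
      rw [Real.sqrt_eq_rpow, ofReal_cpow (by positivity)]
      push_cast
      congr 1
      ring
    rw [pow_zero, one_mul, h2]
    have h3 : cexp (-(x + I * y) ^ 2 / 2) = cexp (-(x + I * y : ℂ) ^ 2 / (4 * (1 / 2))) := by
      congr 1
      ring
    rw [h3, ← h]
    refine integral_congr_ae (Filter.Eventually.of_forall fun ξ => ?_)
    simp only [hermiteWave, hermitePoly, Polynomial.eval_one, ofReal_one, one_mul]
    push_cast
    simp only [Real.norm_eq_abs, ← ofReal_pow, sq_abs]
  | succ k ih =>
    rw [integral_hermiteWave_succ, ih]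
    ring

end OneDim

/-- The functions `exp(-|ξ|²/4 + i⟨s,ξ⟩)`. -/
def gaussWave (s ξ : E n) : ℂ :=
  cexp (I * (inner ℝ s ξ : ℝ)) * (Real.exp (-(1 / 4) * ‖ξ‖ ^ 2) : ℂ)

lemma expBdd_cexp_inner (s : E n) : ExpBdd fun ξ : E n => cexp (I * (inner ℝ s ξ : ℝ)) := by
  simpa using ExpBdd.cexp_clm (I • ofRealCLM.comp (innerSL ℝ s))

lemma memLp_gaussWave (s : E n) : MemLp (gaussWave s) 2 (muTilde n) :=
  memLp_muTilde ((expBdd_cexp_inner s).memLp_gaussian (by norm_num))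

/-- The factor `exp(-|ξ|²/4)` of `gaussWave` completes the one in `q_{k,ξ}` to `exp(-|ξ|²/2)`, so
the integral is a product of one-dimensional ones given by `integral_hermiteWave`. The frequency `s`
merely translates `x`, and each `√(2π)` cancels against the normalization of the measure. -/
lemma integral_gaussWave_mul_qk (s x y : E n) (k : Fin n → ℕ) :
    ∫ ξ, gaussWave s ξ * (qk k ξ y : ℂ) * cexp (I * (inner ℝ ξ x : ℝ)) ∂(muTilde n) =
      qconst k * cexp (-(‖y‖ ^ 2 : ℝ)) *
        ∏ r, ((Real.sqrt 2 * I * (((x r + s r : ℝ) : ℂ) - I * y r)) ^ k r *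
          cexp (-(((x r + s r : ℝ) : ℂ) + I * y r) ^ 2 / 2)) := by
  have h1 : ∀ ξ : E n, gaussWave s ξ * (qk k ξ y : ℂ) * cexp (I * (inner ℝ ξ x : ℝ)) =
      qconst k * cexp (-(‖y‖ ^ 2 : ℝ)) *
        ∏ r, hermiteWave (x r + s r) (y r) (hermitePoly (k r)) (ξ r) := by
    intro ξ
    simp only [hermiteWave, Finset.prod_mul_distrib, qk_eq, ofReal_mul, ofReal_prod, gaussWave,
      hgauss_eq, hvar]
    have h2 : cexp (I * (inner ℝ s ξ : ℝ)) * (Real.exp (-(1 / 4) * ‖ξ‖ ^ 2) : ℂ) *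
        ((Real.exp (-(‖y‖ ^ 2 + inner ℝ ξ y + ‖ξ‖ ^ 2 / 4)) : ℝ) : ℂ) *
        cexp (I * (inner ℝ ξ x : ℝ)) =
        cexp (-(‖y‖ ^ 2 : ℝ)) * ((∏ r, cexp (I * (((x r + s r : ℝ) : ℂ) + I * y r) * ξ r)) *
          ∏ r, (Real.exp (-(1 / 2) * ‖ξ r‖ ^ 2) : ℂ)) := by
      rw [← ofReal_prod, ← Real.exp_sum, ← Complex.exp_sum]
      push_cast
      simp only [← Complex.exp_add]
      congr 1
      have e1 : (‖ξ‖ : ℂ) ^ 2 = ∑ r, (ξ r : ℂ) ^ 2 := by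
        exact_mod_cast EuclideanSpace.real_norm_sq_eq ξ
      have e2 : ∀ a b : E n, ((inner ℝ a b : ℝ) : ℂ) = ∑ r, (a r : ℂ) * b r := by
        intro a b
        rw [PiLp.inner_apply]
        push_cast
        refine Finset.sum_congr rfl fun r _ => ?_
        simp [mul_comm]
      have e3 : ∀ r, ((‖ξ r‖ : ℝ) : ℂ) ^ 2 = (ξ r : ℂ) ^ 2 := fun r => by
        rw [← ofReal_pow, ← ofReal_pow, Real.norm_eq_abs, sq_abs]
      simp only [e1, e2, e3]
      rw [show ∀ A B C D F : ℂ, I * A + -(1 / 4) * B + -(C + D + B / 4) + I * F =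
        -C + (I * A + -(1 / 2) * B + -D + I * F) by intros; ring]
      congr 1
      simp only [Finset.mul_sum, ← Finset.sum_neg_distrib, ← Finset.sum_add_distrib]
      refine Finset.sum_congr rfl fun r _ => ?_
      linear_combination (-(y r : ℂ) * ξ r) * I_sq
    linear_combination (qconst k * ∏ r, (((hermitePoly (k r)).eval
      ((ξ r + 2 * y r) / Real.sqrt 2) : ℝ) : ℂ)) * h2
  simp only [h1]
  rw [integral_muTilde, integral_const_mul, integral_prod_coord
    (fun r t => hermiteWave (x r + s r) (y r) (hermitePoly (k r)) t)]
  simp only [integral_hermiteWave]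
  rw [Finset.prod_mul_distrib, Finset.prod_const, Finset.card_univ, Fintype.card_fin]
  have h3 : (((2 * Real.pi) ^ (-(n : ℝ) / 2) : ℝ) : ℂ) * (Real.sqrt (2 * Real.pi) : ℂ) ^ n = 1 := by
    rw [← ofReal_pow, ← ofReal_mul, ← ofReal_one]
    congr 1
    rw [Real.sqrt_eq_rpow, ← Real.rpow_natCast, ← Real.rpow_mul (by positivity),
      ← Real.rpow_add (by positivity)]
    ring_nf
    simp
  linear_combination (qconst k * cexp (-(‖y‖ ^ 2 : ℝ)) *
        ∏ r, ((Real.sqrt 2 * I * (((x r + s r : ℝ) : ℂ) - I * y r)) ^ k r *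
          cexp (-(((x r + s r : ℝ) : ℂ) + I * y r) ^ 2 / 2))) * h3

end

section

variable {n : ℕ}

/-! ### The Hermite coefficients of the transform of a polyanalytic function -/

/-- The inverse partial transform of `exp(-|ξ|²/4 + i⟨s,ξ⟩) q_{k,ξ}(v)`. -/
def waveKernel (s : E n) (k : Fin n → ℕ) (p : E n × E n) : ℂ :=
  qconst k * cexp (-(‖p.2‖ ^ 2 : ℝ)) *
    ∏ r, ((Real.sqrt 2 * I * (((p.1 r + s r : ℝ) : ℂ) - I * p.2 r)) ^ k r *
      cexp (-(((p.1 r + s r : ℝ) : ℂ) + I * p.2 r) ^ 2 / 2))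

lemma continuous_gaussWave (s : E n) : Continuous (gaussWave s) := by
  unfold gaussWave
  fun_prop

lemma exists_memLp_waveKernel (s : E n) (k : Fin n → ℕ) :
    ∃ h : MemLp (waveKernel s k) 2 (muTilde2 n),
      fourierTensorId n (h.toLp _) = hermiteLift k ((memLp_gaussWave s).toLp _) := by
  have hm : StronglyMeasurable fun p : E n × E n => gaussWave s p.1 * (qk k p.1 p.2 : ℂ) :=
    ((continuous_gaussWave s).comp continuous_fst |>.mul
      (continuous_ofReal.comp (continuous_qk k))).stronglyMeasurable
  obtain ⟨h1, h2⟩ := fourierTensorId_integral_inv (memLp_mul_qk k (memLp_gaussWave s)) hm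
    (Filter.Eventually.of_forall fun v => (memLp_gaussWave s).integrable_mul (memLp_qk_left k v))
  have e : (fun p : E n × E n => ∫ u, gaussWave s u * (qk k u p.2 : ℂ) *
      cexp (I * (inner ℝ u p.1 : ℝ)) ∂(muTilde n)) = waveKernel s k := by
    funext p
    exact integral_gaussWave_mul_qk s p.1 p.2 k
  simp only [e] at h1 h2
  exact ⟨h1, by rw [h2, hermiteLift_toLp]⟩

/-- The constant relating `waveKernel` and `fockKernel`. -/
def waveConst (s : E n) (k : Fin n → ℕ) : ℂ :=
  qconst k * (((2 : ℝ) ^ ((n : ℝ) / 2) : ℝ) : ℂ) * (∏ r, (-(Real.sqrt 2 * I)) ^ k r) *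
    cexp (-∑ r, (s r : ℂ) ^ 2 / 2)

/-- Write `a z = x + iy`. Conjugation turns `x + s - iy` into `a z + s`, and the exponents of the
conjugate kernel and of the flattening add up to `-Σ s_r²/2 - (a z + s)·a z̄`. -/
lemma star_waveKernel_mul_flatten (α : ℝ) [hα : Fact (0 < α)] (s : E n) (k : Fin n → ℕ)
    (f : (Fin n → ℂ) → ℂ) (p : E n × E n) :
    star (waveKernel s k p) * flatten α n f p =
      waveConst s k * (f (cpoint α p) * fockKernel (Real.sqrt α) s k (cpoint α p)) := by
  have ha : (Real.sqrt α : ℂ) ≠ 0 := ofReal_ne_zero.2 (Real.sqrt_pos.2 hα.out).ne'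
  have hz : ∀ r, (Real.sqrt α : ℂ) * cpoint α p r = p.1 r + I * p.2 r := fun r => by
    rw [cpoint, mul_div_cancel₀ _ ha]
  have hz' : ∀ r, (Real.sqrt α : ℂ) * star (cpoint α p r) = p.1 r - I * p.2 r := fun r => by
    have h := congrArg star (hz r)
    simp only [star_mul', star_add, RCLike.star_def, conj_ofReal, conj_I] at h
    rw [RCLike.star_def, h]
    ring
  have hk : fockKernel (Real.sqrt α) s k (cpoint α p) =
      (∏ j, ((p.1 j + s j : ℂ) + I * p.2 j) ^ k j) *
        cexp (∑ j, -((p.1 j + s j : ℂ) + I * p.2 j) * (p.1 j - I * p.2 j)) := by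
    rw [fockKernel]
    congr 1
    · refine Finset.prod_congr rfl fun j _ => ?_
      rw [hz]
      ring
    · congr 1
      refine Finset.sum_congr rfl fun j _ => ?_
      rw [hz, ← hz']
      ring
  have hstar : star (waveKernel s k p) = qconst k * cexp (-∑ r, (p.2 r : ℂ) ^ 2) *
      ((∏ r, (-(Real.sqrt 2 * I)) ^ k r) * (∏ j, ((p.1 j + s j : ℂ) + I * p.2 j) ^ k j) *
        cexp (∑ r, -((p.1 r + s r : ℂ) - I * p.2 r) ^ 2 / 2)) := by
    rw [waveKernel, Complex.exp_sum, ← Finset.prod_mul_distrib, ← Finset.prod_mul_distrib,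
      EuclideanSpace.real_norm_sq_eq]
    simp only [RCLike.star_def, map_mul, map_prod, map_pow, conj_ofReal, ← Complex.exp_conj,
      map_neg, map_div₀, map_sub, map_add, conj_I, map_ofNat]
    push_cast
    congr 1
    refine Finset.prod_congr rfl fun r _ => ?_
    rw [← mul_pow]
    congr 2 <;> ring
  have hflat : flatten α n f p = (((2 : ℝ) ^ ((n : ℝ) / 2) : ℝ) : ℂ) *
      cexp (∑ r, (-(p.1 r : ℂ) ^ 2 / 2 - (p.2 r : ℂ) ^ 2 / 2 - I * (p.1 r * p.2 r))) *
        f (cpoint α p) := by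
    rw [flatten_apply, EuclideanSpace.real_norm_sq_eq, EuclideanSpace.real_norm_sq_eq,
      PiLp.inner_apply]
    congr 3
    push_cast
    simp only [Finset.sum_sub_distrib, ← Finset.sum_div, Finset.sum_neg_distrib, ← Finset.mul_sum,
      neg_div]
    congr 2
    refine Finset.sum_congr rfl fun r _ => ?_
    simp [mul_comm]
  have hexp : cexp (-∑ r, (p.2 r : ℂ) ^ 2) *
      cexp (∑ r, -((p.1 r + s r : ℂ) - I * p.2 r) ^ 2 / 2) *
      cexp (∑ r, (-(p.1 r : ℂ) ^ 2 / 2 - (p.2 r : ℂ) ^ 2 / 2 - I * (p.1 r * p.2 r))) =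
      cexp (-∑ r, (s r : ℂ) ^ 2 / 2) *
        cexp (∑ j, -((p.1 j + s j : ℂ) + I * p.2 j) * (p.1 j - I * p.2 j)) := by
    simp only [← Complex.exp_add, ← Finset.sum_neg_distrib, ← Finset.sum_add_distrib]
    congr 1
    refine Finset.sum_congr rfl fun r _ => ?_
    linear_combination (-(3 / 2) * (p.2 r : ℂ) ^ 2) * I_sq
  rw [hstar, hflat, hk, waveConst]
  linear_combination (qconst k * (((2 : ℝ) ^ ((n : ℝ) / 2) : ℝ) : ℂ) *
    (∏ r, (-(Real.sqrt 2 * I)) ^ k r) * (∏ j, ((p.1 j + s j : ℂ) + I * p.2 j) ^ k j) *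
      f (cpoint α p)) * hexp

lemma waveConst_ne_zero (s : E n) (k : Fin n → ℕ) : waveConst s k ≠ 0 := by
  have h2 : (Real.sqrt 2 : ℂ) ≠ 0 := ofReal_ne_zero.2 (Real.sqrt_pos.2 (by norm_num)).ne'
  refine mul_ne_zero (mul_ne_zero (mul_ne_zero (ofReal_ne_zero.2 (qconst_ne_zero k))
    (ofReal_ne_zero.2 (by positivity))) ?_) (Complex.exp_ne_zero _)
  exact Finset.prod_ne_zero_iff.2 fun r _ => pow_ne_zero _ (neg_ne_zero.2 (mul_ne_zero h2 I_ne_zero))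

/-- In the flattened picture this is a product of two square-integrable functions, so no pointwise
growth estimate for `f` is required. -/
lemma integrable_mul_fockKernel (α : ℝ) [Fact (0 < α)] {m : ℕ} (f : Fock α n m) (s : E n)
    (k : Fin n → ℕ) : Integrable fun z => f.1 z * fockKernel (Real.sqrt α) s k z := by
  obtain ⟨h, -⟩ := exists_memLp_waveKernel s k
  have h1 := h.star.integrable_mul (memLp_flatten α f.2)
  rw [← integrable_comp_cpoint α]
  refine (h1.const_mul (waveConst s k)⁻¹).congr (Filter.Eventually.of_forall fun p => ?_)
  simp only [Pi.mul_apply, Pi.star_apply]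
  rw [star_waveKernel_mul_flatten, inv_mul_cancel_left₀ (waveConst_ne_zero s k)]

lemma inner_waveKernel_flatten (α : ℝ) [hα : Fact (0 < α)] {m : ℕ} (f : Fock α n m) (s : E n)
    {k : Fin n → ℕ} (hk : m ≤ ∑ r, k r) (h : MemLp (waveKernel s k) 2 (muTilde2 n)) :
    inner ℂ (h.toLp _) ((memLp_flatten α f.2).toLp _) = 0 := by
  rw [L2.inner_def]
  have h1 : ∀ᵐ p ∂(muTilde2 n), inner ℂ (h.toLp _ p) ((memLp_flatten α f.2).toLp _ p) =
      waveConst s k * (f.1 (cpoint α p) * fockKernel (Real.sqrt α) s k (cpoint α p)) := by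
    filter_upwards [h.coeFn_toLp, (memLp_flatten α f.2).coeFn_toLp] with p h1 h2
    rw [h1, h2, ← star_waveKernel_mul_flatten, RCLike.inner_apply, mul_comm, RCLike.star_def]
  rw [integral_congr_ae h1, integral_const_mul, integral_comp_cpoint α
    (fun z => f.1 z * fockKernel (Real.sqrt α) s k z),
    integral_mul_fockKernel_eq_zero (Real.sqrt_pos.2 hα.out).ne' f.2.1
      (integrable_mul_fockKernel α f s) hk, smul_zero, mul_zero]

/-- The pairings are the values of the Fourier transform of the integrable function `u(ξ)
exp(-|ξ|²/4)`, and the Gaussian has no zeros. -/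
lemma eq_zero_of_inner_gaussWave_eq_zero {u : Lp ℂ 2 (muTilde n)}
    (h : ∀ s : E n, inner ℂ ((memLp_gaussWave s).toLp _) u = 0) : u = 0 := by
  have hg : MemLp (fun ξ : E n => (Real.exp (-(1 / 4) * ‖ξ‖ ^ 2) : ℂ)) 2 (muTilde n) := by
    simpa using memLp_muTilde ((ExpBdd.const (V := E n) 1).memLp_gaussian (b := 1 / 4) (by norm_num))
  have h1 := ae_eq_zero_of_integral_exp_eq_zero ((Lp.memLp u).integrable_mul hg) fun s => by
    rw [← h s, L2.inner_def]
    refine integral_congr_ae ?_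
    filter_upwards [(memLp_gaussWave s).coeFn_toLp] with ξ hξ
    rw [hξ, RCLike.inner_apply, gaussWave, map_mul, conj_ofReal, ← Complex.exp_conj, map_mul,
      conj_I, conj_ofReal, Pi.mul_apply, real_inner_comm]
    ring
  refine (Lp.eq_zero_iff_ae_eq_zero).2 ?_
  filter_upwards [h1] with ξ hξ
  exact (mul_eq_zero.1 hξ).resolve_right (ofReal_ne_zero.2 (Real.exp_pos _).ne')

/-- The transform of an `m`-analytic function has only Hermite coefficients of degree less
than `m`. -/
lemma hermiteCoeff_fourierTensorId_eq_zero (α : ℝ) [Fact (0 < α)] {m : ℕ} (g : FlatFock α n m)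
    {k : Fin n → ℕ} (hk : m ≤ ∑ r, k r) :
    hermiteCoeff k (fourierTensorId n (FlatFock.toLp α n m g)) = 0 := by
  obtain ⟨_, f, hf, rfl⟩ := g
  refine eq_zero_of_inner_gaussWave_eq_zero fun s => ?_
  obtain ⟨h, h1⟩ := exists_memLp_waveKernel s k
  -- Since `F ⊗ I` preserves inner products it drops out, and the pairing becomes that of
  -- `waveKernel` with a flattened polyanalytic function.
  rw [← inner_hermiteLift_left, ← h1, inner_fourierTensorId]
  exact inner_waveKernel_flatten α ⟨f, hf⟩ s hk h

end

section

variable {n : ℕ}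

/-! ### Functions annihilated by all Wirtinger operators of a given order -/

/-- Smooth functions annihilated by all compositions of `s` Wirtinger operators. -/
def DbarNilpotent : ℕ → ((Fin n → ℂ) → ℂ) → Prop
  | 0, f => f = 0
  | s + 1, f => ContDiff ℝ ∞ f ∧ ∀ r, DbarNilpotent s (dbar r f)

namespace DbarNilpotent

variable {s : ℕ} {f g : (Fin n → ℂ) → ℂ}

lemma contDiff (hf : DbarNilpotent s f) : ContDiff ℝ ∞ f := by
  cases s with
  | zero => rw [show f = 0 from hf]; exact contDiff_const
  | succ s => exact hf.1

lemma add (hf : DbarNilpotent s f) (hg : DbarNilpotent s g) : DbarNilpotent s (f + g) := by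
  induction s generalizing f g with
  | zero => rw [show f = 0 from hf, show g = 0 from hg]; exact add_zero 0
  | succ s ih =>
    refine ⟨hf.1.add hg.1, fun r => ?_⟩
    rw [dbar_add r hf.1 hg.1]
    exact ih (hf.2 r) (hg.2 r)

lemma smul (c : ℂ) (hf : DbarNilpotent s f) : DbarNilpotent s (c • f) := by
  induction s generalizing f with
  | zero => rw [show f = 0 from hf]; exact smul_zero c
  | succ s ih =>
    refine ⟨contDiff_const.smul hf.1, fun r => ?_⟩
    rw [dbar_smul r c hf.1]
    exact ih (hf.2 r)

lemma zero (s : ℕ) : DbarNilpotent s (0 : (Fin n → ℂ) → ℂ) := by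
  induction s with
  | zero => rfl
  | succ s ih =>
    refine ⟨contDiff_const, fun r => ?_⟩
    have h : dbar r (0 : (Fin n → ℂ) → ℂ) = 0 := by
      simpa using dbar_smul r 0 (contDiff_const (c := (0 : ℂ)))
    rwa [h]

lemma sum {ι : Type*} (t : Finset ι) {f : ι → (Fin n → ℂ) → ℂ}
    (hf : ∀ i ∈ t, DbarNilpotent s (f i)) : DbarNilpotent s (∑ i ∈ t, f i) := by
  classical
  induction t using Finset.induction_on with
  | empty => simpa using zero s
  | insert i t hi ih =>
    rw [Finset.sum_insert hi]
    exact (hf i (Finset.mem_insert_self i t)).add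
      (ih fun j hj => hf j (Finset.mem_insert_of_mem hj))

lemma mono {t : ℕ} (hf : DbarNilpotent s f) (h : s ≤ t) : DbarNilpotent t f := by
  induction s generalizing f t with
  | zero => rw [show f = 0 from hf]; exact zero t
  | succ s ih =>
    obtain ⟨t, rfl⟩ : ∃ t', t = t' + 1 := ⟨t - 1, by omega⟩
    exact ⟨hf.1, fun r => ih (hf.2 r) (by omega)⟩

lemma of_holomorphic (hf : ContDiff ℂ ∞ f) : DbarNilpotent 1 f :=
  ⟨hf.restrict_scalars ℝ, fun r => funext fun z => dbar_eq_zero r (hf.differentiable (by simp) z)⟩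

/-- The derivative `∂/∂z̄_r` of `Im z_j` is the constant `i/2` or `0`. By Leibniz, such a factor
costs exactly one additional order. -/
lemma im_coord_mul (hf : DbarNilpotent s f) (j : Fin n) :
    DbarNilpotent (s + 1) fun z => ((z j).im : ℂ) * f z := by
  have h1 : ContDiff ℝ ∞ fun z : Fin n → ℂ => ((z j).im : ℂ) :=
    (ofRealCLM.comp (imCLM.comp (ContinuousLinearMap.proj (φ := fun _ : Fin n => ℂ) j))).contDiff
  have h2 : ∀ r (z : Fin n → ℂ), dbar r (fun z : Fin n → ℂ => ((z j).im : ℂ)) z =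
      if j = r then I / 2 else 0 := fun r z => by
    have h : fderiv ℝ (fun z : Fin n → ℂ => ((z j).im : ℂ)) z = ofRealCLM.comp (imCLM.comp
        (ContinuousLinearMap.proj (φ := fun _ : Fin n => ℂ) j)) :=
      (ofRealCLM.comp (imCLM.comp
        (ContinuousLinearMap.proj (φ := fun _ : Fin n => ℂ) j))).hasFDerivAt.fderiv
    rw [dbar, h]
    by_cases hj : j = r
    · subst hj
      simp
      ring
    · simp [hj]
  induction s generalizing f with
  | zero =>
    have h : (fun z => ((z j).im : ℂ) * f z) = 0 := by
      rw [show f = 0 from hf]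
      funext z
      simp
    rw [h]
    exact zero 1
  | succ s ih =>
    refine ⟨h1.mul hf.1, fun r => ?_⟩
    have h3 : dbar r (fun z => ((z j).im : ℂ) * f z) =
        (if j = r then I / 2 else 0 : ℂ) • f + fun z => ((z j).im : ℂ) * dbar r f z := by
      funext z
      rw [dbar_mul r (h1.differentiable (by simp) z) (hf.1.differentiable (by simp) z), h2]
      rfl
    rw [h3]
    exact (hf.smul _).add (ih (hf.2 r))

lemma im_coord_pow_mul (hf : DbarNilpotent s f) (j : Fin n) (p : ℕ) :
    DbarNilpotent (s + p) fun z => ((z j).im : ℂ) ^ p * f z := by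
  induction p with
  | zero => simpa using hf
  | succ p ih =>
    have h := ih.im_coord_mul j
    simp only [← mul_assoc, ← pow_succ'] at h
    exact h

lemma prod_im_coord_pow_mul (hf : DbarNilpotent s f) (b : Fin n → ℕ) :
    DbarNilpotent (s + ∑ j, b j) fun z => (∏ j, ((z j).im : ℂ) ^ b j) * f z := by
  induction (Finset.univ : Finset (Fin n)) using Finset.induction_on with
  | empty => simpa using hf
  | insert j t hj ih =>
    have h := ih.im_coord_pow_mul j (b j)
    simp only [← mul_assoc] at h
    simp only [Finset.prod_insert hj]
    rwa [Finset.sum_insert hj, add_comm (b j), ← add_assoc]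

lemma holomorphic_mul (hf : DbarNilpotent s f) (hg : ContDiff ℂ ∞ g) :
    DbarNilpotent s fun z => g z * f z := by
  induction s generalizing f with
  | zero =>
    rw [show f = 0 from hf]
    funext z
    simp
  | succ s ih =>
    have hg' : ContDiff ℝ ∞ g := hg.restrict_scalars ℝ
    refine ⟨hg'.mul hf.1, fun r => ?_⟩
    have h : dbar r (fun z => g z * f z) = fun z => g z * dbar r f z := by
      funext z
      rw [dbar_mul r (hg'.differentiable (by simp) z) (hf.1.differentiable (by simp) z),
        dbar_eq_zero r (hg.differentiable (by simp) z), zero_mul, zero_add]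
    rw [h]
    exact ih (hf.2 r)

lemma foldr_dbar (L : List (Fin n)) (hf : DbarNilpotent (s + L.length) f) :
    DbarNilpotent s (L.foldr dbar f) := by
  induction L generalizing s with
  | nil => exact hf
  | cons r L ih =>
    -- The head acts last, so the tail must leave one order of nilpotency for it.
    refine (ih (s := s + 1) ?_).2 r
    rwa [add_assoc, add_comm 1]

lemma isPolyanalytic (hf : DbarNilpotent s f) : IsPolyanalytic s f := by
  refine ⟨hf.contDiff, fun k hk => ?_⟩
  rw [← foldr_indexList]
  refine foldr_dbar (s := 0) _ ?_
  have h : (indexList k).length = s := by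
    rw [← hk, indexList, List.length_flatMap, Fin.sum_univ_def]
    simp
  rwa [h, zero_add]

end DbarNilpotent

/-! ### Entire functions given by Gaussian Fourier integrals -/

/-- The form `z ↦ i a ∑ ξ_r z_r`, as a linear function of `ξ`. -/
def waveForm (n : ℕ) (a : ℝ) : E n →L[ℝ] ((Fin n → ℂ) →L[ℂ] ℂ) :=
  ∑ r, (ofRealCLM.comp (EuclideanSpace.proj r : E n →L[ℝ] ℝ)).smulRight
    ((I * a : ℂ) • (ContinuousLinearMap.proj r : (Fin n → ℂ) →L[ℂ] ℂ))

lemma waveForm_apply (a : ℝ) (ξ : E n) (z : Fin n → ℂ) :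
    waveForm n a ξ z = I * ∑ r, (ξ r : ℂ) * (a * z r) := by
  simp only [waveForm, sum_apply, ContinuousLinearMap.smulRight_apply,
    smul_apply, ContinuousLinearMap.comp_apply, Finset.mul_sum, smul_eq_mul,
    ContinuousLinearMap.proj_apply, ofRealCLM_apply, PiLp.proj_apply]
  exact Finset.sum_congr rfl fun r _ => by ring

/-- The integral `∫ c(ξ) Q(ξ) exp(-|ξ|²/4 + i a ξ·z) dξ`. -/
def waveIntegral (a : ℝ) (c Q : E n → ℂ) (z : Fin n → ℂ) : ℂ :=
  ∫ ξ, c ξ * (Q ξ * (Real.exp (-(1 / 4) * ‖ξ‖ ^ 2) : ℂ)) * cexp (waveForm n a ξ z) ∂(muTilde n)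

variable {a : ℝ} {c Q : E n → ℂ}

lemma expBdd_norm_mul_exp (M : ℝ) (hM : 0 ≤ M) :
    ExpBdd fun ξ : E n => ((‖ξ‖ * Real.exp (M * ‖ξ‖) : ℝ) : ℂ) := by
  refine ⟨by fun_prop, 1, 1 + M, zero_le_one, by positivity, fun ξ => ?_⟩
  rw [norm_real, Real.norm_of_nonneg (by positivity), one_mul, add_mul, Real.exp_add]
  refine mul_le_mul_of_nonneg_right ?_ (Real.exp_pos _).le
  linarith [Real.add_one_le_exp (1 * ‖ξ‖)]

lemma integrable_mul_gaussian (hc : MemLp c 2 (muTilde n)) (hQ : ExpBdd Q) :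
    Integrable (fun ξ => c ξ * (Q ξ * (Real.exp (-(1 / 4) * ‖ξ‖ ^ 2) : ℂ))) (muTilde n) :=
  hc.integrable_mul (memLp_muTilde (hQ.memLp_gaussian (by norm_num)))

lemma integrable_waveIntegrand (a : ℝ) (hc : MemLp c 2 (muTilde n)) (hQ : ExpBdd Q)
    (z : Fin n → ℂ) :
    Integrable (fun ξ => c ξ * (Q ξ * (Real.exp (-(1 / 4) * ‖ξ‖ ^ 2) : ℂ)) *
      cexp (waveForm n a ξ z)) (muTilde n) := by
  have h : ExpBdd fun ξ => cexp (waveForm n a ξ z) :=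
    ExpBdd.cexp_clm ((ContinuousLinearMap.apply ℂ ℂ z).restrictScalars ℝ ∘L waveForm n a)
  refine (integrable_mul_gaussian hc (hQ.mul h)).congr (Filter.Eventually.of_forall fun ξ => ?_)
  dsimp only
  ring

lemma hasFDerivAt_waveIntegral (a : ℝ) (hc : MemLp c 2 (muTilde n)) (hQ : ExpBdd Q)
    (z₀ : Fin n → ℂ) :
    HasFDerivAt (waveIntegral a c Q)
      (∫ ξ, (c ξ * (Q ξ * (Real.exp (-(1 / 4) * ‖ξ‖ ^ 2) : ℂ)) * cexp (waveForm n a ξ z₀)) •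
        waveForm n a ξ ∂(muTilde n)) z₀ := by
  -- This is the growth rate in `ξ` of the exponential, uniform over the unit ball around `z₀`.
  set M : ℝ := ‖waveForm n a‖ * (‖z₀‖ + 1)
  have hb := ((integrable_mul_gaussian hc
    (hQ.mul (expBdd_norm_mul_exp M (by positivity)))).norm.const_mul ‖waveForm n a‖)
  refine hasFDerivAt_integral_of_dominated_of_fderiv_le
    (F' := fun z ξ => (c ξ * (Q ξ * (Real.exp (-(1 / 4) * ‖ξ‖ ^ 2) : ℂ)) *
      cexp (waveForm n a ξ z)) • waveForm n a ξ) (Metric.ball_mem_nhds z₀ one_pos)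
    (Filter.Eventually.of_forall fun z => (integrable_waveIntegrand a hc hQ z).1)
    (integrable_waveIntegrand a hc hQ z₀)
    ((integrable_waveIntegrand a hc hQ z₀).1.smul (waveForm n a).continuous.aestronglyMeasurable)
    (Filter.Eventually.of_forall fun ξ z hz => ?_) hb
    (Filter.Eventually.of_forall fun ξ z _ => ?_)
  · have hz' : ‖z‖ ≤ ‖z₀‖ + 1 := by
      have h1 := norm_sub_norm_le z z₀
      have h2 : ‖z - z₀‖ < 1 := by simpa [dist_eq_norm] using hz
      linarith
    have h1 : ‖waveForm n a ξ‖ ≤ ‖waveForm n a‖ * ‖ξ‖ := (waveForm n a).le_opNorm ξ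
    have h2 : ‖cexp (waveForm n a ξ z)‖ ≤ Real.exp (M * ‖ξ‖) := by
      rw [norm_exp, Real.exp_le_exp]
      refine (re_le_norm _).trans (((waveForm n a ξ).le_opNorm z).trans ?_)
      calc ‖waveForm n a ξ‖ * ‖z‖ ≤ (‖waveForm n a‖ * ‖ξ‖) * (‖z₀‖ + 1) := by gcongr
        _ = M * ‖ξ‖ := by ring
    simp only [norm_smul, norm_mul]
    rw [norm_real ((‖ξ‖ * Real.exp (M * ‖ξ‖) : ℝ)),
      Real.norm_of_nonneg (by positivity : 0 ≤ ‖ξ‖ * Real.exp (M * ‖ξ‖))]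
    calc _ ≤ ‖c ξ‖ * (‖Q ξ‖ * ‖(Real.exp (-(1 / 4) * ‖ξ‖ ^ 2) : ℂ)‖) * Real.exp (M * ‖ξ‖) *
          (‖waveForm n a‖ * ‖ξ‖) := by gcongr
      _ = _ := by ring
  · have h := ((waveForm n a ξ).hasFDerivAt (x := z)).cexp.const_mul
      (c ξ * (Q ξ * (Real.exp (-(1 / 4) * ‖ξ‖ ^ 2) : ℂ)))
    rwa [smul_smul] at h

/-- A derivative only multiplies `Q` by a linear form in `ξ`, so the result is again a
`waveIntegral` with a factor of exponential growth. This drives the induction for smoothness of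
every order. -/
lemma fderiv_waveIntegral_apply (a : ℝ) (hc : MemLp c 2 (muTilde n)) (hQ : ExpBdd Q)
    (z w : Fin n → ℂ) :
    fderiv ℂ (waveIntegral a c Q) z w =
      waveIntegral a c (fun ξ => Q ξ * waveForm n a ξ w) z := by
  have hint : Integrable (fun ξ => (c ξ * (Q ξ * (Real.exp (-(1 / 4) * ‖ξ‖ ^ 2) : ℂ)) *
      cexp (waveForm n a ξ z)) • waveForm n a ξ) (muTilde n) := by
    have h : ExpBdd fun ξ => cexp (waveForm n a ξ z) :=
      ExpBdd.cexp_clm ((ContinuousLinearMap.apply ℂ ℂ z).restrictScalars ℝ ∘L waveForm n a)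
    have hb := (integrable_mul_gaussian hc ((hQ.mul h).mul
      (expBdd_norm_mul_exp 0 le_rfl))).norm.const_mul ‖waveForm n a‖
    refine hb.mono' ((integrable_waveIntegrand a hc hQ z).1.smul
      (waveForm n a).continuous.aestronglyMeasurable) (Filter.Eventually.of_forall fun ξ => ?_)
    have h1 : ‖waveForm n a ξ‖ ≤ ‖waveForm n a‖ * ‖ξ‖ := (waveForm n a).le_opNorm ξ
    simp only [norm_smul, norm_mul, zero_mul, Real.exp_zero, mul_one, norm_real, norm_norm]
    calc _ ≤ ‖c ξ‖ * (‖Q ξ‖ * ‖Real.exp (-(1 / 4) * ‖ξ‖ ^ 2)‖) * ‖cexp (waveForm n a ξ z)‖ *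
          (‖waveForm n a‖ * ‖ξ‖) := by gcongr
      _ = _ := by ring
  rw [(hasFDerivAt_waveIntegral a hc hQ z).fderiv, ContinuousLinearMap.integral_apply hint,
    waveIntegral]
  refine integral_congr_ae (Filter.Eventually.of_forall fun ξ => ?_)
  simp only [smul_apply, smul_eq_mul]
  ring

lemma contDiff_waveIntegral (a : ℝ) (hc : MemLp c 2 (muTilde n)) (hQ : ExpBdd Q) :
    ContDiff ℂ ∞ (waveIntegral a c Q) := by
  rw [contDiff_infty]
  intro N
  induction N generalizing Q with
  | zero =>
    exact contDiff_zero.2 (continuous_iff_continuousAt.2 fun z =>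
      (hasFDerivAt_waveIntegral a hc hQ z).continuousAt)
  | succ N ih =>
    rw [Nat.cast_succ, contDiff_succ_iff_fderiv_apply]
    refine ⟨fun z => (hasFDerivAt_waveIntegral a hc hQ z).differentiableAt, by simp, fun w => ?_⟩
    simp only [fderiv_waveIntegral_apply a hc hQ]
    exact ih (hQ.mul (ExpBdd.of_clm
      ((ContinuousLinearMap.apply ℂ ℂ w).restrictScalars ℝ ∘L waveForm n a)))

end

section

variable {n : ℕ}

/-! ### The preimages of the Hermite lifts -/

lemma natDegree_hermitePoly_le (k : ℕ) : (hermitePoly k).natDegree ≤ k := by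
  induction k with
  | zero => simp [hermitePoly]
  | succ k ih =>
    rw [hermitePoly_succ]
    refine (Polynomial.natDegree_sub_le _ _).trans (max_le ?_ ?_)
    · refine Polynomial.natDegree_mul_le.trans ?_
      have h : (2 * Polynomial.X : Polynomial ℝ).natDegree ≤ 1 := by
        refine Polynomial.natDegree_mul_le.trans ?_
        rw [Polynomial.natDegree_ofNat, zero_add]
        exact Polynomial.natDegree_X_le
      omega
    · exact (Polynomial.natDegree_derivative_le _).trans (by omega)

/-- The coefficient of `y^b` in `∏_r H_{k_r}((ξ_r + 2 y_r)/√2)`. -/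
def hermiteTaylor (k b : Fin n → ℕ) (ξ : E n) : ℂ :=
  ∏ r, ((((Polynomial.hasseDeriv (b r) (hermitePoly (k r))).eval (hvar ξ 0 r) : ℝ) : ℂ) *
    (Real.sqrt 2 : ℂ) ^ b r)

lemma expBdd_hermiteTaylor (k b : Fin n → ℕ) : ExpBdd (hermiteTaylor k b) :=
  ExpBdd.prod _ fun r => ((expBdd_hvar_left 0 r).eval _).mul (ExpBdd.const _)

/-- The multi-indices below `k`. -/
def belowIndices (k : Fin n → ℕ) : Finset (Fin n → ℕ) :=
  Fintype.piFinset fun r => Finset.range (k r + 1)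

/-- Since `hvar ξ y r = √2 y_r + hvar ξ 0 r`, a Taylor expansion about `hvar ξ 0 r` separates the
variables. The degree bound on `H_{k_r}` limits the powers of `y_r` to at most `k_r`, which later
controls the order of polyanalyticity. -/
lemma prod_hermitePoly_hvar (k : Fin n → ℕ) (ξ y : E n) :
    ∏ r, (((hermitePoly (k r)).eval (hvar ξ y r) : ℝ) : ℂ) =
      ∑ b ∈ belowIndices k, (∏ r, (y r : ℂ) ^ b r) * hermiteTaylor k b ξ := by
  have h2 : Real.sqrt 2 ≠ 0 := (Real.sqrt_pos.2 (by norm_num)).ne'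
  have h22 : Real.sqrt 2 ^ 2 = 2 := Real.sq_sqrt (by norm_num)
  have h : ∀ r, (((hermitePoly (k r)).eval (hvar ξ y r) : ℝ) : ℂ) =
      ∑ j ∈ Finset.range (k r + 1), (y r : ℂ) ^ j *
        ((((Polynomial.hasseDeriv j (hermitePoly (k r))).eval (hvar ξ 0 r) : ℝ) : ℂ) *
          (Real.sqrt 2 : ℂ) ^ j) := fun r => by
    have e : hvar ξ y r = Real.sqrt 2 * y r + hvar ξ 0 r := by
      simp only [hvar, PiLp.zero_apply]
      field_simp
      rw [h22]
      ring
    rw [e, ← Polynomial.taylor_eval, Polynomial.eval_eq_sum_range' (n := k r + 1)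
      (by rw [Polynomial.natDegree_taylor]; exact Nat.lt_succ_of_le (natDegree_hermitePoly_le _)),
      ofReal_sum]
    refine Finset.sum_congr rfl fun j _ => ?_
    rw [Polynomial.taylor_coeff, mul_pow]
    push_cast
    ring
  simp only [h, Finset.prod_univ_sum, belowIndices, hermiteTaylor, Finset.prod_mul_distrib]

/-- The function of the Fock space whose transform is `c(ξ) q_{k,ξ}(v)`. -/
def fockLift (α : ℝ) (k : Fin n → ℕ) (c : E n → ℂ) (z : Fin n → ℂ) : ℂ :=
  ((((2 : ℝ) ^ ((n : ℝ) / 2))⁻¹ * qconst k : ℝ) : ℂ) *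
    cexp (∑ r, ((Real.sqrt α : ℂ) * z r) ^ 2 / 2) *
    ∑ b ∈ belowIndices k, (Real.sqrt α : ℂ) ^ (∑ r, b r) * ((∏ r, ((z r).im : ℂ) ^ b r) *
      waveIntegral (Real.sqrt α) c (hermiteTaylor k b) z)

/-- The exponential and the wave integrals are entire, hence of order `1`, and the factor `(Im z)^b`
adds `|b|`. The order `1 + |b|` is at most `1 + |k|`, and so at most `m`. -/
lemma isPolyanalytic_fockLift (α : ℝ) {m : ℕ} {k : Fin n → ℕ} (hk : ∑ r, k r < m) {c : E n → ℂ}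
    (hc : MemLp c 2 (muTilde n)) : IsPolyanalytic m (fockLift α k c) := by
  refine DbarNilpotent.isPolyanalytic ?_
  have h1 : ∀ b ∈ belowIndices k, DbarNilpotent m
      ((Real.sqrt α : ℂ) ^ (∑ r, b r) • fun z : Fin n → ℂ => ((∏ r, ((z r).im : ℂ) ^ b r) *
        waveIntegral (Real.sqrt α) c (hermiteTaylor k b) z)) := fun b hb => by
    have h2 := (DbarNilpotent.of_holomorphic (contDiff_waveIntegral (Real.sqrt α) hc
      (expBdd_hermiteTaylor k b))).prod_im_coord_pow_mul b
    refine (h2.mono ?_).smul _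
    have h3 : ∑ r, b r ≤ ∑ r, k r := Finset.sum_le_sum fun r _ => by
      have := Fintype.mem_piFinset.1 hb r
      rw [Finset.mem_range] at this
      omega
    omega
  have hg : ContDiff ℂ ∞ fun z : Fin n → ℂ =>
      ((((2 : ℝ) ^ ((n : ℝ) / 2))⁻¹ * qconst k : ℝ) : ℂ) *
        cexp (∑ r, ((Real.sqrt α : ℂ) * z r) ^ 2 / 2) := by
    refine contDiff_const.mul (ContDiff.cexp (ContDiff.sum fun r _ => ?_))
    exact ((contDiff_const.mul (contDiff_apply ℂ ℂ r)).pow 2).div_const 2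
  have h := (DbarNilpotent.sum _ h1).holomorphic_mul hg
  convert h using 2 with z
  rw [fockLift, Finset.sum_apply]
  rfl

/-- With `a z = x + iy`, the factor `exp(Σ (a z_r)²/2)` reduces the flattening weight to
`exp(-|y|²)`, and `i a ξ·z` equals `i⟨ξ,x⟩ - ⟨ξ,y⟩`. Together with `exp(-|ξ|²/4)` these reassemble
`hgauss` and the Fourier kernel. The powers of `√α` rescale `Im z` to `y`, after which the sum over
`b` is the Taylor expansion of the Hermite product. -/
lemma flatten_fockLift (α : ℝ) [hα : Fact (0 < α)] (k : Fin n → ℕ) {c : E n → ℂ}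
    (hc : MemLp c 2 (muTilde n)) (p : E n × E n) :
    flatten α n (fockLift α k c) p =
      ∫ ξ, c ξ * (qk k ξ p.2 : ℂ) * cexp (I * (inner ℝ ξ p.1 : ℝ)) ∂(muTilde n) := by
  have ha' : 0 < Real.sqrt α := Real.sqrt_pos.2 hα.out
  have ha : (Real.sqrt α : ℂ) ≠ 0 := ofReal_ne_zero.2 ha'.ne'
  have hz : ∀ r, (Real.sqrt α : ℂ) * cpoint α p r = p.1 r + I * p.2 r := fun r => by
    rw [cpoint, mul_div_cancel₀ _ ha]
  have him : ∀ r, (Real.sqrt α : ℂ) * ((cpoint α p r).im : ℂ) = p.2 r := fun r => by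
    have h := congrArg Complex.im (hz r)
    rw [im_ofReal_mul] at h
    rw [← ofReal_mul, h]
    simp
  have hpow : ∀ b : Fin n → ℕ, (Real.sqrt α : ℂ) ^ (∑ r, b r) *
      ∏ r, ((cpoint α p r).im : ℂ) ^ b r = ∏ r, (p.2 r : ℂ) ^ b r := fun b => by
    rw [← Finset.prod_pow_eq_pow_sum, ← Finset.prod_mul_distrib]
    exact Finset.prod_congr rfl fun r _ => by rw [← mul_pow, him]
  have hexp : cexp (-(‖p.1‖ ^ 2 : ℝ) / 2 - (‖p.2‖ ^ 2 : ℝ) / 2 - I * (inner ℝ p.1 p.2 : ℝ)) *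
      cexp (∑ r, ((Real.sqrt α : ℂ) * cpoint α p r) ^ 2 / 2) = cexp (-(‖p.2‖ ^ 2 : ℝ)) := by
    rw [← Complex.exp_add, EuclideanSpace.real_norm_sq_eq, EuclideanSpace.real_norm_sq_eq,
      PiLp.inner_apply]
    congr 1
    push_cast
    simp only [neg_div, Finset.sum_div, Finset.mul_sum, ← Finset.sum_neg_distrib,
      ← Finset.sum_add_distrib, ← Finset.sum_sub_distrib, hz]
    refine Finset.sum_congr rfl fun r _ => ?_
    simp only [RCLike.inner_apply, conj_trivial]
    push_cast
    linear_combination ((p.2 r : ℂ) ^ 2 / 2) * I_sq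
  have hwave : ∀ ξ : E n, cexp (-(‖p.2‖ ^ 2 : ℝ)) * ((Real.exp (-(1 / 4) * ‖ξ‖ ^ 2) : ℂ) *
      cexp (waveForm n (Real.sqrt α) ξ (cpoint α p))) =
      (hgauss ξ p.2 : ℂ) * cexp (I * (inner ℝ ξ p.1 : ℝ)) := fun ξ => by
    have h1 : waveForm n (Real.sqrt α) ξ (cpoint α p) =
        I * (inner ℝ ξ p.1 : ℝ) - (inner ℝ ξ p.2 : ℝ) := by
      rw [waveForm_apply, PiLp.inner_apply, PiLp.inner_apply]
      push_cast
      simp only [Finset.mul_sum, ← Finset.sum_sub_distrib, hz]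
      refine Finset.sum_congr rfl fun r _ => ?_
      simp only [RCLike.inner_apply, conj_trivial]
      push_cast
      linear_combination ((ξ r : ℂ) * (p.2 r : ℂ)) * I_sq
    rw [h1, hgauss_eq, ofReal_exp, ofReal_exp, ← Complex.exp_add, ← Complex.exp_add,
      ← Complex.exp_add]
    congr 1
    push_cast
    ring
  have hsum : ∑ b ∈ belowIndices k, (Real.sqrt α : ℂ) ^ (∑ r, b r) *
      ((∏ r, ((cpoint α p r).im : ℂ) ^ b r) *
        waveIntegral (Real.sqrt α) c (hermiteTaylor k b) (cpoint α p)) =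
      ∫ ξ, c ξ * ((∏ r, (((hermitePoly (k r)).eval (hvar ξ p.2 r) : ℝ) : ℂ)) *
        (Real.exp (-(1 / 4) * ‖ξ‖ ^ 2) : ℂ)) * cexp (waveForm n (Real.sqrt α) ξ (cpoint α p))
        ∂(muTilde n) := by
    simp only [← mul_assoc, hpow]
    simp only [waveIntegral, ← integral_const_mul]
    rw [← integral_finsetSum _ fun b _ =>
      (integrable_waveIntegrand _ hc (expBdd_hermiteTaylor k b) _).const_mul _]
    refine integral_congr_ae (Filter.Eventually.of_forall fun ξ => ?_)
    simp only [prod_hermitePoly_hvar, Finset.mul_sum, Finset.sum_mul]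
    exact Finset.sum_congr rfl fun b _ => by ring
  have h2 : (((2 : ℝ) ^ ((n : ℝ) / 2) : ℝ) : ℂ) ≠ 0 := ofReal_ne_zero.2 (by positivity)
  rw [flatten_apply, fockLift, hsum]
  rw [show ∀ A B C D F : ℂ, A * B * (C * D * F) = A * C * (B * D) * F from fun A B C D F => by ring,
    hexp, ← integral_const_mul]
  refine integral_congr_ae (Filter.Eventually.of_forall fun ξ => ?_)
  have h3 := hwave ξ
  simp only [qk_eq]
  push_cast
  rw [mul_inv_cancel_left₀ h2]
  push_cast at h3
  linear_combination (c ξ * qconst k *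
    ∏ r, (((hermitePoly (k r)).eval (hvar ξ p.2 r) : ℝ) : ℂ)) * h3

/-- Every Hermite lift of degree less than `m` is the transform of an element of `H_m`. -/
lemma exists_fourierTensorId_eq_hermiteLift (α : ℝ) [Fact (0 < α)] {m : ℕ} {k : Fin n → ℕ}
    (hk : ∑ r, k r < m) (c : Lp ℂ 2 (muTilde n)) :
    ∃ g : FlatFock α n m, fourierTensorId n (FlatFock.toLp α n m g) = hermiteLift k c := by
  have hc := Lp.memLp c
  have hm : StronglyMeasurable fun p : E n × E n => c p.1 * (qk k p.1 p.2 : ℂ) :=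
    ((Lp.stronglyMeasurable c).comp_measurable measurable_fst).mul
      (continuous_ofReal.comp (continuous_qk k)).stronglyMeasurable
  obtain ⟨h1, h2⟩ := fourierTensorId_integral_inv (memLp_mul_qk k hc) hm
    (Filter.Eventually.of_forall fun v => hc.integrable_mul (memLp_qk_left k v))
  have e : (fun p : E n × E n => ∫ u, c u * (qk k u p.2 : ℂ) *
      cexp (I * (inner ℝ u p.1 : ℝ)) ∂(muTilde n)) = flatten α n (fockLift α k c) :=
    funext fun p => (flatten_fockLift α k hc p).symm
  simp only [e] at h1 h2
  have hp := isPolyanalytic_fockLift α hk hc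
  -- The norm in the Fock space is finite because the flattened function is an inverse partial
  -- transform of an `L²` function; `fockLift` itself is never estimated.
  refine ⟨⟨_, fockLift α k c, ⟨hp, memLp_gaussian_of_memLp_flatten α hp.1.continuous h1⟩, rfl⟩, ?_⟩
  rw [hermiteLift_apply, ← h2]
  rfl

end

section

variable {n : ℕ}

/-! ### The enumeration of the multi-indices -/

lemma phi_injective (n m : ℕ) : Function.Injective (phi n m) := fun _ _ h =>
  ((J n m).orderEmbOfFin rfl).injective (ofLex.injective h)

lemma toLex_mem_J {m : ℕ} {k : Fin n → ℕ} : toLex k ∈ J n m ↔ ∑ r, k r < m := by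
  simp only [J, Finset.mem_map_equiv, Finset.mem_filter, Fintype.mem_piFinset, Finset.mem_range]
  refine ⟨fun h => h.2, fun h => ⟨fun r => ?_, h⟩⟩
  exact (Finset.single_le_sum (f := k) (fun _ _ => Nat.zero_le _) (Finset.mem_univ r)).trans_lt h

lemma sum_phi_lt {m : ℕ} (j : Fin (dim n m)) : ∑ r, phi n m j r < m :=
  toLex_mem_J.1 ((J n m).orderEmbOfFin_mem rfl j)

lemma exists_phi_eq {m : ℕ} {k : Fin n → ℕ} (hk : ∑ r, k r < m) : ∃ j, phi n m j = k := by
  have h : toLex k ∈ Set.range ((J n m).orderEmbOfFin rfl) := by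
    rw [Finset.range_orderEmbOfFin]
    exact toLex_mem_J.2 hk
  exact h.imp fun j hj => congrArg ofLex hj

/-! ### The isometric isomorphisms -/

/-- The operator `R_{H_m}` as a linear map to `L²(ℝⁿ)^d`. -/
def flatLinear (α : ℝ) [Fact (0 < α)] (n m : ℕ) : FlatFock α n m →ₗ[ℂ] Target n m :=
  (WithLp.linearEquiv 2 ℂ _).symm.toLinearMap ∘ₗ LinearMap.pi fun j =>
    (hermiteCoeff (phi n m j)).toLinearMap ∘ₗ (fourierTensorId n).toLinearMap ∘ₗ
      FlatFock.toLp α n m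

lemma flatLinear_apply (α : ℝ) [Fact (0 < α)] {m : ℕ} (g : FlatFock α n m) (j : Fin (dim n m)) :
    flatLinear α n m g j =
      hermiteCoeff (phi n m j) (fourierTensorId n (FlatFock.toLp α n m g)) := rfl

/-- This is Parseval: the coefficients outside the range of `phi` have degree at least `m` and
vanish, and `phi` lists the others without repetition. -/
lemma norm_flatLinear (α : ℝ) [Fact (0 < α)] {m : ℕ} (g : FlatFock α n m) :
    ‖flatLinear α n m g‖ = ‖g‖ := by
  have h1 : ‖g‖ = ‖fourierTensorId n (FlatFock.toLp α n m g)‖ := (norm_fourierTensorId _).symm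
  rw [h1, ← sq_eq_sq₀ (norm_nonneg _) (norm_nonneg _), PiLp.norm_sq_eq_of_L2,
    norm_sq_eq_sum_hermiteCoeff (Finset.univ.map ⟨phi n m, phi_injective n m⟩), Finset.sum_map]
  · rfl
  · intro k hk
    refine hermiteCoeff_fourierTensorId_eq_zero α g (not_lt.1 fun h => hk ?_)
    obtain ⟨j, rfl⟩ := exists_phi_eq h
    exact Finset.mem_map_of_mem _ (Finset.mem_univ j)

/-- Preimages of the lifts of the separate components can be added, because the coefficient of index
`k` sees only the lift of index `k`. -/
lemma flatLinear_surjective (α : ℝ) [Fact (0 < α)] (n m : ℕ) :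
    Function.Surjective (flatLinear α n m) := fun t => by
  choose g hg using fun j => exists_fourierTensorId_eq_hermiteLift α (sum_phi_lt j) (t j)
  refine ⟨∑ j, g j, PiLp.ext fun i => ?_⟩
  rw [flatLinear_apply]
  simp only [map_sum, hg, hermiteCoeff_hermiteLift,
    (phi_injective n m).eq_iff, Finset.sum_ite_eq, Finset.mem_univ, if_true]

/-- The operator `R_{H_m}` as an isometric isomorphism. -/
def flatIsometry (α : ℝ) [Fact (0 < α)] (n m : ℕ) : FlatFock α n m ≃ₗᵢ[ℂ] Target n m :=
  LinearIsometryEquiv.ofSurjective ⟨flatLinear α n m, norm_flatLinear α⟩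
    (flatLinear_surjective α n m)

lemma flatIsometry_ae_eq (α : ℝ) [Fact (0 < α)] {m : ℕ} (g : FlatFock α n m)
    (j : Fin (dim n m)) : flatIsometry α n m g j =ᵐ[muTilde n] fun ξ => RFlat α g ξ j :=
  (hermiteCoeff_ae_eq (phi n m j) (fourierTensorId n (FlatFock.toLp α n m g))).symm

lemma norm_U (α : ℝ) [Fact (0 < α)] {m : ℕ} (f : Fock α n m) : ‖U α n m f‖ = ‖f‖ := by
  rw [← sq_eq_sq₀ (norm_nonneg _) (norm_nonneg _)]
  exact (integral_norm_sq_toLp (memLp_flatten α f.2)).symm.trans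
    ((integral_norm_sq_flatten α f.1).trans (integral_norm_sq_toLp f.2.2))

/-- The flattening operator as an isometric isomorphism. -/
def flattenIsometry (α : ℝ) [Fact (0 < α)] (n m : ℕ) : Fock α n m ≃ₗᵢ[ℂ] FlatFock α n m :=
  LinearIsometryEquiv.ofSurjective ⟨U α n m, norm_U α⟩
    ((flatten α n).submoduleMap_surjective (Fock α n m))

/-! ### The integral formulas -/

/-- Boundedness at fixed `ξ` keeps the product with an integrable function integrable, which is what
Fubini requires. The bound uses `a t - t² ≤ a²`. -/
lemma exists_norm_qk_le (k : Fin n → ℕ) (ξ : E n) : ∃ C, ∀ v, ‖(qk k ξ v : ℂ)‖ ≤ C := by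
  obtain ⟨g, ⟨-, C, a, hC, -, hg⟩, h⟩ := exists_expBdd_hgauss_right ξ
    ((ExpBdd.const (qconst k)).mul (ExpBdd.prod Finset.univ fun r =>
      (expBdd_hvar_right ξ r).eval (hermitePoly (k r))))
  refine ⟨C * Real.exp (a ^ 2), fun v => ?_⟩
  have h1 : (qk k ξ v : ℂ) = g v * (Real.exp (-1 * ‖v‖ ^ 2) : ℂ) := by
    rw [← congrFun h v, qk_eq]
    push_cast
    ring
  rw [h1, norm_mul, norm_real, Real.norm_of_nonneg (Real.exp_pos _).le]
  refine (mul_le_mul_of_nonneg_right (hg v) (Real.exp_pos _).le).trans ?_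
  rw [mul_assoc, ← Real.exp_add]
  refine mul_le_mul_of_nonneg_left (Real.exp_le_exp.2 ?_) hC
  nlinarith [sq_nonneg (a - ‖v‖), sq_nonneg (a + ‖v‖), sq_nonneg a]

lemma integrable_mul_exp_mul_qk {ν : Measure (E n × E n)} {g : E n × E n → ℂ}
    (hg : Integrable g ν) (ξ : E n) (k : Fin n → ℕ) :
    Integrable (fun p => g p * cexp (-I * (inner ℝ p.1 ξ : ℝ)) * (qk k ξ p.2 : ℂ)) ν := by
  obtain ⟨C, hC⟩ := exists_norm_qk_le k ξ
  have h1 : Continuous fun p : E n × E n => cexp (-I * (inner ℝ p.1 ξ : ℝ)) := by fun_prop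
  have h2 : Continuous fun p : E n × E n => (qk k ξ p.2 : ℂ) := by fun_prop
  have h3 : ∀ p : E n × E n, ‖cexp (-I * (inner ℝ p.1 ξ : ℝ))‖ ≤ 1 := fun p => by
    rw [norm_exp]
    simp
  exact (hg.mul_bdd h1.aestronglyMeasurable (Filter.Eventually.of_forall h3)).mul_bdd
    h2.aestronglyMeasurable (Filter.Eventually.of_forall fun p => hC p.2)

lemma two_pi_rpow_mul (n : ℕ) :
    (2 * Real.pi) ^ (-(n : ℝ) / 2) * (2 * Real.pi) ^ (-(n : ℝ) / 2) *
      ((2 : ℝ) ^ ((n : ℝ) / 2) * Real.pi ^ ((n : ℝ) / 4)) =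
      1 / ((2 : ℝ) ^ ((n : ℝ) / 2) * Real.pi ^ (3 * (n : ℝ) / 4)) := by
  have hπ := Real.pi_pos
  rw [Real.mul_rpow (by norm_num) hπ.le, one_div, mul_inv, ← Real.rpow_neg (by norm_num),
    ← Real.rpow_neg hπ.le,
    show (-((n : ℝ) / 2)) = -(n : ℝ) / 2 + -(n : ℝ) / 2 + (n : ℝ) / 2 by ring,
    show -(3 * (n : ℝ) / 4) = -(n : ℝ) / 2 + -(n : ℝ) / 2 + (n : ℝ) / 4 by ring]
  simp only [Real.rpow_add hπ, Real.rpow_add (by norm_num : (0 : ℝ) < 2)]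
  ring

/-- Almost every slice of an integrable `g` is integrable, so `F ⊗ I` is there an honest Fourier
integral. Fubini joins it to the integral over `v`, and the constant collects one `(2π)^{-n/2}` from
each variable and the factor `2^{n/2} π^{n/4}` of `q`. -/
lemma RFlat_ae_eq_integral (α : ℝ) [Fact (0 < α)] {m : ℕ} (g : FlatFock α n m)
    (hg : Integrable g.1 volume) (j : Fin (dim n m)) :
    ∀ᵐ ξ : E n, RFlat α g ξ j =
      ((1 / ((2 : ℝ) ^ ((n : ℝ) / 2) * Real.pi ^ (3 * (n : ℝ) / 4)) : ℝ) : ℂ) *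
        ∫ p : E n × E n, g.1 p * cexp (-I * (inner ℝ p.1 ξ : ℝ)) * (hermiteProd j ξ p.2 : ℂ) := by
  have hc := FlatFock.continuous α g
  obtain ⟨hG, h⟩ := fourierTensorId_integral (FlatFock.memLp α g) hc.stronglyMeasurable
    (ae_muTilde_iff.2 (hg.prod_left_ae.mono fun v hv => integrable_muTilde_iff.2 hv))
  have h' : fourierTensorId n (FlatFock.toLp α n m g) = hG.toLp _ := h
  refine ae_muTilde_iff.1 ?_
  filter_upwards [Measure.ae_ae_of_ae_prod hG.coeFn_toLp] with ξ hξ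
  have hint : Integrable (fun p : E n × E n => g.1 p * cexp (-I * (inner ℝ p.1 ξ : ℝ)) *
      (q j ξ p.2 : ℂ)) (volume.prod volume) := by
    rw [Measure.volume_eq_prod] at hg
    simp only [q_eq_qk]
    exact integrable_mul_exp_mul_qk hg ξ (phi n m j)
  have e1 : RFlat α g ξ j = ∫ v, (∫ u, g.1 (u, v) * cexp (-I * (inner ℝ u ξ : ℝ)) ∂(muTilde n)) *
      (q j ξ v : ℂ) ∂(muTilde n) := by
    rw [RFlat, N, h']
    refine integral_congr_ae ?_
    filter_upwards [hξ] with v hv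
    rw [hv]
  have e2 : ∫ v, ∫ u, g.1 (u, v) * cexp (-I * (inner ℝ u ξ : ℝ)) * (q j ξ v : ℂ) =
      (((2 : ℝ) ^ ((n : ℝ) / 2) * Real.pi ^ ((n : ℝ) / 4) : ℝ) : ℂ) *
        ∫ p : E n × E n, g.1 p * cexp (-I * (inner ℝ p.1 ξ : ℝ)) * (hermiteProd j ξ p.2 : ℂ) := by
    rw [← integral_const_mul, Measure.volume_eq_prod]
    refine (integral_prod_symm _ hint).symm.trans (integral_congr_ae
      (Filter.Eventually.of_forall fun p => ?_))
    simp only [q, ofReal_mul]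
    ring
  simp only [e1, integral_muTilde, mul_assoc _ (∫ u, _ : ℂ), ← integral_mul_const]
  rw [integral_const_mul, e2, ← two_pi_rpow_mul]
  push_cast
  ring

lemma integrable_volume_of_integrable_muTilde2 {g : E n × E n → ℂ}
    (hg : Integrable g (muTilde2 n)) : Integrable g volume := by
  rw [Measure.volume_eq_prod, Measure.isAddLeftInvariant_eq_smul
    ((volume : Measure (E n)).prod (volume : Measure (E n))) (muTilde2 n)]
  exact hg.smul_measure_nnreal

/-- Since `|U f|` is `2^{n/2} |f| exp(-α|z|²/2)` at `z = (x+iy)/√α`, the hypothesis amounts to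
integrability of `U f`. The factor `2^{n/2}` cancels in the constant, and the phases `⟨u,v⟩` and
`⟨u,ξ⟩` merge. -/
lemma RFock_ae_eq_integral (α : ℝ) [Fact (0 < α)] {m : ℕ} (f : Fock α n m)
    (hf : Integrable fun z : Fin n → ℂ => ‖f.1 z‖ * Real.exp (-(α / 2) * ∑ r, ‖z r‖ ^ 2))
    (j : Fin (dim n m)) :
    ∀ᵐ ξ : E n, RFock α f ξ j = ((1 / Real.pi ^ (3 * (n : ℝ) / 4) : ℝ) : ℂ) *
      ∫ p : E n × E n, f.1 (cpoint α p) *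
        cexp (-(‖p.1‖ ^ 2 : ℝ) / 2 - (‖p.2‖ ^ 2 : ℝ) / 2 - I * (inner ℝ p.1 (p.2 + ξ) : ℝ)) *
          (hermiteProd j ξ p.2 : ℂ) := by
  have hg : Integrable (U α n m f).1 volume := by
    refine integrable_volume_of_integrable_muTilde2 ?_
    rw [← integrable_norm_iff (FlatFock.continuous α (U α n m f)).aestronglyMeasurable]
    exact (((integrable_comp_cpoint α).2 hf).const_mul ((2 : ℝ) ^ ((n : ℝ) / 2))).congr
      (Filter.Eventually.of_forall fun p => (norm_flatten α f.1 p).symm)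
  filter_upwards [RFlat_ae_eq_integral α (U α n m f) hg j] with ξ hξ
  have h2 : (((2 : ℝ) ^ ((n : ℝ) / 2) : ℝ) : ℂ) ≠ 0 := ofReal_ne_zero.2 (by positivity)
  have e : ∀ p : E n × E n, (U α n m f).1 p * cexp (-I * (inner ℝ p.1 ξ : ℝ)) *
      (hermiteProd j ξ p.2 : ℂ) = (((2 : ℝ) ^ ((n : ℝ) / 2) : ℝ) : ℂ) * (f.1 (cpoint α p) *
        cexp (-(‖p.1‖ ^ 2 : ℝ) / 2 - (‖p.2‖ ^ 2 : ℝ) / 2 - I * (inner ℝ p.1 (p.2 + ξ) : ℝ)) *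
          (hermiteProd j ξ p.2 : ℂ)) := fun p => by
    have h3 : (U α n m f).1 p = flatten α n f.1 p := rfl
    rw [h3, flatten_apply, inner_add_right,
      show -(‖p.1‖ ^ 2 : ℝ) / 2 - (‖p.2‖ ^ 2 : ℝ) / 2 -
        I * ((inner ℝ p.1 p.2 + inner ℝ p.1 ξ : ℝ) : ℂ) =
        (-(‖p.1‖ ^ 2 : ℝ) / 2 - (‖p.2‖ ^ 2 : ℝ) / 2 - I * (inner ℝ p.1 p.2 : ℝ)) +
          -I * (inner ℝ p.1 ξ : ℝ) by push_cast; ring, Complex.exp_add]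
    ring
  rw [RFock, hξ]
  simp only [e, integral_const_mul]
  rw [← mul_assoc, one_div, mul_inv, ofReal_mul, ofReal_inv,
    mul_comm (((2 : ℝ) ^ ((n : ℝ) / 2) : ℝ) : ℂ)⁻¹, inv_mul_cancel_right₀ h2, one_div]

end

end PolyFock

end

theorem mainTheorem3 (n m : ℕ) (hn : 1 ≤ n) (hm : 1 ≤ m) (α : ℝ) [Fact (0 < α)] :
    (∃ R : PolyFock.FlatFock α n m ≃ₗᵢ[ℂ] PolyFock.Target n m,
      ∀ g j, R g j =ᵐ[PolyFock.muTilde n] fun ξ => PolyFock.RFlat α g ξ j) ∧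
    (∀ g : PolyFock.FlatFock α n m, MeasureTheory.Integrable g.1 MeasureTheory.volume →
      ∀ j, ∀ᵐ ξ : PolyFock.E n,
        PolyFock.RFlat α g ξ j =
          ((1 / ((2 : ℝ) ^ ((n : ℝ) / 2) * Real.pi ^ (3 * (n : ℝ) / 4)) : ℝ) : ℂ) *
            ∫ p : PolyFock.E n × PolyFock.E n,
              g.1 p * Complex.exp (-Complex.I * (inner ℝ p.1 ξ : ℝ)) *
                (PolyFock.hermiteProd j ξ p.2 : ℂ)) ∧
    (∃ R : PolyFock.Fock α n m ≃ₗᵢ[ℂ] PolyFock.Target n m,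
      ∀ f j, R f j =ᵐ[PolyFock.muTilde n] fun ξ => PolyFock.RFock α f ξ j) ∧
    (∀ f : PolyFock.Fock α n m,
      MeasureTheory.Integrable
        (fun z : Fin n → ℂ => ‖f.1 z‖ * Real.exp (-(α / 2) * ∑ r, ‖z r‖ ^ 2))
        MeasureTheory.volume →
      ∀ j, ∀ᵐ ξ : PolyFock.E n,
        PolyFock.RFock α f ξ j =
          ((1 / Real.pi ^ (3 * (n : ℝ) / 4) : ℝ) : ℂ) *
            ∫ p : PolyFock.E n × PolyFock.E n,
              f.1 (fun r => ((p.1 r : ℂ) + Complex.I * (p.2 r : ℂ)) / (Real.sqrt α : ℂ)) *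
                Complex.exp (-(‖p.1‖ ^ 2 : ℝ) / 2 - (‖p.2‖ ^ 2 : ℝ) / 2
                  - Complex.I * (inner ℝ p.1 (p.2 + ξ) : ℝ)) *
                (PolyFock.hermiteProd j ξ p.2 : ℂ)) := by
  exact ⟨⟨PolyFock.flatIsometry α n m, PolyFock.flatIsometry_ae_eq α⟩,
    PolyFock.RFlat_ae_eq_integral α,
    ⟨(PolyFock.flattenIsometry α n m).trans (PolyFock.flatIsometry α n m),
      fun f => PolyFock.flatIsometry_ae_eq α (PolyFock.U α n m f)⟩,
    PolyFock.RFock_ae_eq_integral α⟩
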